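/- Let $0\le k\le n$ and let $g_0(x,\xi)=x_1\xi_1+\dots+x_{n-k}\xi_{n-k}-x_{n-k+1}\xi_{n-k+1}-\dots-x_n\xi_n$ on $\mathbb{R}^n$, with diagonal matrix $(\delta^k_{ij})$. Let $(g^{ij}(x))$ be real symmetric non-degenerate $n\times n$ matrices depending smoothly on $x\in\mathbb{R}^n$ which satisfy the long-range condition: for some $0<\mu<1$ and every multi-index $\alpha$ there is $C_\alpha$ with $\sum_{i,j}|\partial_x^\alpha(g^{ij}(x)-\delta^k_{ij})|\le C_\alpha\langle x\rangle^{-\mu-|\alpha|}$ for all $x\in\mathbb{R}^n$, where $\langle x\rangle=(1+|x|^2)^{1/2}$. Write $g_x(\eta,\eta)=\sum_{i,j}g^{ij}(x)\eta_i\eta_j$, and for an open interval $J$ set $$\Gamma^{\pm}(R,J,\sigma)=\Big\{(x,\xi)\in\mathbb{R}^{2n} : |x|>R,\ |\xi|^2\in J,\ \pm\frac{g_0(x,\xi)}{|x||\xi|}>-\sigma\Big\}.$$ **Theorem.** Let $J=(a,b)$ with $0<a<b<\infty$. There exist $R_0>0$ and $0<\sigma_0<1$ such that for every $0<\sigma<\sigma_0$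 there are real-valued functions $S_\pm\in C^\infty(\Gamma^\pm(R_0,J,\sigma))$ with $$g_x(\partial_xS_\pm(x,\xi),\partial_xS_\pm(x,\xi))=g_0(\xi,\xi),\qquad (x,\xi)\in\Gamma^\pm(R_0,J,\sigma),$$ and, for all multi-indices $\alpha,\beta$, with a constant $C_{\alpha\beta}>0$, $$|\partial_x^\alpha\partial_\xi^\beta(S_\pm(x,\xi)-x\cdot\xi)|\le C_{\alpha\beta}\langle x\rangle^{1-\mu},\qquad (x,\xi)\in\Gamma^\pm(R_0,J,\sigma).$$ Moreover, there exist $R'>0$ and families of real-valued functions $\{S_{\pm,R}\}_{R\ge R'}\subset C^\infty(\mathbb{R}^{2n})$ such that, for every $R\ge R'$, $S_{\pm,R}=S_\pm$ on $\Gamma^\pm(R,J,\sigma)$ and $$g_x(\partial_xS_{\pm,R}(x,\xi),\partial_xS_{\pm,R}(x,\xi))=g_0(\xi,\xi),\qquad (x,\xi)\in\Gamma^\pm(R,J,\sigma),$$ and such that for all $\alpha,\beta$ there is $C_{\alpha\beta}>0$ with, for all $R\ge 2R'$ and all $(x,\xi)\in\mathbb{R}^{2n}$, $$|\partial_x^\alpha\partial_\xi^\beta(S_{\pm,R}(x,\xi)-x\cdot\xi)|\le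 C_{\alpha\beta}\min\big(\langle x\rangle^{1-\mu-|\alpha|},R^{1-\mu-|\alpha|}\big)\quad\text{if }\alpha\neq0,$$ $$|\partial_\xi^\beta(S_{\pm,R}(x,\xi)-x\cdot\xi)|\le C_{0\beta}\langle x\rangle^{1-\mu}\quad\text{if }\alpha=0.$$ -/

import Mathlib

open scoped ContDiff

noncomputable section

namespace EikonalPhase

/-- Euclidean space of dimension `n`, with the Euclidean norm. -/
abbrev E (n : ℕ) := EuclideanSpace ℝ (Fin n)

/-- The Japanese bracket `⟨x⟩ = (1 + |x|²)^{1/2}`. -/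
def jap {n : ℕ} (x : E n) : ℝ := Real.sqrt (1 + ‖x‖ ^ 2)

/-- The order `|α| = α₁ + ⋯ + αₙ` of a multi-index. -/
def order {n : ℕ} (α : Fin n → ℕ) : ℕ := ∑ i, α i

/-- Iterated directional derivative `∂_{v₁} ⋯ ∂_{vₘ} f` along a list of vectors. -/
def dirDerivs {V : Type*} [NormedAddCommGroup V] [NormedSpace ℝ V] :
    List V → (V → ℝ) → V → ℝ
  | [], f => f
  | v :: L, f => fun p => fderiv ℝ (dirDerivs L f) p v

/-- The multi-index `α` spelled as a list of coordinates: `0` repeated `α 0` times, then `1`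
repeated `α 1` times, and so on. -/
def word {n : ℕ} (α : Fin n → ℕ) : List (Fin n) :=
  (List.finRange n).flatMap fun i => List.replicate (α i) i

/-- `∂^α f` for a function `f` on `ℝⁿ`. -/
def partialDeriv {n : ℕ} (α : Fin n → ℕ) (f : E n → ℝ) : E n → ℝ :=
  dirDerivs ((word α).map fun i => EuclideanSpace.single i (1 : ℝ)) f

/-- `∂_x^α ∂_ξ^β f` for a function `f` of `(x, ξ) ∈ ℝⁿ × ℝⁿ`. -/
def mixedDeriv {n : ℕ} (α β : Fin n → ℕ) (f : E n × E n → ℝ) : E n × E n → ℝ :=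
  dirDerivs
    (((word α).map fun i => ((EuclideanSpace.single i (1 : ℝ), 0) : E n × E n)) ++
      ((word β).map fun j => ((0, EuclideanSpace.single j (1 : ℝ)) : E n × E n))) f

/-- The `i`-th component of `∂_x S` at the point `p = (x, ξ)`. -/
def gradX {n : ℕ} (S : E n × E n → ℝ) (p : E n × E n) (i : Fin n) : ℝ :=
  fderiv ℝ S p (EuclideanSpace.single i (1 : ℝ), 0)

/-- The diagonal matrix `I_k` with `n - k` entries `1` followed by `k` entries `-1`. -/
def flatMatrix (n k : ℕ) : Matrix (Fin n) (Fin n) ℝ :=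
  Matrix.diagonal fun i => if (i : ℕ) + k < n then 1 else -1

/-- The bilinear form `∑ i j, A i j * η i * θ j` of a matrix `A`. -/
def bilin {n : ℕ} (A : Matrix (Fin n) (Fin n) ℝ) (η θ : Fin n → ℝ) : ℝ :=
  ∑ i, ∑ j, A i j * η i * θ j

/-- The flat form `g₀(x, ξ) = x₁ξ₁ + ⋯ + x_{n-k}ξ_{n-k} - x_{n-k+1}ξ_{n-k+1} - ⋯ - xₙξₙ`. -/
def g₀ {n : ℕ} (k : ℕ) (x ξ : E n) : ℝ := bilin (flatMatrix n k) x ξ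

/-- `G x = (g^{ij}(x))` is a smooth field of symmetric non-degenerate matrices on `ℝⁿ` which is a
long-range perturbation, of order `μ`, of the flat matrix `I_k`. (Hence `G x` has exactly `k`
negative eigenvalues for every `x`.) -/
structure IsLongRange {n : ℕ} (k : ℕ) (μ : ℝ) (G : E n → Matrix (Fin n) (Fin n) ℝ) : Prop where
  smooth : ∀ i j, ContDiff ℝ ∞ fun x => G x i j
  symm : ∀ x, (G x).IsSymm
  nondegenerate : ∀ x, (G x).det ≠ 0
  decay : ∀ α : Fin n → ℕ, ∃ C : ℝ, ∀ x : E n,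
    ∑ i, ∑ j, |partialDeriv α (fun y => G y i j - flatMatrix n k i j) x|
      ≤ C * jap x ^ (-μ - (order α : ℝ))

/-- The outgoing (`ε = 1`) and incoming (`ε = -1`) regions
`Γ^±(R, J, σ) = {(x, ξ) : |x| > R, |ξ|² ∈ J, ± g₀(x, ξ) / (|x||ξ|) > -σ}`. -/
def region {n : ℕ} (k : ℕ) (ε : ℤˣ) (R : ℝ) (J : Set ℝ) (σ : ℝ) : Set (E n × E n) :=
  {p | R < ‖p.1‖ ∧ ‖p.2‖ ^ 2 ∈ J ∧
    -σ < ((ε : ℤ) : ℝ) * (g₀ k p.1 p.2 / (‖p.1‖ * ‖p.2‖))}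

/-- The eikonal equation `g_x(∂_x S(x, ξ), ∂_x S(x, ξ)) = g₀(ξ, ξ)` on a set of `(x, ξ)`. -/
def SolvesEikonal {n : ℕ} (k : ℕ) (G : E n → Matrix (Fin n) (Fin n) ℝ)
    (S : E n × E n → ℝ) (U : Set (E n × E n)) : Prop :=
  ∀ p ∈ U, bilin (G p.1) (gradX S p) (gradX S p) = g₀ k p.2 p.2

/-- The function `(x, ξ) ↦ S(x, ξ) - x · ξ`. -/
def deviation {n : ℕ} (S : E n × E n → ℝ) : E n × E n → ℝ :=
  fun p => S p - inner ℝ p.1 p.2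

end EikonalPhase

end

open scoped ContDiff

noncomputable section

set_option maxSynthPendingDepth 5

namespace EikonalPhase

open Set Filter Topology MeasureTheory BoundedContinuousFunction

/-! ### Calculus of families of smooth functions with uniformly bounded derivatives. -/

section UniformlySmooth

universe u

variable {ι κ : Type*} {V W X Y : Type*} [NormedAddCommGroup V] [NormedSpace ℝ V]
  [NormedAddCommGroup W] [NormedSpace ℝ W] [NormedAddCommGroup X] [NormedSpace ℝ X]
  [NormedAddCommGroup Y] [NormedSpace ℝ Y]

/-! The outgoing phase generates the classical flow of `g_x(η, η)` with mixed boundary data. For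
outgoing `(x, ξ)`, let `(x(t), η(t))` be the Hamiltonian trajectory with `x(0) = x` and `η(t) → ξ`
as `t → ∞`. Then `S` is sought with `∂_x S = η(0)`. So these trajectories must depend smoothly on
the data with uniform bounds, `η(0) - ξ` must be a gradient in `x` of size `|x|^{-μ}`, and energy
must be conserved.

Trajectories. After scaling position and time by `ρ`, the Hamiltonian is `g₀(η, η)` plus `ρ^{-μ}
⟨t⟩^{-μ} P`. Cutting off small `|X|/⟨t⟩` and large `|η|` gives `P` bounded derivatives of every
order on all of phase space, uniformly in the scale. On bounded continuous paths, with positions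
divided by `⟨t⟩`, the boundary value problem becomes `u = free path + N(u)`, where `N` and its
derivatives are `O(ρ^{-μ})`. For `ρ ≥ r` it is solved by inverting `1 - N` globally
(`tameOn_fixedPointMap`), which gives `IsScale.exists_shift_bound`. Over the enlarged outgoing
region the free path satisfies `|X| ≥ 2c⟨t⟩` (`norm_freePath_ge`), so the true path never meets the
cutoffs (`margin`), and conservation of energy is the eikonal equation (`energy_eq`).

Gradient. For two variations that fix `ξ`, the symplectic form is constant in time. It tends to `0`,
because such variations grow at most like `⟨t⟩^{1/4}` in position and decay at least like
`⟨t⟩^{-3/4}` in momentum (`IsScale.fderiv_path_decay`). At time `0` this says that the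
`x`-derivative of the shift is symmetric (`IsScale.fderiv_shift_symm`). The cut-off shift is defined
everywhere, so the Poincaré lemma along rays yields a potential (`fderiv_potential`).

Bounds. Uniqueness makes the shifts at different scales dilates of one another (`shift_dilate`).
Hence the dilates of the shift at the single scale `r`, suitably weighted, are uniformly smooth.
Integration along rays costs `∫₀¹ s^{-μ} ds`, finite since `μ < 1`, and bounds the dilated potential
on the shell `1/2 < |y| < 2`. Undoing the dilation by `|x|` turns each `x`-derivative into a factor
`|x|^{-1}`.

The functions `S_{+,R}` multiply the correction `S_+ - x · ξ` by cutoffs homogeneous of degree zero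
or adapted to `|x| ~ R`. The incoming case is the reflection `S_-(x, ξ) = -S_+(x, -ξ)`. -/

/-- A family of smooth functions on open sets all of whose derivatives of positive order are
bounded, uniformly in the family. -/
structure TameOn (f : ι → V → W) (s : ι → Set V) : Prop where
  isOpen : ∀ i, IsOpen (s i)
  contDiffOn : ∀ i, ContDiffOn ℝ ∞ (f i) (s i)
  bound : ∀ j : ℕ, 1 ≤ j → ∃ C : ℝ, ∀ i, ∀ v ∈ s i, ‖iteratedFDeriv ℝ j (f i) v‖ ≤ C

/-- A family of smooth functions on open sets all of whose derivatives are bounded, uniformly in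
the family. -/
structure UnifSmoothOn (f : ι → V → W) (s : ι → Set V) : Prop where
  isOpen : ∀ i, IsOpen (s i)
  contDiffOn : ∀ i, ContDiffOn ℝ ∞ (f i) (s i)
  bound : ∀ j : ℕ, ∃ C : ℝ, ∀ i, ∀ v ∈ s i, ‖iteratedFDeriv ℝ j (f i) v‖ ≤ C

theorem UnifSmoothOn.tameOn {f : ι → V → W} {s : ι → Set V} (h : UnifSmoothOn f s) :
    TameOn f s :=
  ⟨h.isOpen, h.contDiffOn, fun j _ => h.bound j⟩

theorem TameOn.bound_uniform {f : ι → V → W} {s : ι → Set V} (h : TameOn f s) (n : ℕ) :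
    ∃ D : ℝ, 1 ≤ D ∧ ∀ j, 1 ≤ j → j ≤ n → ∀ i, ∀ v ∈ s i, ‖iteratedFDeriv ℝ j (f i) v‖ ≤ D := by
  induction n with
  | zero => exact ⟨1, le_rfl, fun j h1 h0 => by omega⟩
  | succ n ih =>
    obtain ⟨D, hD1, hD⟩ := ih
    obtain ⟨C, hC⟩ := h.bound (n + 1) (by omega)
    refine ⟨max D C, hD1.trans (le_max_left _ _), fun j h1 hj i v hv => ?_⟩
    rcases Nat.lt_or_ge j (n + 1) with hlt | hge
    · exact (hD j h1 (by omega) i v hv).trans (le_max_left _ _)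
    · obtain rfl : j = n + 1 := by omega
      exact (hC i v hv).trans (le_max_right _ _)

theorem UnifSmoothOn.bound_uniform {f : ι → V → W} {s : ι → Set V} (h : UnifSmoothOn f s)
    (n : ℕ) :
    ∃ D : ℝ, 1 ≤ D ∧ ∀ j, j ≤ n → ∀ i, ∀ v ∈ s i, ‖iteratedFDeriv ℝ j (f i) v‖ ≤ D := by
  obtain ⟨D, hD1, hD⟩ := h.tameOn.bound_uniform n
  obtain ⟨C, hC⟩ := h.bound 0
  refine ⟨max D C, hD1.trans (le_max_left _ _), fun j hj i v hv => ?_⟩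
  rcases Nat.eq_zero_or_pos j with rfl | hpos
  · exact (hC i v hv).trans (le_max_right _ _)
  · exact (hD j hpos hj i v hv).trans (le_max_left _ _)

theorem UnifSmoothOn.contDiffAt {f : ι → V → W} {s : ι → Set V} (h : UnifSmoothOn f s) (i : ι)
    {v : V} (hv : v ∈ s i) : ContDiffAt ℝ ∞ (f i) v :=
  (h.contDiffOn i).contDiffAt ((h.isOpen i).mem_nhds hv)

theorem UnifSmoothOn.mono {f : ι → V → W} {s t : ι → Set V} (h : UnifSmoothOn f s)
    (ht : ∀ i, IsOpen (t i)) (hts : ∀ i, t i ⊆ s i) : UnifSmoothOn f t :=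
  ⟨ht, fun i => (h.contDiffOn i).mono (hts i), fun j =>
    (h.bound j).imp fun _ hC i v hv => hC i v (hts i hv)⟩

theorem UnifSmoothOn.reindex {f : ι → V → W} {s : ι → Set V} (h : UnifSmoothOn f s)
    (e : κ → ι) : UnifSmoothOn (fun k => f (e k)) fun k => s (e k) :=
  ⟨fun _ => h.isOpen _, fun _ => h.contDiffOn _, fun j =>
    (h.bound j).imp fun _ hC k v hv => hC (e k) v hv⟩

theorem UnifSmoothOn.congr {f g : ι → V → W} {s : ι → Set V} (h : UnifSmoothOn f s)
    (hfg : ∀ i, EqOn (g i) (f i) (s i)) : UnifSmoothOn g s := by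
  refine ⟨h.isOpen, fun i => (h.contDiffOn i).congr (hfg i), fun j => ?_⟩
  obtain ⟨C, hC⟩ := h.bound j
  refine ⟨C, fun i v hv => ?_⟩
  rw [Filter.EventuallyEq.iteratedFDeriv ℝ
    (eventuallyEq_of_mem ((h.isOpen i).mem_nhds hv) (hfg i)) j |>.eq_of_nhds]
  exact hC i v hv

theorem UnifSmoothOn.union {f : ι → V → W} {s t : ι → Set V} (hs : UnifSmoothOn f s)
    (ht : UnifSmoothOn f t) : UnifSmoothOn f fun i => s i ∪ t i := by
  refine ⟨fun i => (hs.isOpen i).union (ht.isOpen i), fun i v hv => ?_, fun j => ?_⟩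
  · rcases hv with hv | hv
    · exact (hs.contDiffAt i hv).contDiffWithinAt
    · exact (ht.contDiffAt i hv).contDiffWithinAt
  · obtain ⟨C, hC⟩ := hs.bound j
    obtain ⟨D, hD⟩ := ht.bound j
    refine ⟨max C D, fun i v hv => ?_⟩
    rcases hv with hv | hv
    · exact (hC i v hv).trans (le_max_left _ _)
    · exact (hD i v hv).trans (le_max_right _ _)

theorem UnifSmoothOn.sum {ν : Type*} (A : Finset ν) {f : ν → ι → V → W} {s : ι → Set V}
    (hs : ∀ i, IsOpen (s i)) (h : ∀ a ∈ A, UnifSmoothOn (f a) s) :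
    UnifSmoothOn (fun i v => ∑ a ∈ A, f a i v) s := by
  refine ⟨hs, fun i => ContDiffOn.sum fun a ha => (h a ha).contDiffOn i, fun j => ?_⟩
  choose! C hC using fun a (ha : a ∈ A) => (h a ha).bound j
  refine ⟨∑ a ∈ A, C a, fun i v hv => ?_⟩
  rw [← iteratedFDerivWithin_of_isOpen j (hs i) hv,
    iteratedFDerivWithin_fun_sum_apply (hs i).uniqueDiffOn hv
      (fun a ha => (((h a ha).contDiffOn i) v hv).of_le (by exact_mod_cast le_top))]
  refine (norm_sum_le _ _).trans (Finset.sum_le_sum fun a ha => ?_)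
  rw [iteratedFDerivWithin_of_isOpen j (hs i) hv]
  exact hC a ha i v hv

theorem UnifSmoothOn.const_of_bounded {c : ι → W} {C : ℝ} (hc : ∀ i, ‖c i‖ ≤ C) :
    UnifSmoothOn (fun i (_ : V) => c i) fun _ => univ := by
  refine ⟨fun _ => isOpen_univ, fun i => contDiffOn_const, fun j => ⟨max C 0, fun i v _ => ?_⟩⟩
  rcases Nat.eq_zero_or_pos j with rfl | hj
  · rw [norm_iteratedFDeriv_zero]
    exact (hc i).trans (le_max_left _ _)
  · rw [iteratedFDeriv_const_of_ne (by omega)]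
    simp

theorem UnifSmoothOn.bilinear (B : W →L[ℝ] X →L[ℝ] Y) {f : ι → V → W} {g : ι → V → X}
    {s : ι → Set V} (hf : UnifSmoothOn f s) (hg : UnifSmoothOn g s) :
    UnifSmoothOn (fun i v => B (f i v) (g i v)) s := by
  refine ⟨hf.isOpen, fun i => B.isBoundedBilinearMap.contDiff.comp₂_contDiffOn
    (hf.contDiffOn i) (hg.contDiffOn i), fun n => ?_⟩
  obtain ⟨C, hC1, hC⟩ := hf.bound_uniform n
  obtain ⟨D, hD1, hD⟩ := hg.bound_uniform n
  refine ⟨‖B‖ * ∑ i ∈ Finset.range (n + 1), (n.choose i : ℝ) * C * D, fun i v hv => ?_⟩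
  have := B.norm_iteratedFDerivWithin_le_of_bilinear (hf.contDiffOn i) (hg.contDiffOn i)
    (hf.isOpen i).uniqueDiffOn hv (n := n) (by exact_mod_cast le_top)
  simp only [iteratedFDerivWithin_of_isOpen _ (hf.isOpen i) hv] at this
  refine this.trans ?_
  gcongr with k hk
  · exact hC k (by simpa [Nat.lt_succ_iff] using hk) i v hv
  · exact hD _ (Nat.sub_le _ _) i v hv

theorem UnifSmoothOn.clm_comp (A : W →L[ℝ] X) {f : ι → V → W} {s : ι → Set V}
    (hf : UnifSmoothOn f s) : UnifSmoothOn (fun i v => A (f i v)) s := by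
  refine ⟨hf.isOpen, fun i => A.contDiff.comp_contDiffOn (hf.contDiffOn i), fun n => ?_⟩
  obtain ⟨C, hC⟩ := hf.bound n
  refine ⟨‖A‖ * C, fun i v hv => ?_⟩
  refine (A.norm_iteratedFDeriv_comp_left (hf.contDiffAt i hv) (by exact_mod_cast le_top)).trans ?_
  gcongr
  exact hC i v hv

/-- In the formula for derivatives of a composite, the inner map enters only through its derivatives
of positive order. It may therefore be unbounded, as linear maps and the solution map of the fixed
point equation are. -/
theorem UnifSmoothOn.comp {g : ι → W → X} {f : ι → V → W} {s : ι → Set V} {t : ι → Set W}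
    (hg : UnifSmoothOn g t) (hf : TameOn f s) (hst : ∀ i, MapsTo (f i) (s i) (t i)) :
    UnifSmoothOn (fun i v => g i (f i v)) s := by
  refine ⟨hf.isOpen, fun i => (hg.contDiffOn i).comp (hf.contDiffOn i) (hst i), fun n => ?_⟩
  obtain ⟨C, hC1, hC⟩ := hg.bound_uniform n
  obtain ⟨D, hD1, hD⟩ := hf.bound_uniform n
  refine ⟨n.factorial * C * D ^ n, fun i v hv => ?_⟩
  have := norm_iteratedFDerivWithin_comp_le (n := n) (hg.contDiffOn i) (hf.contDiffOn i)
    (by exact_mod_cast le_top) (hg.isOpen i).uniqueDiffOn (hf.isOpen i).uniqueDiffOn (hst i) hv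
    (C := C) (D := D) (fun j hj => ?_) (fun j h1 hj => ?_)
  · rwa [iteratedFDerivWithin_of_isOpen _ (hf.isOpen i) hv] at this
  · rw [iteratedFDerivWithin_of_isOpen _ (hg.isOpen i) (hst i hv)]
    exact hC j hj i _ (hst i hv)
  · rw [iteratedFDerivWithin_of_isOpen _ (hf.isOpen i) hv]
    -- The estimate for composites asks for `D ^ j`; `D ≥ 1` lets a single `D` serve all orders.
    exact (hD j h1 hj i v hv).trans (le_self_pow₀ hD1 (by omega))

theorem TameOn.unifSmoothOn_fderiv {f : ι → V → W} {s : ι → Set V} (h : TameOn f s) :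
    UnifSmoothOn (fun i => fderiv ℝ (f i)) s := by
  refine ⟨h.isOpen, fun i => (h.contDiffOn i).fderiv_of_isOpen (h.isOpen i) (by simp), fun j => ?_⟩
  obtain ⟨C, hC⟩ := h.bound (j + 1) (by omega)
  refine ⟨C, fun i v hv => ?_⟩
  rw [norm_iteratedFDeriv_fderiv]
  exact hC i v hv

theorem TameOn.of_fderiv {f : ι → V → W} {s : ι → Set V} (hs : ∀ i, IsOpen (s i))
    (hf : ∀ i, ContDiffOn ℝ ∞ (f i) (s i))
    (h : ∀ j : ℕ, ∃ C : ℝ, ∀ i, ∀ v ∈ s i, ‖iteratedFDeriv ℝ j (fderiv ℝ (f i)) v‖ ≤ C) :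
    TameOn f s := by
  refine ⟨hs, hf, fun j hj => ?_⟩
  obtain ⟨C, hC⟩ := h (j - 1)
  refine ⟨C, fun i v hv => ?_⟩
  have := hC i v hv
  rwa [norm_iteratedFDeriv_fderiv, Nat.sub_add_cancel hj] at this

theorem TameOn.of_clm {A : ι → V →L[ℝ] W} {C : ℝ} (hA : ∀ i, ‖A i‖ ≤ C) :
    TameOn (fun i v => A i v) fun _ => univ := by
  refine TameOn.of_fderiv (fun _ => isOpen_univ) (fun i => (A i).contDiff.contDiffOn) ?_
  have h : ∀ i, fderiv ℝ (fun v => A i v) = fun _ => A i := fun i => by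
    ext1 v; exact (A i).fderiv
  simp only [h]
  exact (UnifSmoothOn.const_of_bounded hA).bound

/-- By the chain rule the derivative of the composite is a bilinear expression in two families
bounded with all derivatives, so the values themselves need no bound. -/
theorem TameOn.comp_tame {g : ι → W → X} {f : ι → V → W} {s : ι → Set V} {t : ι → Set W}
    (hg : TameOn g t) (hf : TameOn f s) (hst : ∀ i, MapsTo (f i) (s i) (t i)) :
    TameOn (fun i v => g i (f i v)) s := by
  refine TameOn.of_fderiv hf.isOpen
    (fun i => (hg.contDiffOn i).comp (hf.contDiffOn i) (hst i)) ?_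
  have h := (hg.unifSmoothOn_fderiv.comp hf hst).bilinear (ContinuousLinearMap.compL ℝ V W X) hf.unifSmoothOn_fderiv
  refine (h.congr fun i v hv => ?_).bound
  have h1 : DifferentiableAt ℝ (g i) (f i v) :=
    (((hg.contDiffOn i).contDiffAt ((hg.isOpen i).mem_nhds (hst i hv))).differentiableAt (by simp))
  have h2 : DifferentiableAt ℝ (f i) v :=
    (((hf.contDiffOn i).contDiffAt ((hf.isOpen i).mem_nhds hv)).differentiableAt (by simp))
  exact fderiv_comp v h1 h2

end UniformlySmooth

/-! ### Smoothness of superposition operators on bounded continuous paths. -/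

section Nemytskii

universe u

variable {ι : Type*} {V W : Type u} [NormedAddCommGroup V] [NormedSpace ℝ V]
  [NormedAddCommGroup W] [NormedSpace ℝ W]

open Classical in
/-- The superposition operator `u ↦ (t ↦ F t (u t))` on bounded continuous functions. -/
def nemytskii (F : ℝ → V → W) (u : ℝ →ᵇ V) : ℝ →ᵇ W :=
  if h : Continuous (fun t => F t (u t)) ∧ ∃ C : ℝ, ∀ t, ‖F t (u t)‖ ≤ C then
    BoundedContinuousFunction.ofNormedAddCommGroup _ h.1 h.2.choose h.2.choose_spec
  -- This default never occurs for families in `UnifSmoothPaths`; see `nemytskii_apply`.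
  else 0

/-- Pointwise application of operator-valued functions. -/
def applyPointwise : (ℝ →ᵇ (V →L[ℝ] W)) →L[ℝ] (ℝ →ᵇ V) →L[ℝ] (ℝ →ᵇ W) :=
  LinearMap.mkContinuous₂
    (LinearMap.mk₂ ℝ
      (fun (A : ℝ →ᵇ (V →L[ℝ] W)) (u : ℝ →ᵇ V) =>
        BoundedContinuousFunction.ofNormedAddCommGroup (fun t => A t (u t))
        (A.continuous.clm_apply u.continuous) (‖A‖ * ‖u‖) fun t =>
          ((A t).le_opNorm _).trans (by gcongr <;> exact norm_coe_le_norm _ t))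
      (fun A B u => by ext t; simp) (fun c A u => by ext t; simp)
      (fun A u v => by ext t; simp) (fun c A u => by ext t; simp))
    1 fun A u => by
      rw [one_mul]
      exact (BoundedContinuousFunction.norm_le (by positivity)).2 fun t =>
        ((A t).le_opNorm _).trans (by gcongr <;> exact norm_coe_le_norm _ t)

@[simp]
theorem applyPointwise_apply (A : ℝ →ᵇ (V →L[ℝ] W)) (u : ℝ →ᵇ V) (t : ℝ) :
    applyPointwise A u t = A t (u t) := rfl

theorem norm_applyPointwise_apply_le (A : ℝ →ᵇ (V →L[ℝ] W)) (u : ℝ →ᵇ V) :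
    ‖applyPointwise A u‖ ≤ ‖A‖ * ‖u‖ := by
  refine (BoundedContinuousFunction.norm_le (by positivity)).2 fun t => ?_
  exact ((A t).le_opNorm _).trans (by gcongr <;> exact norm_coe_le_norm _ t)

/-- A family of jointly smooth functions `F i t v`, all of whose derivatives in `v` are bounded,
uniformly in `i` and `t`. -/
structure UnifSmoothPaths (F : ι → ℝ → V → W) : Prop where
  contDiff : ∀ i, ContDiff ℝ ∞ fun p : ℝ × V => F i p.1 p.2
  unif : UnifSmoothOn (fun p : ι × ℝ => F p.1 p.2) fun _ => univ

theorem UnifSmoothPaths.contDiff_right {F : ι → ℝ → V → W} (hF : UnifSmoothPaths F) (i : ι)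
    (t : ℝ) : ContDiff ℝ ∞ (F i t) :=
  (hF.contDiff i).comp (contDiff_prodMk_right t)

theorem UnifSmoothPaths.nemytskii_apply {F : ι → ℝ → V → W} (hF : UnifSmoothPaths F) (i : ι)
    (u : ℝ →ᵇ V) (t : ℝ) : nemytskii (F i) u t = F i t (u t) := by
  have h : Continuous (fun t => F i t (u t)) ∧ ∃ C : ℝ, ∀ t, ‖F i t (u t)‖ ≤ C := by
    refine ⟨(hF.contDiff i).continuous.comp (continuous_id.prodMk u.continuous), ?_⟩
    obtain ⟨C, hC⟩ := hF.unif.bound 0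
    exact ⟨C, fun t => by simpa using hC (i, t) (u t) (mem_univ _)⟩
  rw [nemytskii, dif_pos h]
  rfl

theorem UnifSmoothPaths.norm_nemytskii_le {F : ι → ℝ → V → W} (hF : UnifSmoothPaths F) :
    ∃ C : ℝ, ∀ i u, ‖nemytskii (F i) u‖ ≤ C := by
  obtain ⟨C, hC⟩ := hF.unif.bound 0
  refine ⟨max C 0, fun i u => (BoundedContinuousFunction.norm_le (le_max_right _ _)).2 fun t => ?_⟩
  rw [hF.nemytskii_apply]
  exact (by simpa using hC (i, t) (u t) (mem_univ _) : ‖F i t (u t)‖ ≤ C).trans (le_max_left _ _)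

theorem UnifSmoothPaths.fderiv {F : ι → ℝ → V → W} (hF : UnifSmoothPaths F) :
    UnifSmoothPaths fun i t => fderiv ℝ (F i t) := by
  refine ⟨fun i => ?_, hF.unif.tameOn.unifSmoothOn_fderiv⟩
  exact ContDiff.fderiv (f := fun (p : ℝ × V) v => F i p.1 v) (g := fun p => p.2) (m := ∞) (n := ∞)
    ((hF.contDiff i).comp ((contDiff_fst.comp contDiff_fst).prodMk contDiff_snd))
    contDiff_snd (by simp)

/-- A bound on the second derivative of `F i t`, uniform in `t`, makes the pointwise Taylor
remainder quadratic with one constant for all times, hence quadratic in the supremum norm. -/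
theorem UnifSmoothPaths.hasFDerivAt_nemytskii {F : ι → ℝ → V → W} (hF : UnifSmoothPaths F)
    (i : ι) (u : ℝ →ᵇ V) :
    HasFDerivAt (nemytskii (F i))
      (applyPointwise (nemytskii (fun t => _root_.fderiv ℝ (F i t)) u)) u := by
  obtain ⟨C, hC⟩ := hF.fderiv.unif.bound 1
  have hC0 : 0 ≤ C := (norm_nonneg _).trans (hC (i, 0) 0 (mem_univ _))
  have key : ∀ t (v h : V),
      ‖F i t (v + h) - F i t v - _root_.fderiv ℝ (F i t) v h‖ ≤ C * ‖h‖ * ‖h‖ := by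
    intro t v h
    have hd : ∀ x, DifferentiableAt ℝ (F i t) x := fun x =>
      (hF.contDiff_right i t).differentiable (by simp) x
    have hl : ∀ x ∈ segment ℝ v (v + h),
        ‖_root_.fderiv ℝ (F i t) x - _root_.fderiv ℝ (F i t) v‖ ≤ C * ‖h‖ := by
      intro x hx
      have h1 : ‖_root_.fderiv ℝ (F i t) x - _root_.fderiv ℝ (F i t) v‖ ≤ C * ‖x - v‖ :=
        convex_univ.norm_image_sub_le_of_norm_fderiv_le (f := _root_.fderiv ℝ (F i t)) (𝕜 := ℝ)
          (fun y _ => (hF.fderiv.contDiff_right i t).differentiable (by simp) y)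
          (fun y _ => by
            have := hC (i, t) y (mem_univ _)
            rwa [← norm_iteratedFDeriv_fderiv (n := 0), norm_iteratedFDeriv_zero] at this)
          (mem_univ _) (mem_univ _)
      refine h1.trans (mul_le_mul_of_nonneg_left ?_ hC0)
      have := norm_sub_le_of_mem_segment hx
      simpa using this
    have := (convex_segment v (v + h)).norm_image_sub_le_of_norm_hasFDerivWithin_le'
      (fun x hx => (hd x).hasFDerivAt.hasFDerivWithinAt) hl
      (left_mem_segment ℝ v (v + h)) (right_mem_segment ℝ v (v + h))
    simpa using this
  refine HasFDerivAt.of_isLittleO ?_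
  refine Asymptotics.IsBigO.trans_isLittleO (g := fun w => ‖w - u‖ * ‖w - u‖) ?_ ?_
  · refine Asymptotics.IsBigO.of_bound C (Eventually.of_forall fun w => ?_)
    rw [norm_mul, norm_norm]
    refine (BoundedContinuousFunction.norm_le (by positivity)).2 fun t => ?_
    have h1 := key t (u t) ((w - u) t)
    have h2 : ‖(w - u) t‖ ≤ ‖w - u‖ := norm_coe_le_norm _ t
    simp only [BoundedContinuousFunction.sub_apply, applyPointwise_apply, hF.nemytskii_apply,
      hF.fderiv.nemytskii_apply] at h1 h2 ⊢
    rw [add_sub_cancel] at h1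
    refine h1.trans ?_
    rw [mul_assoc]
    gcongr
  · have h1 : (fun w : ℝ →ᵇ V => ‖w - u‖) =o[𝓝 u] fun _ => (1 : ℝ) := by
      rw [Asymptotics.isLittleO_one_iff]
      exact tendsto_norm_sub_self u
    simpa using h1.mul_isBigO (Asymptotics.isBigO_refl (fun w : ℝ →ᵇ V => w - u) (𝓝 u)).norm_norm

theorem contDiff_clm_comp {X Y Z : Type*} [NormedAddCommGroup X] [NormedSpace ℝ X]
    [NormedAddCommGroup Y] [NormedSpace ℝ Y] [NormedAddCommGroup Z] [NormedSpace ℝ Z]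
    (A : Y →L[ℝ] Z) {n : ℕ} {f : X → Y} (hf : ContDiff ℝ n f) :
    ContDiff ℝ n (fun x => A (f x)) ∧
      ∀ x, ‖iteratedFDeriv ℝ n (fun x => A (f x)) x‖ ≤ ‖A‖ * ‖iteratedFDeriv ℝ n f x‖ :=
  ⟨A.contDiff.comp hf, fun _ => A.norm_iteratedFDeriv_comp_left hf.contDiffAt le_rfl⟩

/-- The derivative of a superposition operator is the superposition operator of the derivative
followed by the fixed linear map `applyPointwise`. Since the target changes from `W` to `V →L[ℝ] W`,
the induction must quantify over `W`. -/
theorem UnifSmoothPaths.contDiff_and_bound (n : ℕ) : ∀ {W : Type u} [NormedAddCommGroup W]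
    [NormedSpace ℝ W] {F : ι → ℝ → V → W}, UnifSmoothPaths F →
    (∀ i, ContDiff ℝ n (nemytskii (F i))) ∧
      ∃ C : ℝ, ∀ i u, ‖iteratedFDeriv ℝ n (nemytskii (F i)) u‖ ≤ C := by
  induction n with
  | zero =>
    intro W _ _ F hF
    refine ⟨fun i => ?_, ?_⟩
    · rw [Nat.cast_zero, contDiff_zero]
      exact continuous_iff_continuousAt.2 fun u => (hF.hasFDerivAt_nemytskii i u).continuousAt
    · simpa using hF.norm_nemytskii_le
  | succ n ih =>
    intro W _ _ F hF
    have hd : ∀ i, _root_.fderiv ℝ (nemytskii (F i)) =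
        fun u => applyPointwise (nemytskii (fun t => _root_.fderiv ℝ (F i t)) u) := fun i => by
      ext1 u; exact (hF.hasFDerivAt_nemytskii i u).fderiv
    obtain ⟨h1, C, h2⟩ := ih hF.fderiv
    have h3 := fun i => contDiff_clm_comp (X := ℝ →ᵇ V) (Y := ℝ →ᵇ (V →L[ℝ] W))
      (Z := (ℝ →ᵇ V) →L[ℝ] (ℝ →ᵇ W)) applyPointwise (h1 i)
    refine ⟨fun i => ?_, ‖(applyPointwise : (ℝ →ᵇ (V →L[ℝ] W)) →L[ℝ]
      ((ℝ →ᵇ V) →L[ℝ] (ℝ →ᵇ W)))‖ * C, fun i u => ?_⟩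
    · rw [Nat.cast_add, Nat.cast_one, contDiff_succ_iff_fderiv]
      refine ⟨fun u => (hF.hasFDerivAt_nemytskii i u).differentiableAt, by simp, ?_⟩
      rw [hd]
      exact (h3 i).1
    · rw [← norm_iteratedFDeriv_fderiv, hd]
      refine ((h3 i).2 u).trans ?_
      gcongr
      exact h2 i u

theorem UnifSmoothPaths.nemytskii {F : ι → ℝ → V → W} (hF : UnifSmoothPaths F) :
    UnifSmoothOn (fun i => nemytskii (F i)) fun _ => univ :=
  ⟨fun _ => isOpen_univ,
    fun i => (contDiff_infty.2 fun n => (hF.contDiff_and_bound n).1 i).contDiffOn,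
    fun n => (hF.contDiff_and_bound n).2.imp fun _ hC i u _ => hC i u⟩

end Nemytskii

/-! ### Global inversion of a contractive perturbation of the identity. -/

section GlobalInverse

variable {P : Type*} [NormedAddCommGroup P] [NormedSpace ℝ P]

theorem lipschitz_of_fderiv_le_half {N : P → P} (hN : ContDiff ℝ ∞ N)
    (hd : ∀ u, ‖fderiv ℝ N u‖ ≤ 1 / 2) (u v : P) : ‖N u - N v‖ ≤ 1 / 2 * ‖u - v‖ :=
  convex_univ.norm_image_sub_le_of_norm_fderiv_le (𝕜 := ℝ)
    (fun x _ => hN.differentiable (by simp) x) (fun x _ => hd x) (mem_univ _) (mem_univ _)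

variable [CompleteSpace P]

/-- The map approximates the identity with constant `1/2`, below the inverse norm of the identity,
so the global form of the inverse function theorem applies. -/
theorem exists_homeomorph_sub {N : P → P} (hN : ContDiff ℝ ∞ N)
    (hd : ∀ u, ‖fderiv ℝ N u‖ ≤ 1 / 2) : ∃ f : P ≃ₜ P, ∀ u, f u = u - N u := by
  have hA : ApproximatesLinearOn (fun u => u - N u)
      ((ContinuousLinearEquiv.refl ℝ P : P ≃L[ℝ] P) : P →L[ℝ] P) univ (1 / 2) := by
    intro x _ y _
    have h := lipschitz_of_fderiv_le_half hN hd x y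
    have h2 : x - N x - (y - N y) -
        ((ContinuousLinearEquiv.refl ℝ P : P ≃L[ℝ] P) : P →L[ℝ] P) (x - y) = -(N x - N y) := by
      simp only [ContinuousLinearEquiv.coe_refl, ContinuousLinearMap.coe_id', id_eq]
      abel
    rw [h2, norm_neg]
    simpa using h
  refine ⟨hA.toHomeomorph _ ?_, fun u => rfl⟩
  rcases subsingleton_or_nontrivial P with hs | hn
  · exact Or.inl hs
  · refine Or.inr ?_
    have h1 : ‖(((ContinuousLinearEquiv.refl ℝ P).symm : P ≃L[ℝ] P) : P →L[ℝ] P)‖₊ = 1 := by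
      simp
    rw [h1, inv_one]
    exact NNReal.half_lt_self one_ne_zero

/-- The solution map `p ↦ u` of the fixed point equation `u = p + N u`. -/
def fixedPointMap {N : P → P} (hN : ContDiff ℝ ∞ N) (hd : ∀ u, ‖fderiv ℝ N u‖ ≤ 1 / 2) : P → P :=
  (exists_homeomorph_sub hN hd).choose.symm

variable {N : P → P} (hN : ContDiff ℝ ∞ N) (hd : ∀ u, ‖fderiv ℝ N u‖ ≤ 1 / 2)

theorem fixedPointMap_eq (p : P) :
    fixedPointMap hN hd p = p + N (fixedPointMap hN hd p) := by
  have h := (exists_homeomorph_sub hN hd).choose_spec (fixedPointMap hN hd p)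
  rw [fixedPointMap, Homeomorph.apply_symm_apply] at h
  exact eq_add_of_sub_eq h.symm

theorem fixedPointMap_unique {u p : P} (h : u = p + N u) : fixedPointMap hN hd p = u := by
  have h1 := (exists_homeomorph_sub hN hd).choose_spec u
  rw [fixedPointMap, Homeomorph.symm_apply_eq, h1, eq_sub_iff_add_eq]
  exact h.symm

/-- The derivative `1 - N'(u)` is invertible by the Neumann series at every point. -/
theorem contDiff_fixedPointMap : ContDiff ℝ ∞ (fixedPointMap hN hd) := by
  have hf := (exists_homeomorph_sub hN hd).choose_spec
  set f := (exists_homeomorph_sub hN hd).choose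
  have hfun : (f : P → P) = fun u => u - N u := funext hf
  have hlt : ∀ u, ‖fderiv ℝ N u‖ < 1 := fun u => (hd u).trans_lt (by norm_num)
  refine Homeomorph.contDiff_symm f
    (f₀' := fun u => ContinuousLinearEquiv.unitsEquiv ℝ P (Units.oneSub _ (hlt u))) ?_ ?_
  · intro u
    rw [hfun]
    exact (hasFDerivAt_id u).sub (hN.differentiable (by simp) u).hasFDerivAt
  · rw [hfun]
    exact contDiff_id.sub hN

theorem fderiv_fixedPointMap (p : P) :
    fderiv ℝ (fixedPointMap hN hd) p = ContinuousLinearMap.id ℝ P +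
      (fderiv ℝ N (fixedPointMap hN hd p)).comp (fderiv ℝ (fixedPointMap hN hd) p) := by
  have h1 : fixedPointMap hN hd = fun p => p + N (fixedPointMap hN hd p) :=
    funext fun p => fixedPointMap_eq hN hd p
  have hdiff := (contDiff_fixedPointMap hN hd).differentiable (by simp)
  conv_lhs => rw [h1]
  exact ((hasFDerivAt_id p).add (((hN.differentiable (by simp) _).hasFDerivAt).comp p
    (hdiff p).hasFDerivAt)).fderiv

end GlobalInverse

/-! ### Uniform derivative bounds for the inverse maps. -/

section GlobalInverseFamily

variable {ι : Type*} {P : Type*} [NormedAddCommGroup P] [NormedSpace ℝ P] [CompleteSpace P]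

/-- Differentiate the identity `A = 1 + N'(f) A` for the derivative `A` of the solution map `f`. In
the Leibniz expansion the top-order term in `A` carries a factor of norm at most `1/2` and is
absorbed on the left; all other terms are controlled by induction. -/
theorem tameOn_fixedPointMap {N : ι → P → P} (hU : UnifSmoothOn N fun _ => univ)
    (hN : ∀ i, ContDiff ℝ ∞ (N i)) (hd : ∀ i u, ‖fderiv ℝ (N i) u‖ ≤ 1 / 2) :
    TameOn (fun i => fixedPointMap (hN i) (hd i)) fun _ => univ := by
  have hs : ∀ i, ContDiff ℝ ∞ (fixedPointMap (hN i) (hd i)) := fun i =>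
    contDiff_fixedPointMap (hN i) (hd i)
  suffices H : ∀ n, ∃ C : ℝ, ∀ i v, ∀ j, 1 ≤ j → j ≤ n →
      ‖iteratedFDeriv ℝ j (fixedPointMap (hN i) (hd i)) v‖ ≤ C from
    ⟨fun _ => isOpen_univ, fun i => (hs i).contDiffOn,
      fun j hj => (H j).imp fun C hC i v _ => hC i v j hj le_rfl⟩
  intro n
  induction n with
  | zero => exact ⟨0, fun i v j h1 h2 => by omega⟩
  | succ n ih =>
    obtain ⟨D₀, hD₀⟩ := ih
    set D := max D₀ 1
    have hD1 : 1 ≤ D := le_max_right _ _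
    have hD : ∀ i v, ∀ j, 1 ≤ j → j ≤ n →
        ‖iteratedFDeriv ℝ j (fixedPointMap (hN i) (hd i)) v‖ ≤ D :=
      fun i v j h1 h2 => (hD₀ i v j h1 h2).trans (le_max_left _ _)
    obtain ⟨B, hB1, hB⟩ := hU.tameOn.unifSmoothOn_fderiv.bound_uniform n
    have hBD : ∀ k ≤ n, ∀ i v, ‖iteratedFDeriv ℝ k
        (fun p => fderiv ℝ (N i) (fixedPointMap (hN i) (hd i) p)) v‖ ≤
          k.factorial * B * D ^ k := by
      intro k hk i v
      refine norm_iteratedFDeriv_comp_le (((hN i).fderiv_right (m := ∞) (by simp))) (hs i)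
        (by exact_mod_cast le_top) v (fun l hl => hB l (by omega) i _ (mem_univ _))
        (fun l h1 hl => (hD i v l h1 (by omega)).trans (le_self_pow₀ hD1 (by omega)))
    -- `M` collects the constant term and the Leibniz terms with at least one derivative on `N'(f)`.
    -- Absorbing the remaining term doubles the bound.
    set M : ℝ := 1 + ∑ k ∈ Finset.range n, (n.choose (k + 1) : ℝ) *
      ((k + 1).factorial * B * D ^ (k + 1)) * D
    refine ⟨max D (2 * M), fun i v j h1 hj => ?_⟩
    rcases Nat.lt_or_ge j (n + 1) with hlt | hge
    · exact (hD i v j h1 (by omega)).trans (le_max_left _ _)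
    obtain rfl : j = n + 1 := by omega
    refine le_trans ?_ (le_max_right _ _)
    rw [← norm_iteratedFDeriv_fderiv]
    set A := fderiv ℝ (fixedPointMap (hN i) (hd i))
    have hA : A = fun p => ContinuousLinearMap.id ℝ P +
        (ContinuousLinearMap.compL ℝ P P P)
          (fderiv ℝ (N i) (fixedPointMap (hN i) (hd i) p)) (A p) :=
      funext fun p => fderiv_fixedPointMap (hN i) (hd i) p
    have hAs : ContDiff ℝ ∞ A := (hs i).fderiv_right (by simp)
    have hNs : ContDiff ℝ ∞ fun p => fderiv ℝ (N i) (fixedPointMap (hN i) (hd i) p) :=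
      ((hN i).fderiv_right (m := ∞) (by simp)).comp (hs i)
    have hbil := (ContinuousLinearMap.compL ℝ P P P).norm_iteratedFDeriv_le_of_bilinear_of_le_one
      hNs hAs v (n := n) (by exact_mod_cast le_top) (ContinuousLinearMap.norm_compL_le ℝ P P P)
    rw [Finset.sum_range_succ'] at hbil
    have h0 : ‖iteratedFDeriv ℝ n A v‖ ≤ 1 + ‖iteratedFDeriv ℝ n (fun p =>
        (ContinuousLinearMap.compL ℝ P P P)
          (fderiv ℝ (N i) (fixedPointMap (hN i) (hd i) p)) (A p)) v‖ := by
      conv_lhs => rw [hA]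
      have hc : ContDiff ℝ ∞ fun p => (ContinuousLinearMap.compL ℝ P P P)
          (fderiv ℝ (N i) (fixedPointMap (hN i) (hd i) p)) (A p) :=
        (ContinuousLinearMap.compL ℝ P P P).isBoundedBilinearMap.contDiff.comp₂ hNs hAs
      rw [fun_iteratedFDeriv_add_apply (contDiffAt_const)
        (hc.contDiffAt.of_le (by exact_mod_cast le_top))]
      refine (norm_add_le _ _).trans (add_le_add_left ?_ _)
      rcases Nat.eq_zero_or_pos n with rfl | hn
      · rw [norm_iteratedFDeriv_zero]
        exact ContinuousLinearMap.norm_id_le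
      · rw [iteratedFDeriv_const_of_ne (by omega)]
        simp
    have h1 : ∑ k ∈ Finset.range n, (n.choose (k + 1) : ℝ) * ‖iteratedFDeriv ℝ (k + 1)
        (fun p => fderiv ℝ (N i) (fixedPointMap (hN i) (hd i) p)) v‖ *
          ‖iteratedFDeriv ℝ (n - (k + 1)) A v‖ ≤ ∑ k ∈ Finset.range n,
        (n.choose (k + 1) : ℝ) * ((k + 1).factorial * B * D ^ (k + 1)) * D := by
      refine Finset.sum_le_sum fun k hk => ?_
      rw [Finset.mem_range] at hk
      gcongr
      · exact hBD (k + 1) (by omega) i v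
      · rw [norm_iteratedFDeriv_fderiv]
        exact hD i v _ (by omega) (by omega)
    have h2 : ((n.choose 0 : ℕ) : ℝ) * ‖iteratedFDeriv ℝ 0
        (fun p => fderiv ℝ (N i) (fixedPointMap (hN i) (hd i) p)) v‖ *
          ‖iteratedFDeriv ℝ (n - 0) A v‖ ≤ 1 / 2 * ‖iteratedFDeriv ℝ n A v‖ := by
      rw [Nat.choose_zero_right, Nat.cast_one, one_mul, norm_iteratedFDeriv_zero, Nat.sub_zero]
      gcongr
      exact hd i _
    simp only [M]
    linarith

end GlobalInverseFamily

/-! ### Differentiation under an integral over the unit interval. -/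

section ParametricIntegral

universe u

variable {Z W : Type u} [NormedAddCommGroup Z] [NormedSpace ℝ Z] [ProperSpace Z]
  [NormedAddCommGroup W] [NormedSpace ℝ W]

omit [ProperSpace Z] in
theorem contDiff_fderiv_right {f : ℝ → Z → W} (hf : ContDiff ℝ ∞ fun p : ℝ × Z => f p.1 p.2) :
    ContDiff ℝ ∞ fun p : ℝ × Z => fderiv ℝ (f p.1) p.2 :=
  ContDiff.fderiv (f := fun (p : ℝ × Z) v => f p.1 v) (g := fun p => p.2) (m := ∞) (n := ∞)
    (hf.comp ((contDiff_fst.comp contDiff_fst).prodMk contDiff_snd)) contDiff_snd (by simp)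

theorem hasFDerivAt_integral_zero_one {f : ℝ → Z → W}
    (hf : ContDiff ℝ ∞ fun p : ℝ × Z => f p.1 p.2) (z : Z) :
    HasFDerivAt (fun z => ∫ s in (0 : ℝ)..1, f s z) (∫ s in (0 : ℝ)..1, fderiv ℝ (f s) z) z := by
  have hd := (contDiff_fderiv_right hf).continuous
  obtain ⟨C, hC⟩ := ((isCompact_Icc (a := (0 : ℝ)) (b := 1)).prod
    (isCompact_closedBall z 1)).exists_bound_of_continuousOn hd.continuousOn
  refine intervalIntegral.hasFDerivAt_integral_of_dominated_of_fderiv_le (bound := fun _ => C)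
    (s := Metric.closedBall z 1) (Metric.closedBall_mem_nhds z one_pos) (F' := fun z s => fderiv ℝ (f s) z) ?_ ?_ ?_ ?_ ?_ ?_
  · refine Eventually.of_forall fun x => Continuous.aestronglyMeasurable ?_
    exact hf.continuous.comp (continuous_id.prodMk continuous_const)
  · refine Continuous.intervalIntegrable ?_ _ _
    exact hf.continuous.comp (continuous_id.prodMk continuous_const)
  · refine Continuous.aestronglyMeasurable ?_
    exact hd.comp (continuous_id.prodMk continuous_const)
  · refine Eventually.of_forall fun s hs x hx => hC (s, x) ⟨?_, hx⟩
    rw [uIoc_of_le zero_le_one] at hs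
    exact ⟨hs.1.le, hs.2⟩
  · exact intervalIntegrable_const
  · refine Eventually.of_forall fun s hs x hx => ?_
    exact ((hf.comp (contDiff_prodMk_right s)).differentiable (by simp) x).hasFDerivAt

/-- The bound keeps the integral of the norms instead of a supremum, because it is later used with
an integrand whose derivative bounds blow up like `s^{-μ}` at `0`. -/
theorem contDiff_integral_zero_one_aux (n : ℕ) : ∀ {W : Type u} [NormedAddCommGroup W]
    [NormedSpace ℝ W] {f : ℝ → Z → W}, ContDiff ℝ ∞ (fun p : ℝ × Z => f p.1 p.2) →
    ContDiff ℝ n (fun z => ∫ s in (0 : ℝ)..1, f s z) ∧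
      ∀ z, ‖iteratedFDeriv ℝ n (fun z => ∫ s in (0 : ℝ)..1, f s z) z‖ ≤
        ∫ s in (0 : ℝ)..1, ‖iteratedFDeriv ℝ n (f s) z‖ := by
  induction n with
  | zero =>
    intro W _ _ f hf
    refine ⟨?_, fun z => ?_⟩
    · rw [Nat.cast_zero, contDiff_zero]
      exact continuous_iff_continuousAt.2 fun z => (hasFDerivAt_integral_zero_one hf z).continuousAt
    · simpa only [norm_iteratedFDeriv_zero] using
        intervalIntegral.norm_integral_le_integral_norm zero_le_one
  | succ n ih =>
    intro W _ _ f hf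
    have hd : fderiv ℝ (fun z => ∫ s in (0 : ℝ)..1, f s z) =
        fun z => ∫ s in (0 : ℝ)..1, fderiv ℝ (f s) z :=
      funext fun z => (hasFDerivAt_integral_zero_one hf z).fderiv
    obtain ⟨h1, h2⟩ := ih (f := fun s z => fderiv ℝ (f s) z) (contDiff_fderiv_right hf)
    refine ⟨?_, fun z => ?_⟩
    · rw [Nat.cast_add, Nat.cast_one, contDiff_succ_iff_fderiv]
      refine ⟨fun z => (hasFDerivAt_integral_zero_one hf z).differentiableAt, by simp, ?_⟩
      rw [hd]
      exact h1
    · rw [← norm_iteratedFDeriv_fderiv, hd]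
      refine (h2 z).trans (le_of_eq ?_)
      simp only [norm_iteratedFDeriv_fderiv]

theorem contDiff_integral_zero_one {f : ℝ → Z → W}
    (hf : ContDiff ℝ ∞ fun p : ℝ × Z => f p.1 p.2) :
    ContDiff ℝ ∞ (fun z => ∫ s in (0 : ℝ)..1, f s z) :=
  contDiff_infty.2 fun n => (contDiff_integral_zero_one_aux n hf).1

end ParametricIntegral

/-! ### Weighted integration operators on bounded paths. -/

section PathOperators

/-- The weight `⟨t⟩ = (1 + t²)^{1/2}` on the time axis. -/
def timeWeight (t : ℝ) : ℝ := Real.sqrt (1 + t ^ 2)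

theorem one_le_timeWeight (t : ℝ) : 1 ≤ timeWeight t := by
  rw [timeWeight, Real.one_le_sqrt]; nlinarith [sq_nonneg t]

theorem timeWeight_pos (t : ℝ) : 0 < timeWeight t := one_pos.trans_le (one_le_timeWeight t)

theorem timeWeight_sq (t : ℝ) : timeWeight t ^ 2 = 1 + t ^ 2 := Real.sq_sqrt (by positivity)

theorem abs_le_timeWeight (t : ℝ) : |t| ≤ timeWeight t := by
  rw [timeWeight]; exact Real.abs_le_sqrt (by linarith)

theorem timeWeight_abs (t : ℝ) : timeWeight |t| = timeWeight t := by
  simp [timeWeight]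

theorem contDiff_timeWeight : ContDiff ℝ ∞ timeWeight :=
  ContDiff.sqrt (by fun_prop) fun t => by positivity

theorem continuous_timeWeight : Continuous timeWeight := contDiff_timeWeight.continuous

theorem timeWeight_mono {s t : ℝ} (h : |s| ≤ |t|) : timeWeight s ≤ timeWeight t := by
  unfold timeWeight
  gcongr 1
  have := sq_le_sq.2 h
  linarith

theorem continuous_timeWeight_rpow (c : ℝ) : Continuous fun t => timeWeight t ^ c :=
  continuous_timeWeight.rpow_const fun t => Or.inl (timeWeight_pos t).ne'

theorem timeWeight_rpow_le_one {c : ℝ} (hc : c ≤ 0) (t : ℝ) : timeWeight t ^ c ≤ 1 :=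
  Real.rpow_le_one_of_one_le_of_nonpos (one_le_timeWeight t) hc

theorem integrable_timeWeight_rpow {μ : ℝ} (hμ : 0 < μ) :
    Integrable fun t => timeWeight t ^ (-1 - μ) := by
  have h := integrable_rpow_neg_one_add_norm_sq (E := ℝ) (μ := volume) (r := 1 + μ) (by simp [hμ])
  refine h.congr (Eventually.of_forall fun t => ?_)
  simp only [timeWeight, Real.norm_eq_abs, sq_abs]
  rw [Real.sqrt_eq_rpow, ← Real.rpow_mul (by positivity)]
  congr 1
  ring

variable {F : Type*} [NormedAddCommGroup F] [NormedSpace ℝ F]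

/-- A bounded linear operator on bounded paths given by a pointwise formula. -/
def pathOp (T : (ℝ →ᵇ F) → ℝ → F) (C : ℝ) (hC : 0 ≤ C) (hcont : ∀ f, Continuous (T f))
    (hadd : ∀ f g t, T (f + g) t = T f t + T g t) (hsmul : ∀ (c : ℝ) f t, T (c • f) t = c • T f t)
    (hbound : ∀ f t, ‖T f t‖ ≤ C * ‖f‖) : (ℝ →ᵇ F) →L[ℝ] (ℝ →ᵇ F) :=
  LinearMap.mkContinuous
    { toFun := fun f =>
        BoundedContinuousFunction.ofNormedAddCommGroup (T f) (hcont f) (C * ‖f‖) (hbound f)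
      map_add' := fun f g => by ext t; exact hadd f g t
      map_smul' := fun c f => by ext t; exact hsmul c f t }
    C fun f => (BoundedContinuousFunction.norm_le (mul_nonneg hC (norm_nonneg f))).2 (hbound f)

/-- Multiplication of bounded paths by the weight `⟨t⟩ ^ c`, `c ≤ 0`. -/
def weightMul (F : Type*) [NormedAddCommGroup F] [NormedSpace ℝ F] (c : ℝ) (hc : c ≤ 0) :
    (ℝ →ᵇ F) →L[ℝ] (ℝ →ᵇ F) :=
  pathOp (fun f t => timeWeight t ^ c • f t) 1 zero_le_one
    (fun f => (continuous_timeWeight_rpow c).smul f.continuous)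
    (fun f g t => smul_add _ _ _) (fun a f t => smul_comm _ _ _) fun f t => by
      have := timeWeight_pos t
      rw [norm_smul, Real.norm_of_nonneg (by positivity)]
      gcongr
      · exact timeWeight_rpow_le_one hc t
      · exact f.norm_coe_le_norm t

@[simp]
theorem weightMul_apply (c : ℝ) (hc : c ≤ 0) (f : ℝ →ᵇ F) (t : ℝ) :
    weightMul F c hc f t = timeWeight t ^ c • f t := rfl

theorem integrableOn_tail {μ a : ℝ} (hμ : 0 < μ) (ha : a ≤ 1) (f : ℝ →ᵇ F) (S : Set ℝ) :
    IntegrableOn (fun s => timeWeight s ^ (-1 - μ + (a - 1)) • f s) S := by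
  refine Integrable.integrableOn ?_
  refine ((integrable_timeWeight_rpow hμ).mul_const ‖f‖).mono'
    ((continuous_timeWeight_rpow _).smul f.continuous).aestronglyMeasurable
    (Eventually.of_forall fun t => ?_)
  have := timeWeight_pos t
  rw [norm_smul, Real.norm_of_nonneg (by positivity)]
  gcongr
  · exact one_le_timeWeight t
  · linarith
  · exact f.norm_coe_le_norm t

/-- The constant `∫ ⟨s⟩ ^ (-1-μ)`. -/
def tailConst (μ : ℝ) : ℝ := ∫ s, timeWeight s ^ (-1 - μ)

theorem tailConst_nonneg (μ : ℝ) : 0 ≤ tailConst μ :=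
  integral_nonneg fun t => by have := timeWeight_pos t; positivity

/-- The weighted tail integral `t ↦ ⟨t⟩^{1-a} ∫_{|t|}^∞ ⟨s⟩^{-1-μ+(a-1)} f s ds`. -/
def tailFun (μ a : ℝ) (f : ℝ → F) (t : ℝ) : F :=
  timeWeight t ^ (1 - a) • ∫ s in Ioi |t|, timeWeight s ^ (-1 - μ + (a - 1)) • f s

theorem continuous_integral_Ioi {g : ℝ → F} (hg : Integrable g) :
    Continuous fun x => ∫ s in Ioi x, g s := by
  have h : (fun x => ∫ s in Ioi x, g s) = fun x => (∫ s in Ioi 0, g s) - ∫ s in (0 : ℝ)..x, g s := by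
    ext1 x
    rw [← intervalIntegral.integral_Ioi_sub_Ioi' hg.integrableOn hg.integrableOn]
    abel
  rw [h]
  exact continuous_const.sub (intervalIntegral.continuous_primitive
    (fun a b => hg.intervalIntegrable) 0)

/-- For `s ≥ |t|` and `a ≤ 1` one has `⟨s⟩^{a-1} ≤ ⟨t⟩^{a-1}`, which cancels the prefactor and
leaves the integrable weight `⟨s⟩^{-1-μ}`. -/
theorem norm_tailFun_le {μ a : ℝ} (hμ : 0 < μ) (ha : a ≤ 1) (f : ℝ →ᵇ F) (t : ℝ) :
    ‖tailFun μ a f t‖ ≤ tailConst μ * ‖f‖ := by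
  have ht := timeWeight_pos t
  have h1 : ‖∫ s in Ioi |t|, timeWeight s ^ (-1 - μ + (a - 1)) • f s‖ ≤
      ∫ s in Ioi |t|, timeWeight t ^ (a - 1) * (timeWeight s ^ (-1 - μ) * ‖f‖) := by
    refine norm_integral_le_of_norm_le (((integrable_timeWeight_rpow hμ).mul_const _).const_mul
      _).integrableOn ?_
    refine (ae_restrict_mem measurableSet_Ioi).mono fun s hs => ?_
    have hs' := timeWeight_pos s
    rw [norm_smul, Real.norm_of_nonneg (by positivity), Real.rpow_add hs', ← mul_assoc,
      mul_comm (timeWeight t ^ (a - 1))]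
    have h2 : timeWeight s ^ (a - 1) ≤ timeWeight t ^ (a - 1) :=
      Real.rpow_le_rpow_of_nonpos ht
        (timeWeight_mono ((mem_Ioi.1 hs).le.trans (le_abs_self s))) (by linarith)
    gcongr
    exact f.norm_coe_le_norm s
  have h3 : ∫ s in Ioi |t|, timeWeight t ^ (a - 1) * (timeWeight s ^ (-1 - μ) * ‖f‖) ≤
      timeWeight t ^ (a - 1) * (tailConst μ * ‖f‖) := by
    rw [integral_const_mul, integral_mul_const]
    gcongr
    exact setIntegral_le_integral (integrable_timeWeight_rpow hμ)
      (Eventually.of_forall fun s => by have := timeWeight_pos s; positivity)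
  rw [tailFun, norm_smul, Real.norm_of_nonneg (by positivity)]
  calc _ ≤ timeWeight t ^ (1 - a) * (timeWeight t ^ (a - 1) * (tailConst μ * ‖f‖)) := by
        gcongr; exact h1.trans h3
    _ = tailConst μ * ‖f‖ := by
        rw [← mul_assoc, ← Real.rpow_add ht]; simp

/-- The operator of weighted tail integration on bounded paths. -/
def tailOp (F : Type*) [NormedAddCommGroup F] [NormedSpace ℝ F] (μ a : ℝ) (hμ : 0 < μ)
    (ha : a ≤ 1) : (ℝ →ᵇ F) →L[ℝ] (ℝ →ᵇ F) :=
  pathOp (fun f => tailFun μ a f) (tailConst μ) (tailConst_nonneg μ)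
    (fun f => (continuous_timeWeight_rpow _).smul ((continuous_integral_Ioi
      (integrableOn_univ.1 (integrableOn_tail hμ ha f univ))).comp continuous_abs))
    (fun f g t => by
      simp only [tailFun, BoundedContinuousFunction.add_apply, smul_add]
      rw [integral_add (integrableOn_tail hμ ha f _) (integrableOn_tail hμ ha g _), smul_add])
    (fun c f t => by
      simp only [tailFun, BoundedContinuousFunction.coe_smul, smul_comm _ c]
      rw [integral_smul, smul_comm])
    (norm_tailFun_le hμ ha)

/-- The weighted primitive `t ↦ ⟨t⟩^{-a} ∫_0^{|t|} ⟨s⟩^{a-1} f s ds`. -/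
def headFun (a : ℝ) (f : ℝ → F) (t : ℝ) : F :=
  timeWeight t ^ (-a) • ∫ s in (0 : ℝ)..|t|, timeWeight s ^ (a - 1) • f s

/-- Replacing `⟨s⟩^{a-1}` by the larger `s^{a-1}` gives the primitive `|t|^a / a`, which is where `a
> 0` enters. -/
theorem norm_headFun_le {a : ℝ} (ha0 : 0 < a) (ha : a ≤ 1) (f : ℝ →ᵇ F) (t : ℝ) :
    ‖headFun a f t‖ ≤ a⁻¹ * ‖f‖ := by
  have ht := timeWeight_pos t
  have hint : IntervalIntegrable (fun s : ℝ => s ^ (a - 1)) volume 0 |t| :=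
    intervalIntegral.intervalIntegrable_rpow' (by linarith)
  have h1 : ‖∫ s in (0 : ℝ)..|t|, timeWeight s ^ (a - 1) • f s‖ ≤
      ∫ s in (0 : ℝ)..|t|, s ^ (a - 1) * ‖f‖ := by
    refine intervalIntegral.norm_integral_le_of_norm_le (abs_nonneg t)
      (Eventually.of_forall fun s hs => ?_) (hint.mul_const _)
    have hs' := timeWeight_pos s
    rw [norm_smul, Real.norm_of_nonneg (by positivity)]
    have h2 : timeWeight s ^ (a - 1) ≤ s ^ (a - 1) :=
      Real.rpow_le_rpow_of_nonpos hs.1 ((le_abs_self s).trans (abs_le_timeWeight s)) (by linarith)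
    have h3 : 0 ≤ s ^ (a - 1) := Real.rpow_nonneg hs.1.le _
    gcongr
    exact f.norm_coe_le_norm s
  rw [intervalIntegral.integral_mul_const, integral_rpow (Or.inl (by linarith))] at h1
  rw [headFun, norm_smul, Real.norm_of_nonneg (by positivity)]
  have h4 : |t| ^ a ≤ timeWeight t ^ a :=
    Real.rpow_le_rpow (abs_nonneg t) (abs_le_timeWeight t) ha0.le
  calc _ ≤ timeWeight t ^ (-a) * (timeWeight t ^ a * a⁻¹ * ‖f‖) := by
        gcongr
        refine h1.trans ?_
        rw [sub_add_cancel, Real.zero_rpow ha0.ne', sub_zero, div_eq_mul_inv]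
        gcongr
    _ = a⁻¹ * ‖f‖ := by
        rw [← mul_assoc, ← mul_assoc, ← Real.rpow_add ht]; simp

/-- The operator of weighted integration from `0` on bounded paths. -/
def headOp (F : Type*) [NormedAddCommGroup F] [NormedSpace ℝ F] (a : ℝ) (ha0 : 0 < a)
    (ha : a ≤ 1) : (ℝ →ᵇ F) →L[ℝ] (ℝ →ᵇ F) :=
  have hc : ∀ f : ℝ →ᵇ F, Continuous fun s => timeWeight s ^ (a - 1) • f s := fun f =>
    (continuous_timeWeight_rpow _).smul f.continuous
  pathOp (fun f => headFun a f) a⁻¹ (inv_nonneg.2 ha0.le)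
    (fun f => (continuous_timeWeight_rpow _).smul ((intervalIntegral.continuous_primitive
      (fun _ _ => (hc f).intervalIntegrable _ _) 0).comp continuous_abs))
    (fun f g t => by
      simp only [headFun, BoundedContinuousFunction.add_apply, smul_add]
      rw [intervalIntegral.integral_add ((hc f).intervalIntegrable _ _)
        ((hc g).intervalIntegrable _ _), smul_add])
    (fun c f t => by
      simp only [headFun, BoundedContinuousFunction.coe_smul, smul_comm _ c]
      rw [intervalIntegral.integral_smul, smul_comm])
    (norm_headFun_le ha0 ha)

end PathOperators

/-! ### The flat form as an isometric sign operator. -/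

section FlatForm

variable {n : ℕ} (k : ℕ)

/-- The diagonal sign operator `I_k`. -/
def flatOp (n k : ℕ) : E n →L[ℝ] E n :=
  LinearMap.toContinuousLinearMap
    { toFun := fun x => WithLp.toLp 2 fun i : Fin n => (if (i : ℕ) + k < n then 1 else -1) * x i
      map_add' := fun x y => by ext i; simp [mul_add]
      map_smul' := fun c x => by ext i; simp [mul_left_comm] }

theorem flatOp_apply (x : E n) (i : Fin n) :
    flatOp n k x i = (if (i : ℕ) + k < n then 1 else -1) * x i := rfl

theorem inner_eq_sum (x y : E n) : inner ℝ x y = ∑ i, x i * y i := by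
  rw [PiLp.inner_apply]
  exact Finset.sum_congr rfl fun i _ => by simp [mul_comm]

theorem g₀_eq_sum (x y : E n) :
    g₀ k x y = ∑ i : Fin n, (if (i : ℕ) + k < n then 1 else -1) * x i * y i := by
  simp only [g₀, bilin, flatMatrix, Matrix.diagonal_apply]
  refine Finset.sum_congr rfl fun i _ => ?_
  rw [Finset.sum_eq_single i (fun j _ hj => by rw [if_neg hj.symm]; ring) (by simp)]
  simp

theorem inner_flatOp (x y : E n) : inner ℝ (flatOp n k x) y = g₀ k x y := by
  rw [inner_eq_sum, g₀_eq_sum]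
  rfl

theorem g₀_comm (x y : E n) : g₀ k x y = g₀ k y x := by
  simp only [g₀_eq_sum]
  exact Finset.sum_congr rfl fun i _ => by ring

theorem norm_flatOp (x : E n) : ‖flatOp n k x‖ = ‖x‖ := by
  rw [EuclideanSpace.norm_eq, EuclideanSpace.norm_eq]
  congr 1
  refine Finset.sum_congr rfl fun i _ => ?_
  rw [flatOp_apply, norm_mul]
  split_ifs <;> simp

end FlatForm

/-! ### The integral form of the forced free evolution. -/

section Evolution

variable {n : ℕ}

/-- The pair of partial gradients `(∂_η, ∂_y)` of a linear form on phase space. -/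
def gradPair (n : ℕ) : (E n × E n →L[ℝ] ℝ) →L[ℝ] E n × E n :=
  ((InnerProductSpace.toDual ℝ (E n)).symm.toContinuousLinearEquiv.toContinuousLinearMap.comp
    ((ContinuousLinearMap.compL ℝ (E n) (E n × E n) ℝ).flip (ContinuousLinearMap.inr ℝ _ _))).prod
  ((InnerProductSpace.toDual ℝ (E n)).symm.toContinuousLinearEquiv.toContinuousLinearMap.comp
    ((ContinuousLinearMap.compL ℝ (E n) (E n × E n) ℝ).flip (ContinuousLinearMap.inl ℝ _ _)))

theorem inner_gradPair_fst (l : E n × E n →L[ℝ] ℝ) (h : E n) :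
    inner ℝ (gradPair n l).1 h = l (0, h) :=
  InnerProductSpace.toDual_symm_apply

theorem inner_gradPair_snd (l : E n × E n →L[ℝ] ℝ) (h : E n) :
    inner ℝ (gradPair n l).2 h = l (h, 0) :=
  InnerProductSpace.toDual_symm_apply

variable (k : ℕ) {μ a : ℝ} (hμ : 0 < μ) (ha0 : 0 < a) (ha : a ≤ 1)

/-- The first component of a bounded path in phase space. -/
def pathFst (n : ℕ) : (ℝ →ᵇ E n × E n) →L[ℝ] (ℝ →ᵇ E n) :=
  (ContinuousLinearMap.fst ℝ (E n) (E n)).compLeftContinuousBounded ℝ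

/-- The second component of a bounded path in phase space. -/
def pathSnd (n : ℕ) : (ℝ →ᵇ E n × E n) →L[ℝ] (ℝ →ᵇ E n) :=
  (ContinuousLinearMap.snd ℝ (E n) (E n)).compLeftContinuousBounded ℝ

/-- The integral operator sending a force `f = (f₁, f₂)` to the solution, vanishing at `0` in
position and at infinity in momentum, of `X' = ⟨t⟩^{-μ} f₁ + 2 I η`, `η' = -⟨t⟩^{-1-μ} f₂`, with
positions rescaled by `⟨t⟩`, and conjugated by `⟨t⟩ ^ (a-1)`. -/
def evolOp (n : ℕ) : (ℝ →ᵇ E n × E n) →L[ℝ] (ℝ →ᵇ E n × E n) :=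
  ((ContinuousLinearMap.inl ℝ (E n) (E n)).compLeftContinuousBounded ℝ).comp
    ((headOp (E n) a ha0 ha).comp
      ((weightMul (E n) (-μ) (by linarith)).comp (pathFst n) +
        ((2 : ℝ) • flatOp n k).compLeftContinuousBounded ℝ ∘L
          (tailOp (E n) μ a hμ ha).comp (pathSnd n))) +
  ((ContinuousLinearMap.inr ℝ (E n) (E n)).compLeftContinuousBounded ℝ).comp
    ((tailOp (E n) μ a hμ ha).comp (pathSnd n))

theorem evolOp_fst (f : ℝ →ᵇ E n × E n) (t : ℝ) :
    (evolOp k hμ ha0 ha n f t).1 = headFun a (fun s => timeWeight s ^ (-μ) • (f s).1 +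
      (2 : ℝ) • flatOp n k (tailFun μ a (fun s => (f s).2) s)) t := by
  simp only [evolOp, _root_.add_apply, BoundedContinuousFunction.add_apply,
    Prod.fst_add]
  exact add_zero _

theorem evolOp_snd (f : ℝ →ᵇ E n × E n) (t : ℝ) :
    (evolOp k hμ ha0 ha n f t).2 = tailFun μ a (fun s => (f s).2) t := by
  simp only [evolOp, _root_.add_apply, BoundedContinuousFunction.add_apply,
    Prod.snd_add]
  exact zero_add _

theorem tailFun_weightMul (f : ℝ → E n) (t : ℝ) :
    tailFun μ 1 (fun s => timeWeight s ^ (a - 1) • f s) t =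
      timeWeight t ^ (a - 1) • tailFun μ a f t := by
  have ht := timeWeight_pos t
  simp only [tailFun, smul_smul]
  rw [← Real.rpow_add ht]
  congr 1
  · congr 1; ring
  · congr 1
    ext1 s
    rw [← Real.rpow_add (timeWeight_pos s)]
    congr 2; ring

theorem headFun_weightMul (f : ℝ → E n) (t : ℝ) :
    headFun 1 (fun s => timeWeight s ^ (a - 1) • f s) t =
      timeWeight t ^ (a - 1) • headFun a f t := by
  have ht := timeWeight_pos t
  simp only [headFun, smul_smul]
  rw [← Real.rpow_add ht]
  congr 1
  · congr 1; ring
  · congr 1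
    ext1 s
    rw [← Real.rpow_add (timeWeight_pos s)]
    congr 2; ring

/-- On paths of size `⟨t⟩^{a-1}`, the evolution operator acts as its bounded conjugate with
parameter `a`. Decay of solutions of linear equations thus becomes boundedness for the conjugated
problem. -/
theorem evolOp_weightMul (f : ℝ →ᵇ E n × E n) :
    evolOp k hμ one_pos le_rfl n (weightMul _ (a - 1) (by linarith) f) =
      weightMul _ (a - 1) (by linarith) (evolOp k hμ ha0 ha n f) := by
  ext1 t
  refine Prod.ext ?_ ?_
  · rw [evolOp_fst, weightMul_apply, Prod.smul_fst, evolOp_fst, ← headFun_weightMul]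
    congr 1
    ext1 s
    simp only [weightMul_apply, Prod.smul_fst, Prod.smul_snd, tailFun_weightMul, map_smul,
      smul_add]
    rw [smul_comm (timeWeight s ^ (-μ)), smul_comm (2 : ℝ)]
  · rw [evolOp_snd, weightMul_apply, Prod.smul_snd, evolOp_snd, ← tailFun_weightMul]
    rfl

theorem norm_freePath_le (z : E n × E n) (t : ℝ) :
    ‖((timeWeight t)⁻¹ • (z.1 + (2 * |t|) • flatOp n k z.2), z.2)‖ ≤ 3 * ‖z‖ := by
  have ht := timeWeight_pos t
  have h1 : ‖z.1‖ ≤ ‖z‖ := norm_fst_le z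
  have h2 : ‖z.2‖ ≤ ‖z‖ := norm_snd_le z
  refine max_le ?_ (by linarith [norm_nonneg z])
  simp only
  rw [norm_smul, norm_inv, Real.norm_of_nonneg ht.le, inv_mul_le_iff₀ ht]
  refine (norm_add_le _ _).trans ?_
  rw [norm_smul, norm_flatOp, Real.norm_of_nonneg (by positivity)]
  have h3 := abs_le_timeWeight t
  have h4 := one_le_timeWeight t
  nlinarith [mul_le_mul h3 h2 (norm_nonneg _) ht.le, mul_le_mul h4 h1 (norm_nonneg _) ht.le]

/-- The free path `(y + 2|t| I ξ, ξ)`, with positions rescaled by `⟨t⟩`. -/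
def freePath (n : ℕ) : E n × E n →L[ℝ] (ℝ →ᵇ E n × E n) :=
  LinearMap.mkContinuous
    { toFun := fun z => BoundedContinuousFunction.ofNormedAddCommGroup
        (fun t => ((timeWeight t)⁻¹ • (z.1 + (2 * |t|) • flatOp n k z.2), z.2))
        (((continuous_timeWeight.inv₀ fun t => (timeWeight_pos t).ne').smul
          (by fun_prop)).prodMk continuous_const) (3 * ‖z‖) (norm_freePath_le k z)
      map_add' := fun x y => by
        ext1 t
        refine Prod.ext ?_ rfl
        simp only [BoundedContinuousFunction.coe_ofNormedAddCommGroup, Prod.fst_add, Prod.snd_add,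
          map_add, smul_add, BoundedContinuousFunction.add_apply]
        abel
      map_smul' := fun c x => by
        ext1 t
        refine Prod.ext ?_ rfl
        simp only [BoundedContinuousFunction.coe_ofNormedAddCommGroup, Prod.smul_fst,
          Prod.smul_snd, map_smul, smul_add, BoundedContinuousFunction.coe_smul, RingHom.id_apply]
        rw [smul_comm _ c, smul_comm _ c, smul_comm _ c] }
    3 fun z => (BoundedContinuousFunction.norm_le (by positivity)).2 (norm_freePath_le k z)

theorem freePath_apply (z : E n × E n) (t : ℝ) :
    freePath k n z t = ((timeWeight t)⁻¹ • (z.1 + (2 * |t|) • flatOp n k z.2), z.2) := rfl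

theorem integrable_weight_snd {μ : ℝ} (hμ : 0 < μ) (f : ℝ →ᵇ E n × E n) :
    Integrable fun s => timeWeight s ^ (-1 - μ) • (f s).2 := by
  have h := integrableOn_univ.1 (integrableOn_tail (a := 1) hμ le_rfl (pathSnd n f) univ)
  simp only [sub_self, add_zero] at h
  exact h

theorem continuous_velocity (c : ℝ) (x f : ℝ →ᵇ E n × E n) :
    Continuous fun s => (2 : ℝ) • flatOp n k (x s).2 + (c * timeWeight s ^ (-μ)) • (f s).1 := by
  have h1 : Continuous fun s => flatOp n k (x s).2 :=
    (flatOp n k).continuous.comp (continuous_snd.comp x.continuous)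
  have h2 : Continuous fun s => c * timeWeight s ^ (-μ) :=
    continuous_const.mul (continuous_timeWeight_rpow _)
  have h3 : Continuous fun s => (f s).1 := continuous_fst.comp f.continuous
  exact (h1.const_smul (2 : ℝ)).add (h2.smul h3)

/-- A rescaled path produced by the evolution operator solves the corresponding differential
equations on `[0, ∞)`, starts at `z.1` and has momentum tending to `z.2`. -/
theorem evolution_equations {c : ℝ} {z : E n × E n} {x f : ℝ →ᵇ E n × E n}
    (hx : x = freePath k n z + c • evolOp k hμ one_pos le_rfl n f) :
    (∀ t, 0 ≤ t → timeWeight t • (x t).1 = z.1 +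
      ∫ s in (0 : ℝ)..t, ((2 : ℝ) • flatOp n k (x s).2 + (c * timeWeight s ^ (-μ)) • (f s).1)) ∧
    (∀ t, 0 ≤ t → (x t).2 = z.2 + c • ∫ s in Ioi t, timeWeight s ^ (-1 - μ) • (f s).2) := by
  have h2 : ∀ t, 0 ≤ t → (x t).2 = z.2 + c • ∫ s in Ioi t, timeWeight s ^ (-1 - μ) • (f s).2 := by
    intro t ht
    rw [hx]
    simp only [BoundedContinuousFunction.add_apply, BoundedContinuousFunction.coe_smul,
      Prod.snd_add, Prod.smul_snd, evolOp_snd, freePath_apply, tailFun, abs_of_nonneg ht]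
    simp
  refine ⟨fun t ht => ?_, h2⟩
  have htw := timeWeight_pos t
  have hc1 : Continuous fun s => timeWeight s ^ (-μ) • (f s).1 :=
    (continuous_timeWeight_rpow _).smul (continuous_fst.comp f.continuous)
  have hx2 : Continuous fun s => (x s).2 := continuous_snd.comp x.continuous
  have h3 : ∀ s, c • tailFun μ 1 (fun s => (f s).2) s = (x s).2 - z.2 := by
    intro s
    rw [hx]
    simp [evolOp_snd, freePath_apply]
  have h1 : (x t).1 = (timeWeight t)⁻¹ • (z.1 + (2 * t) • flatOp n k z.2) +
      c • ((timeWeight t)⁻¹ • ∫ s in (0 : ℝ)..t, (timeWeight s ^ (-μ) • (f s).1 +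
        (2 : ℝ) • flatOp n k (tailFun μ 1 (fun s => (f s).2) s))) := by
    rw [hx]
    simp only [BoundedContinuousFunction.add_apply, BoundedContinuousFunction.coe_smul,
      Prod.fst_add, Prod.smul_fst, evolOp_fst, freePath_apply, headFun, abs_of_nonneg ht,
      sub_self, Real.rpow_zero, one_smul, Real.rpow_neg_one]
  rw [h1, smul_comm c, ← smul_add, smul_inv_smul₀ htw.ne', ← intervalIntegral.integral_smul,
    add_assoc]
  congr 1
  have h4 : ∀ s, c • (timeWeight s ^ (-μ) • (f s).1 +
      (2 : ℝ) • flatOp n k (tailFun μ 1 (fun s => (f s).2) s)) =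
      ((2 : ℝ) • flatOp n k (x s).2 + (c * timeWeight s ^ (-μ)) • (f s).1) -
        (2 : ℝ) • flatOp n k z.2 := by
    intro s
    rw [smul_add, smul_comm c (2 : ℝ), ← map_smul, h3, map_sub, smul_smul, smul_sub]
    abel
  simp only [h4]
  have hc2 := continuous_velocity (μ := μ) k c x f
  rw [intervalIntegral.integral_sub (hc2.intervalIntegrable _ _)
    (continuous_const.intervalIntegrable _ _), intervalIntegral.integral_const, sub_zero,
    smul_smul, mul_comm t]
  abel

/-- The derivatives are one-sided at `0` because paths are extended evenly to negative times. -/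
theorem evolution_hasDerivWithinAt {c : ℝ} {z : E n × E n} {x f : ℝ →ᵇ E n × E n}
    (hx : x = freePath k n z + c • evolOp k hμ one_pos le_rfl n f) {t : ℝ} (ht : 0 ≤ t) :
    HasDerivWithinAt (fun t => timeWeight t • (x t).1)
      ((2 : ℝ) • flatOp n k (x t).2 + (c * timeWeight t ^ (-μ)) • (f t).1) (Ici 0) t ∧
    HasDerivWithinAt (fun t => (x t).2) (-(c * timeWeight t ^ (-1 - μ)) • (f t).2) (Ici 0) t := by
  obtain ⟨h1, h2⟩ := evolution_equations k hμ hx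
  constructor
  · have hc := continuous_velocity (μ := μ) k c x f
    have hd := (hc.integral_hasStrictDerivAt 0 t).hasDerivAt.const_add z.1
    exact hd.hasDerivWithinAt.congr (fun s hs => h1 s hs) (h1 t ht)
  · have hc : Continuous fun s => timeWeight s ^ (-1 - μ) • (f s).2 :=
      (continuous_timeWeight_rpow _).smul (continuous_snd.comp f.continuous)
    have hi : Integrable fun s => timeWeight s ^ (-1 - μ) • (f s).2 := integrable_weight_snd hμ f
    have hd := (((hc.integral_hasStrictDerivAt 0 t).hasDerivAt.const_sub
      (∫ s in Ioi 0, timeWeight s ^ (-1 - μ) • (f s).2)).const_smul c).const_add z.2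
    have he : ∀ s, 0 ≤ s → (x s).2 = z.2 + c • ((∫ s in Ioi 0, timeWeight s ^ (-1 - μ) • (f s).2) -
        ∫ u in (0 : ℝ)..s, timeWeight u ^ (-1 - μ) • (f u).2) := by
      intro s hs
      rw [h2 s hs, ← intervalIntegral.integral_Ioi_sub_Ioi' hi.integrableOn hi.integrableOn]
      congr 2
      abel
    have hd' := hd.hasDerivWithinAt.congr (s := Ici 0) (fun s hs => he s hs) (he t ht)
    rwa [smul_neg, smul_smul, ← neg_smul] at hd'

/-- The momentum is prescribed at infinity: its deviation from `z.2` is the tail of a convergent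
integral. -/
theorem tendsto_snd_of_evolution {c : ℝ} {z : E n × E n} {x f : ℝ →ᵇ E n × E n}
    (hx : x = freePath k n z + c • evolOp k hμ one_pos le_rfl n f) :
    Tendsto (fun t => (x t).2) atTop (𝓝 z.2) := by
  obtain ⟨-, h2⟩ := evolution_equations k hμ hx
  have hi : Integrable fun s => timeWeight s ^ (-1 - μ) • (f s).2 := integrable_weight_snd hμ f
  have h3 : Tendsto (fun t : ℝ => ∫ s in Ioi t, timeWeight s ^ (-1 - μ) • (f s).2) atTop (𝓝 0) := by
    have h := tendsto_setIntegral_of_antitone (μ := volume) (s := fun t : ℝ => Ioi t)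
      (fun _ => measurableSet_Ioi) (fun _ _ h => Ioi_subset_Ioi h) ⟨0, hi.integrableOn⟩
    have he : ⋂ t : ℝ, Ioi t = ∅ :=
      eq_empty_of_forall_notMem fun x hx => lt_irrefl x (mem_iInter.1 hx x)
    rwa [he, setIntegral_empty] at h
  have h4 := (h3.const_smul c).const_add z.2
  rw [smul_zero, add_zero] at h4
  exact h4.congr' ((eventually_ge_atTop 0).mono fun t ht => (h2 t ht).symm)

end Evolution

/-! ### Trajectories with given initial position and asymptotic momentum. -/

/-- A Hamiltonian perturbation `P τ (y, η)`, smooth, with all derivatives in `(y, η)` bounded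
uniformly in `τ ≥ 1`. It stands for the Hamiltonian
`g₀(η, η) + ρ^{-μ} ⟨t⟩^{-μ} P (ρ⟨t⟩) (X / ⟨t⟩, η)` at scale `ρ`. -/
structure Perturbation (n : ℕ) (μ : ℝ) where
  pos : 0 < μ
  toFun : ℝ → E n × E n → ℝ
  unif : UnifSmoothPaths fun (ρ : {ρ : ℝ // 1 ≤ ρ}) t v => toFun (ρ * timeWeight t) v

namespace Perturbation

variable {n : ℕ} (k : ℕ) {μ : ℝ} (P : Perturbation n μ)

/-- The pair of partial gradients of the perturbation along the path. -/
def force (ρ t : ℝ) (v : E n × E n) : E n × E n :=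
  gradPair n (fderiv ℝ (P.toFun (ρ * timeWeight t)) v)

theorem unif_force :
    UnifSmoothPaths fun (ρ : {ρ : ℝ // 1 ≤ ρ}) t v => P.force ρ t v :=
  ⟨fun i => (gradPair n).contDiff.comp (P.unif.fderiv.contDiff i),
    P.unif.fderiv.unif.clm_comp (gradPair n)⟩

/-- The nonlinear part of the fixed point equation for paths. -/
def nonlin (ρ : ℝ) (u : ℝ →ᵇ E n × E n) : ℝ →ᵇ E n × E n :=
  ρ ^ (-μ) • evolOp k P.pos one_pos le_rfl n (nemytskii (P.force ρ) u)

/-- The derivative of the force along a path. -/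
def forceDeriv (ρ : ℝ) (u : ℝ →ᵇ E n × E n) : (ℝ →ᵇ E n × E n) →L[ℝ] (ℝ →ᵇ E n × E n) :=
  applyPointwise (nemytskii (fun t => fderiv ℝ (P.force ρ t)) u)

/-- The linearization of `nonlin`, conjugated by `⟨t⟩ ^ (a-1)`. -/
def linearized {a : ℝ} (ha0 : 0 < a) (ha : a ≤ 1) (ρ : ℝ) (u : ℝ →ᵇ E n × E n) :
    (ℝ →ᵇ E n × E n) →L[ℝ] (ℝ →ᵇ E n × E n) :=
  ρ ^ (-μ) • (evolOp k P.pos ha0 ha n).comp (P.forceDeriv ρ u)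

theorem nemytskii_force_apply {ρ : ℝ} (hρ : 1 ≤ ρ) (u : ℝ →ᵇ E n × E n) (t : ℝ) :
    nemytskii (P.force ρ) u t = P.force ρ t (u t) :=
  P.unif_force.nemytskii_apply ⟨ρ, hρ⟩ u t

theorem forceDeriv_apply {ρ : ℝ} (hρ : 1 ≤ ρ) (u h : ℝ →ᵇ E n × E n) (t : ℝ) :
    P.forceDeriv ρ u h t = fderiv ℝ (P.force ρ t) (u t) (h t) := by
  rw [forceDeriv, applyPointwise_apply]
  rw [P.unif_force.fderiv.nemytskii_apply ⟨ρ, hρ⟩ u t]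

theorem hasFDerivAt_nonlin {ρ : ℝ} (hρ : 1 ≤ ρ) (u : ℝ →ᵇ E n × E n) :
    HasFDerivAt (P.nonlin k ρ) (P.linearized k one_pos le_rfl ρ u) u :=
  (((evolOp k P.pos one_pos le_rfl n).hasFDerivAt).comp u
    (P.unif_force.hasFDerivAt_nemytskii ⟨ρ, hρ⟩ u)).const_smul (ρ ^ (-μ))

theorem contDiff_nonlin {ρ : ℝ} (hρ : 1 ≤ ρ) : ContDiff ℝ ∞ (P.nonlin k ρ) :=
  ((evolOp k P.pos one_pos le_rfl n).contDiff.comp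
    (contDiffOn_univ.1 (P.unif_force.nemytskii.contDiffOn ⟨ρ, hρ⟩))).const_smul (ρ ^ (-μ))

theorem exists_nonlin_bound : ∃ C : ℝ, 0 ≤ C ∧ ∀ ρ, 1 ≤ ρ → ∀ u,
    ‖P.nonlin k ρ u‖ ≤ C * ρ ^ (-μ) := by
  obtain ⟨C, hC⟩ := P.unif_force.norm_nemytskii_le
  refine ⟨‖evolOp k P.pos one_pos le_rfl n‖ * max C 0, by positivity, fun ρ hρ u => ?_⟩
  have h0 : 0 < ρ := one_pos.trans_le hρ
  rw [nonlin, norm_smul, Real.norm_of_nonneg (by positivity), mul_comm]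
  gcongr
  exact (ContinuousLinearMap.le_opNorm _ _).trans
    (by gcongr; exact (hC ⟨ρ, hρ⟩ u).trans (le_max_left _ _))

theorem exists_linearized_bound {a : ℝ} (ha0 : 0 < a) (ha : a ≤ 1) : ∃ C : ℝ, 0 ≤ C ∧
    ∀ ρ, 1 ≤ ρ → ∀ u, ‖P.linearized k ha0 ha ρ u‖ ≤ C * ρ ^ (-μ) := by
  obtain ⟨C, hC⟩ := P.unif_force.fderiv.norm_nemytskii_le
  refine ⟨‖evolOp k P.pos ha0 ha n‖ * max C 0, by positivity, fun ρ hρ u => ?_⟩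
  have h0 : 0 < ρ := one_pos.trans_le hρ
  rw [linearized, norm_smul, Real.norm_of_nonneg (by positivity), mul_comm]
  gcongr
  refine (ContinuousLinearMap.opNorm_comp_le _ _).trans ?_
  gcongr
  refine ContinuousLinearMap.opNorm_le_bound _ (le_max_right _ _) fun h => ?_
  refine (norm_applyPointwise_apply_le _ _).trans ?_
  gcongr
  exact (hC ⟨ρ, hρ⟩ u).trans (le_max_left _ _)

/-- `r` is a scale beyond which the perturbation is `ε`-small and contractive. -/
structure IsScale (r ε : ℝ) : Prop where
  one_le : 1 ≤ r
  nonlin_le : ∀ ρ, r ≤ ρ → ∀ u, ‖P.nonlin k ρ u‖ ≤ ε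
  linearized_le : ∀ ρ, r ≤ ρ → ∀ u, ‖P.linearized k one_pos le_rfl ρ u‖ ≤ 1 / 2
  linearized_quarter_le : ∀ ρ, r ≤ ρ → ∀ u,
    ‖P.linearized k (a := 1 / 4) (by norm_num) (by norm_num) ρ u‖ ≤ 1 / 2

/-- All three quantities are `O(ρ^{-μ})`, uniformly in the path, so `ρ` large makes them as small as
desired. -/
theorem exists_isScale {ε : ℝ} (hε : 0 < ε) : ∃ r, P.IsScale k r ε := by
  obtain ⟨C₁, h1, hC₁⟩ := P.exists_nonlin_bound k
  obtain ⟨C₂, h2, hC₂⟩ := P.exists_linearized_bound k one_pos le_rfl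
  obtain ⟨C₃, h3, hC₃⟩ := P.exists_linearized_bound k (a := 1 / 4) (by norm_num) (by norm_num)
  have ht : ∀ C δ : ℝ, 0 < δ → ∀ᶠ ρ : ℝ in atTop, C * ρ ^ (-μ) ≤ δ := by
    intro C δ hδ
    have := (tendsto_rpow_neg_atTop P.pos).const_mul C
    rw [mul_zero] at this
    exact (this.eventually_lt_const hδ).mono fun _ h => h.le
  obtain ⟨r, hr⟩ := eventually_atTop.1 ((ht C₁ ε hε).and
    ((ht C₂ (1 / 2) (by norm_num)).and (ht C₃ (1 / 2) (by norm_num))))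
  refine ⟨max r 1, le_max_right _ _, fun ρ hρ u => ?_, fun ρ hρ u => ?_, fun ρ hρ u => ?_⟩
  · exact (hC₁ ρ ((le_max_right _ _).trans hρ) u).trans (hr ρ ((le_max_left _ _).trans hρ)).1
  · exact (hC₂ ρ ((le_max_right _ _).trans hρ) u).trans (hr ρ ((le_max_left _ _).trans hρ)).2.1
  · exact (hC₃ ρ ((le_max_right _ _).trans hρ) u).trans (hr ρ ((le_max_left _ _).trans hρ)).2.2

variable {k P} {r ε : ℝ}

theorem IsScale.fderiv_le (hr : P.IsScale k r ε) (ρ : {ρ : ℝ // r ≤ ρ}) (u : ℝ →ᵇ E n × E n) :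
    ‖fderiv ℝ (P.nonlin k ρ) u‖ ≤ 1 / 2 := by
  rw [(P.hasFDerivAt_nonlin k (hr.one_le.trans ρ.2) u).fderiv]
  exact hr.linearized_le ρ ρ.2 u

variable (hr : P.IsScale k r ε)

/-- The path, at scale `ρ`, with initial position `z.1` and asymptotic momentum `z.2`. -/
def IsScale.path (ρ : {ρ : ℝ // r ≤ ρ}) (z : E n × E n) : ℝ →ᵇ E n × E n :=
  fixedPointMap (P.contDiff_nonlin k (hr.one_le.trans ρ.2)) (hr.fderiv_le ρ) (freePath k n z)

theorem IsScale.path_eq (ρ : {ρ : ℝ // r ≤ ρ}) (z : E n × E n) :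
    hr.path ρ z = freePath k n z + P.nonlin k ρ (hr.path ρ z) :=
  fixedPointMap_eq _ _ _

theorem IsScale.path_unique {ρ : {ρ : ℝ // r ≤ ρ}} {z : E n × E n} {u : ℝ →ᵇ E n × E n}
    (h : u = freePath k n z + P.nonlin k ρ u) : hr.path ρ z = u :=
  fixedPointMap_unique _ _ h

theorem IsScale.contDiff_path (ρ : {ρ : ℝ // r ≤ ρ}) : ContDiff ℝ ∞ (hr.path ρ) :=
  (contDiff_fixedPointMap _ _).comp (freePath k n).contDiff

theorem IsScale.norm_path_sub_le (ρ : {ρ : ℝ // r ≤ ρ}) (z : E n × E n) (t : ℝ) :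
    ‖hr.path ρ z t - freePath k n z t‖ ≤ ε := by
  have h : hr.path ρ z t - freePath k n z t = P.nonlin k ρ (hr.path ρ z) t := by
    conv_lhs => rw [hr.path_eq ρ z]
    simp
  rw [h]
  exact (norm_coe_le_norm _ t).trans (hr.nonlin_le ρ ρ.2 _)

theorem IsScale.path_zero_fst (ρ : {ρ : ℝ // r ≤ ρ}) (z : E n × E n) :
    (hr.path ρ z 0).1 = z.1 := by
  have h := (evolution_equations k P.pos (hr.path_eq ρ z)).1 0 le_rfl
  simpa [timeWeight] using h

/-- The momentum shift `η(0) - ξ` as a function of the initial position and the asymptotic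
momentum. -/
def IsScale.shift (ρ : {ρ : ℝ // r ≤ ρ}) (z : E n × E n) : E n := (hr.path ρ z 0).2 - z.2

theorem IsScale.shift_eq (ρ : {ρ : ℝ // r ≤ ρ}) (z : E n × E n) :
    hr.shift ρ z = (ρ : ℝ) ^ (-μ) • (evolOp k P.pos one_pos le_rfl n
      (nemytskii (P.force ρ) (hr.path ρ z)) 0).2 := by
  have h := congrArg (fun u : ℝ →ᵇ E n × E n => (u 0).2 - z.2) (hr.path_eq ρ z)
  rw [shift]
  simpa [freePath_apply, nonlin] using h

/-- Evaluation at time `0` of the momentum of a path. -/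
def momentumAtZero (n : ℕ) : (ℝ →ᵇ E n × E n) →L[ℝ] E n :=
  (ContinuousLinearMap.snd ℝ (E n) (E n)).comp (BoundedContinuousFunction.evalCLM ℝ 0)

theorem IsScale.contDiff_shift (ρ : {ρ : ℝ // r ≤ ρ}) : ContDiff ℝ ∞ (hr.shift ρ) :=
  ((momentumAtZero n).contDiff.comp (hr.contDiff_path ρ)).sub contDiff_snd

theorem IsScale.tameOn_path : TameOn (fun ρ : {ρ : ℝ // r ≤ ρ} => hr.path ρ) fun _ => univ := by
  have hN : UnifSmoothOn (fun ρ : {ρ : ℝ // r ≤ ρ} => P.nonlin k ρ) fun _ => univ := by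
    have h1 := (P.unif_force.nemytskii.clm_comp (evolOp k P.pos one_pos le_rfl n)).reindex
      fun ρ : {ρ : ℝ // r ≤ ρ} => (⟨ρ, hr.one_le.trans ρ.2⟩ : {ρ : ℝ // 1 ≤ ρ})
    have h2 : UnifSmoothOn (V := ℝ →ᵇ E n × E n) (fun (ρ : {ρ : ℝ // r ≤ ρ}) _ => (ρ : ℝ) ^ (-μ))
        fun _ => univ := by
      refine UnifSmoothOn.const_of_bounded (C := 1) fun ρ => ?_
      have h3 := hr.one_le.trans ρ.2
      rw [Real.norm_of_nonneg (by positivity)]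
      exact Real.rpow_le_one_of_one_le_of_nonpos h3 (by linarith [P.pos])
    exact h2.bilinear (ContinuousLinearMap.lsmul ℝ ℝ) h1
  exact (tameOn_fixedPointMap hN (fun ρ => P.contDiff_nonlin k (hr.one_le.trans ρ.2))
    hr.fderiv_le).comp_tame (TameOn.of_clm (A := fun _ => freePath k n) fun _ => le_rfl)
    fun _ => mapsTo_univ _ _

/-- The explicit factor `ρ^{-μ}` in `shift_eq` multiplies a composition of a uniformly smooth force
with the tame solution map, so derivatives of every order inherit the factor. -/
theorem IsScale.exists_shift_bound (j : ℕ) : ∃ C : ℝ, 0 ≤ C ∧ ∀ (ρ : {ρ : ℝ // r ≤ ρ}) z,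
    ‖iteratedFDeriv ℝ j (hr.shift ρ) z‖ ≤ C * (ρ : ℝ) ^ (-μ) := by
  have h1 := (P.unif_force.nemytskii.clm_comp
    ((momentumAtZero n).comp (evolOp k P.pos one_pos le_rfl n))).reindex
      fun ρ : {ρ : ℝ // r ≤ ρ} => (⟨ρ, hr.one_le.trans ρ.2⟩ : {ρ : ℝ // 1 ≤ ρ})
  have h2 := h1.comp hr.tameOn_path fun _ => mapsTo_univ _ _
  obtain ⟨C, hC⟩ := h2.bound j
  refine ⟨max C 0, le_max_right _ _, fun ρ z => ?_⟩
  have h0 : 0 < (ρ : ℝ) := one_pos.trans_le (hr.one_le.trans ρ.2)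
  have h3 : hr.shift ρ = (ρ : ℝ) ^ (-μ) • fun z => ((momentumAtZero n).comp
      (evolOp k P.pos one_pos le_rfl n)) (nemytskii (P.force ρ) (hr.path ρ z)) :=
    funext fun z => hr.shift_eq ρ z
  rw [h3, iteratedFDeriv_const_smul_apply ((h2.contDiffAt ρ (mem_univ z)).of_le
    (by exact_mod_cast le_top)), norm_smul, Real.norm_of_nonneg (by positivity), mul_comm]
  gcongr
  exact (hC ρ z (mem_univ _)).trans (le_max_left _ _)

/-- The conjugated operator has norm at most `1/2` and is inverted by a Neumann series; multiplying
back by the weight solves the original linear equation. -/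
theorem exists_weighted_solution {a : ℝ} (ha0 : 0 < a) (ha : a ≤ 1) {ρ : ℝ} (hρ : 1 ≤ ρ)
    (u : ℝ →ᵇ E n × E n) (h1 : ‖P.linearized k ha0 ha ρ u‖ ≤ 1 / 2)
    (g : ℝ →ᵇ E n × E n) : ∃ x : ℝ →ᵇ E n × E n,
      weightMul _ (a - 1) (by linarith) x = weightMul _ (a - 1) (by linarith) g +
        P.linearized k one_pos le_rfl ρ u (weightMul _ (a - 1) (by linarith) x) := by
  set K := P.linearized k ha0 ha ρ u
  have hK : ‖K‖ < 1 := h1.trans_lt (by norm_num)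
  obtain ⟨x, hx⟩ : ∃ x, x - K x = g := by
    refine ⟨(↑(Units.oneSub K hK)⁻¹ : (ℝ →ᵇ E n × E n) →L[ℝ] (ℝ →ᵇ E n × E n)) g, ?_⟩
    have h := congrArg (fun A : (ℝ →ᵇ E n × E n) →L[ℝ] (ℝ →ᵇ E n × E n) => A g)
      (Units.mul_inv (Units.oneSub K hK))
    exact h
  refine ⟨x, ?_⟩
  have h2 : x = g + K x := by rw [← hx]; abel
  conv_lhs => rw [h2, map_add]
  congr 1
  simp only [K, linearized, _root_.smul_apply, map_smul,
    ContinuousLinearMap.comp_apply]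
  rw [← evolOp_weightMul]
  congr 2
  ext1 t
  rw [weightMul_apply, P.forceDeriv_apply hρ, P.forceDeriv_apply hρ, weightMul_apply, map_smul]

theorem IsScale.fderiv_path_eq (ρ : {ρ : ℝ // r ≤ ρ}) (z h : E n × E n) :
    fderiv ℝ (hr.path ρ) z h = freePath k n h +
      P.linearized k one_pos le_rfl ρ (hr.path ρ z) (fderiv ℝ (hr.path ρ) z h) := by
  have h1 : hr.path ρ = fun z => freePath k n z + P.nonlin k ρ (hr.path ρ z) :=
    funext fun z => hr.path_eq ρ z
  have h2 := (hr.contDiff_path ρ).differentiable (by simp) z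
  have h3 : HasFDerivAt (fun z => freePath k n z + P.nonlin k ρ (hr.path ρ z))
      (freePath k n + (P.linearized k one_pos le_rfl ρ (hr.path ρ z)).comp
        (fderiv ℝ (hr.path ρ) z)) z :=
    (freePath k n).hasFDerivAt.add ((P.hasFDerivAt_nonlin k (hr.one_le.trans ρ.2)
      (hr.path ρ z)).comp z h2.hasFDerivAt)
  conv_lhs => rw [h1, h3.fderiv]
  rfl

/-- The derivative of the path with respect to the initial position grows at most like
`⟨t⟩ ^ (1/4)` in position and decays at least like `⟨t⟩ ^ (-3/4)` in momentum. -/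
theorem IsScale.fderiv_path_decay (ρ : {ρ : ℝ // r ≤ ρ}) (z : E n × E n) (v : E n) :
    ∃ C : ℝ, ∀ t, ‖fderiv ℝ (hr.path ρ) z (v, 0) t‖ ≤ C * timeWeight t ^ (-(3 / 4) : ℝ) := by
  have hρ := hr.one_le.trans ρ.2
  -- The free variation `(⟨t⟩^{-1} v, 0)` is `⟨t⟩^{-3/4}` times this bounded path.
  have hg : ∀ t, ‖timeWeight t ^ (-(1 / 4) : ℝ) • ((v, 0) : E n × E n)‖ ≤ ‖((v, 0) : E n × E n)‖ := by
    intro t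
    have := timeWeight_pos t
    rw [norm_smul, Real.norm_of_nonneg (by positivity)]
    exact mul_le_of_le_one_left (norm_nonneg _) (timeWeight_rpow_le_one (by norm_num) t)
  obtain ⟨x, hx⟩ := exists_weighted_solution (k := k) (P := P) (a := 1 / 4) (by norm_num)
    (by norm_num) hρ (hr.path ρ z) (hr.linearized_quarter_le ρ ρ.2 _)
    (BoundedContinuousFunction.ofNormedAddCommGroup
      (fun t => timeWeight t ^ (-(1 / 4) : ℝ) • ((v, 0) : E n × E n))
      ((continuous_timeWeight_rpow _).smul continuous_const) _ hg)
  set y := weightMul (E n × E n) (1 / 4 - 1) (by norm_num) x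
  have hy : fderiv ℝ (hr.path ρ) z (v, 0) = y := by
    have hx' : y = freePath k n (v, 0) +
        P.linearized k one_pos le_rfl ρ (hr.path ρ z) y := by
      refine hx.trans ?_
      congr 1
      ext1 t
      have ht := timeWeight_pos t
      rw [weightMul_apply, freePath_apply, BoundedContinuousFunction.coe_ofNormedAddCommGroup,
        smul_smul, ← Real.rpow_add ht]
      norm_num [Real.rpow_neg_one]
    have h1 := hr.fderiv_path_eq ρ z (v, 0)
    set δ := fderiv ℝ (hr.path ρ) z (v, 0)
    have h2 : δ - y = P.linearized k one_pos le_rfl ρ (hr.path ρ z) (δ - y) := by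
      conv_lhs => rw [h1, hx']
      rw [map_sub]
      abel
    -- The unweighted linearization is also a contraction, so its bounded solution is unique and the
    -- derivative of the path is the decaying solution.
    have h3 : ‖δ - y‖ ≤ 1 / 2 * ‖δ - y‖ := by
      conv_lhs => rw [h2]
      exact ContinuousLinearMap.le_of_opNorm_le _ (hr.linearized_le ρ ρ.2 _) _
    exact sub_eq_zero.1 (norm_le_zero_iff.1 (by linarith [norm_nonneg (δ - y)]))
  refine ⟨‖x‖, fun t => ?_⟩
  have := timeWeight_pos t
  rw [hy, weightMul_apply, norm_smul, Real.norm_of_nonneg (by positivity), mul_comm]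
  gcongr
  · exact x.norm_coe_le_norm t
  · exact one_le_timeWeight t
  · norm_num

theorem inner_forceDeriv_fst {ρ : ℝ} (hρ : 1 ≤ ρ) (u δ : ℝ →ᵇ E n × E n) (t : ℝ) (h : E n) :
    inner ℝ (P.forceDeriv ρ u δ t).1 h =
      fderiv ℝ (fderiv ℝ (P.toFun (ρ * timeWeight t))) (u t) (δ t) (0, h) := by
  have hd : DifferentiableAt ℝ (fderiv ℝ (P.toFun (ρ * timeWeight t))) (u t) :=
    (P.unif.fderiv.contDiff_right ⟨ρ, hρ⟩ t).differentiable (by simp) _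
  rw [P.forceDeriv_apply hρ]
  have := ((gradPair n).hasFDerivAt.comp (u t) hd.hasFDerivAt).fderiv
  rw [show fderiv ℝ (P.force ρ t) (u t) = _ from this]
  exact inner_gradPair_fst _ _

theorem inner_forceDeriv_snd {ρ : ℝ} (hρ : 1 ≤ ρ) (u δ : ℝ →ᵇ E n × E n) (t : ℝ) (h : E n) :
    inner ℝ (P.forceDeriv ρ u δ t).2 h =
      fderiv ℝ (fderiv ℝ (P.toFun (ρ * timeWeight t))) (u t) (δ t) (h, 0) := by
  have hd : DifferentiableAt ℝ (fderiv ℝ (P.toFun (ρ * timeWeight t))) (u t) :=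
    (P.unif.fderiv.contDiff_right ⟨ρ, hρ⟩ t).differentiable (by simp) _
  rw [P.forceDeriv_apply hρ]
  have := ((gradPair n).hasFDerivAt.comp (u t) hd.hasFDerivAt).fderiv
  rw [show fderiv ℝ (P.force ρ t) (u t) = _ from this]
  exact inner_gradPair_snd _ _

/-- The free contribution cancels because `g₀` is symmetric, the perturbation because its Hessian
is. Positions were divided by `⟨t⟩`, which accounts for the different weights of the two forces:
`⟨t⟩ ⟨t⟩^{-1-μ} = ⟨t⟩^{-μ}`. -/
theorem IsScale.symplectic_eq (ρ : {ρ : ℝ // r ≤ ρ}) (z : E n × E n) (v w : E n) {t : ℝ}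
    (ht : 0 ≤ t) :
    HasDerivWithinAt (fun t =>
      inner ℝ (timeWeight t • (fderiv ℝ (hr.path ρ) z (v, 0) t).1)
        (fderiv ℝ (hr.path ρ) z (w, 0) t).2 -
      inner ℝ (timeWeight t • (fderiv ℝ (hr.path ρ) z (w, 0) t).1)
        (fderiv ℝ (hr.path ρ) z (v, 0) t).2) 0 (Ici 0) t := by
  have hρ := hr.one_le.trans ρ.2
  have htw := timeWeight_pos t
  set u := hr.path ρ z
  obtain ⟨a1, a2⟩ := evolution_hasDerivWithinAt k P.pos
    (f := P.forceDeriv ρ u (fderiv ℝ (hr.path ρ) z (v, 0))) (hr.fderiv_path_eq ρ z (v, 0)) ht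
  obtain ⟨b1, b2⟩ := evolution_hasDerivWithinAt k P.pos
    (f := P.forceDeriv ρ u (fderiv ℝ (hr.path ρ) z (w, 0))) (hr.fderiv_path_eq ρ z (w, 0)) ht
  set δ := fderiv ℝ (hr.path ρ) z (v, 0)
  set δ' := fderiv ℝ (hr.path ρ) z (w, 0)
  have hsymm : fderiv ℝ (fderiv ℝ (P.toFun (ρ * timeWeight t))) (u t) (δ t) (δ' t) =
      fderiv ℝ (fderiv ℝ (P.toFun (ρ * timeWeight t))) (u t) (δ' t) (δ t) :=
    ((P.unif.contDiff_right ⟨ρ, hρ⟩ t).contDiffAt.isSymmSndFDerivAt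
      (by
      rw [minSmoothness_of_isRCLikeNormedField]
      exact WithTop.coe_le_coe.2 le_top)) _ _
  -- Splitting a Hessian slot into position and momentum parts matches the two force components.
  have hsplit : ∀ x : E n × E n, x = (0, x.2) + (x.1, 0) := fun x => by simp
  refine HasDerivWithinAt.congr_deriv ((a1.inner ℝ b2).sub (b1.inner ℝ a2)) ?_
  have hw : timeWeight t * timeWeight t ^ (-1 - μ) = timeWeight t ^ (-μ) := by
    rw [← Real.rpow_one_add' htw.le (by linarith [P.pos])]
    congr 1; ring
  simp only [inner_add_left, real_inner_smul_left, real_inner_smul_right, inner_flatOp]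
  rw [real_inner_comm _ (δ t).1, real_inner_comm _ (δ' t).1, inner_forceDeriv_snd hρ,
    inner_forceDeriv_snd hρ, inner_forceDeriv_fst hρ, inner_forceDeriv_fst hρ, g₀_comm k (δ t).2]
  conv at hsymm => lhs; arg 2; rw [hsplit (δ' t)]
  conv at hsymm => rhs; arg 2; rw [hsplit (δ t)]
  rw [map_add, map_add] at hsymm
  simp only [← hw]
  linear_combination ((ρ : ℝ) ^ (-μ) * (timeWeight t * timeWeight t ^ (-1 - μ))) * hsymm

/-- The derivative of the momentum shift with respect to position is symmetric. -/
theorem IsScale.fderiv_shift_symm (ρ : {ρ : ℝ // r ≤ ρ}) (z : E n × E n) (v w : E n) :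
    inner ℝ (fderiv ℝ (hr.shift ρ) z (v, 0)) w = inner ℝ (fderiv ℝ (hr.shift ρ) z (w, 0)) v := by
  set δ := fderiv ℝ (hr.path ρ) z (v, 0) with hδ
  set δ' := fderiv ℝ (hr.path ρ) z (w, 0) with hδ'
  have hshift : ∀ h : E n, fderiv ℝ (hr.shift ρ) z (h, 0) =
      (fderiv ℝ (hr.path ρ) z (h, 0) 0).2 := by
    intro h
    have h1 := ((momentumAtZero n).hasFDerivAt.comp z
      ((hr.contDiff_path ρ).differentiable (by simp) z).hasFDerivAt).sub
        (hasFDerivAt_snd (𝕜 := ℝ) (p := z))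
    rw [show fderiv ℝ (hr.shift ρ) z = _ from h1.fderiv]
    simp [momentumAtZero]
  have hfst : ∀ h : E n, (fderiv ℝ (hr.path ρ) z (h, 0) 0).1 = h := by
    intro h
    have h1 := (evolution_equations k P.pos (hr.fderiv_path_eq ρ z (h, 0))).1 0 le_rfl
    simpa [timeWeight] using h1
  set Ω : ℝ → ℝ := fun t => inner ℝ (timeWeight t • (δ t).1) (δ' t).2 -
    inner ℝ (timeWeight t • (δ' t).1) (δ t).2 with hΩ
  have hderiv : ∀ t, 0 ≤ t → HasDerivWithinAt Ω 0 (Ici 0) t := fun t ht =>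
    hr.symplectic_eq ρ z v w ht
  have hconst : ∀ T, 0 ≤ T → Ω T = Ω 0 := by
    intro T hT
    refine constant_of_has_deriv_right_zero (a := 0) (b := T)
      (fun t ht => ((hderiv t ht.1).continuousWithinAt.mono Icc_subset_Ici_self))
      (fun t ht => (hderiv t ht.1).mono (Ici_subset_Ici.2 ht.1)) T ⟨hT, le_rfl⟩
  obtain ⟨C, hC⟩ := hr.fderiv_path_decay ρ z v
  obtain ⟨C', hC'⟩ := hr.fderiv_path_decay ρ z w
  -- Each term is at most a constant times `⟨t⟩ · ⟨t⟩^{-3/4} · ⟨t⟩^{-3/4} = ⟨t⟩^{-1/2}`. This is why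
  -- the conjugation exponent is `1/4`: it has to be below `1/2`.
  have hlim : Tendsto Ω atTop (𝓝 0) := by
    refine squeeze_zero_norm' (a := fun t => 2 * (C * C') * timeWeight t ^ (-(1 / 2) : ℝ)) ?_ ?_
    · refine Eventually.of_forall fun t => ?_
      have htw := timeWeight_pos t
      have key : ∀ x y : E n, ‖x‖ * ‖y‖ ≤ C * C' * timeWeight t ^ (-(3 / 2) : ℝ) →
          ‖inner ℝ (timeWeight t • x) y‖ ≤ C * C' * timeWeight t ^ (-(1 / 2) : ℝ) := by
        intro x y hxy
        refine (norm_inner_le_norm _ _).trans ?_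
        rw [norm_smul, Real.norm_of_nonneg htw.le, mul_assoc]
        calc _ ≤ timeWeight t * (C * C' * timeWeight t ^ (-(3 / 2) : ℝ)) := by gcongr
          _ = C * C' * (timeWeight t ^ (1 : ℝ) * timeWeight t ^ (-(3 / 2) : ℝ)) := by
            rw [Real.rpow_one]; ring
          _ = _ := by rw [← Real.rpow_add htw]; norm_num
      have hpow : timeWeight t ^ (-(3 / 4) : ℝ) * timeWeight t ^ (-(3 / 4) : ℝ) =
          timeWeight t ^ (-(3 / 2) : ℝ) := by
        rw [← Real.rpow_add htw]; norm_num
      have hprod : ‖δ t‖ * ‖δ' t‖ ≤ C * C' * timeWeight t ^ (-(3 / 2) : ℝ) := by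
        calc _ ≤ (C * timeWeight t ^ (-(3 / 4) : ℝ)) * (C' * timeWeight t ^ (-(3 / 4) : ℝ)) :=
              mul_le_mul (hC t) (hC' t) (norm_nonneg _) ((norm_nonneg _).trans (hC t))
          _ = C * C' * (timeWeight t ^ (-(3 / 4) : ℝ) * timeWeight t ^ (-(3 / 4) : ℝ)) := by ring
          _ = _ := by rw [hpow]
      have e1 := key (δ t).1 (δ' t).2 ((mul_le_mul (norm_fst_le _) (norm_snd_le _)
        (norm_nonneg _) (norm_nonneg _)).trans hprod)
      have e2 := key (δ' t).1 (δ t).2 ((mul_comm _ _).trans_le ((mul_le_mul (norm_snd_le _)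
        (norm_fst_le _) (norm_nonneg _) (norm_nonneg _)).trans hprod))
      refine (norm_sub_le _ _).trans ?_
      linarith
    · have h1 : Tendsto timeWeight atTop atTop :=
        tendsto_atTop_mono (fun t => (le_abs_self t).trans (abs_le_timeWeight t)) tendsto_id
      have h2 := ((tendsto_rpow_neg_atTop (y := 1 / 2) (by norm_num)).comp h1).const_mul
        (2 * (C * C'))
      rw [mul_zero] at h2
      exact h2
  have h0 : Ω 0 = 0 := by
    refine tendsto_nhds_unique (tendsto_const_nhds.congr' ?_) hlim
    exact (eventually_ge_atTop 0).mono fun t ht => (hconst t ht).symm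
  have htw0 : timeWeight 0 = 1 := by simp [timeWeight]
  rw [hΩ] at h0
  simp only [htw0, one_smul, hδ, hδ', hfst] at h0
  rw [hshift, hshift, real_inner_comm w, real_inner_comm v]
  linarith

end Perturbation

/-! ### Iterated directional derivatives. -/

section DirectionalDerivatives

variable {V : Type*} [NormedAddCommGroup V] [NormedSpace ℝ V]

theorem contDiff_dirDerivs {f : V → ℝ} (hf : ContDiff ℝ ∞ f) (L : List V) :
    ContDiff ℝ ∞ (dirDerivs L f) := by
  induction L with
  | nil => exact hf
  | cons v L ih => exact (ih.fderiv_right (m := ∞) (by simp)).clm_apply contDiff_const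

theorem dirDerivs_eq_iteratedFDeriv {f : V → ℝ} (hf : ContDiff ℝ ∞ f) (L : List V) (p : V) :
    dirDerivs L f p = iteratedFDeriv ℝ L.length f p L.get := by
  induction L generalizing p with
  | nil => simp [dirDerivs]
  | cons v L ih =>
    have h1 : dirDerivs L f = fun p => iteratedFDeriv ℝ L.length f p L.get := funext ih
    have h2 : DifferentiableAt ℝ (iteratedFDeriv ℝ L.length f) p :=
      (hf.differentiable_iteratedFDeriv (by exact_mod_cast ENat.natCast_lt_top _)) p
    rw [dirDerivs, h1]
    exact (h2.iteratedFDeriv_succ_apply_left' (m := (v :: L).get)).symm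

theorem abs_dirDerivs_le {f : V → ℝ} (hf : ContDiff ℝ ∞ f) {L : List V} (hL : ∀ v ∈ L, ‖v‖ ≤ 1)
    (p : V) : |dirDerivs L f p| ≤ ‖iteratedFDeriv ℝ L.length f p‖ := by
  rw [dirDerivs_eq_iteratedFDeriv hf, ← Real.norm_eq_abs]
  refine (ContinuousMultilinearMap.le_opNorm _ _).trans ?_
  refine mul_le_of_le_one_right (norm_nonneg _) (Finset.prod_le_one (fun _ _ => norm_nonneg _) ?_)
  exact fun i _ => hL _ (List.get_mem L i)

theorem dirDerivs_perm {f : V → ℝ} (hf : ContDiff ℝ ∞ f) {L L' : List V} (h : L.Perm L') :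
    dirDerivs L f = dirDerivs L' f := by
  induction h with
  | nil => rfl
  | cons v _ ih => simp only [dirDerivs, ih]
  | trans _ _ ih₁ ih₂ => exact ih₁.trans ih₂
  | swap v w L =>
    have hg := contDiff_dirDerivs hf L
    set g := dirDerivs L f with hgdef
    have hd : ∀ p, DifferentiableAt ℝ (fderiv ℝ g) p := fun p =>
      (hg.fderiv_right (m := ∞) (by simp)).differentiable (by simp) p
    ext1 p
    have h1 : ∀ u, fderiv ℝ (fun p => fderiv ℝ g p u) p = (fderiv ℝ (fderiv ℝ g) p).flip u := by
      intro u
      rw [fderiv_clm_apply (hd p) (differentiableAt_const u)]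
      ext; simp
    change fderiv ℝ (fun p => fderiv ℝ g p v) p w = fderiv ℝ (fun p => fderiv ℝ g p w) p v
    rw [h1, h1]
    exact (hg.contDiffAt.isSymmSndFDerivAt (by
      rw [minSmoothness_of_isRCLikeNormedField]
      exact WithTop.coe_le_coe.2 le_top)) w v

theorem dirDerivs_comp_clm {W : Type*} [NormedAddCommGroup W] [NormedSpace ℝ W] {f : W → ℝ}
    (hf : ContDiff ℝ ∞ f) (A : V →L[ℝ] W) (L : List V) (p : V) :
    dirDerivs L (fun p => f (A p)) p = dirDerivs (L.map A) f (A p) := by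
  induction L generalizing p with
  | nil => rfl
  | cons v L ih =>
    have h1 : dirDerivs L (fun p => f (A p)) = fun p => dirDerivs (L.map A) f (A p) := funext ih
    have h2 : HasFDerivAt (dirDerivs (L.map A) f) _ (A p) :=
      ((contDiff_dirDerivs hf (L.map A)).differentiable (by simp) (A p)).hasFDerivAt
    rw [dirDerivs, h1]
    exact congrArg (fun T : V →L[ℝ] ℝ => T v) (h2.comp p A.hasFDerivAt).fderiv

theorem dirDerivs_smul_append {f : V → ℝ} (hf : ContDiff ℝ ∞ f) (c : ℝ) (L L' : List V) :
    dirDerivs (L.map (fun v => c • v) ++ L') f = fun p => c ^ L.length * dirDerivs (L ++ L') f p := by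
  induction L with
  | nil => simp
  | cons v L ih =>
    ext1 p
    have h2 : DifferentiableAt ℝ (dirDerivs (L ++ L') f) p :=
      (contDiff_dirDerivs hf (L ++ L')).differentiable (by simp) p
    rw [List.map_cons, List.cons_append, dirDerivs, ih]
    simp only [fderiv_const_mul h2, map_smul, List.cons_append, dirDerivs, List.length_cons,
      smul_eq_mul, _root_.smul_apply]
    ring

theorem dirDerivs_const_mul {f : V → ℝ} (hf : ContDiff ℝ ∞ f) (c : ℝ) (L : List V) (p : V) :
    dirDerivs L (fun p => c * f p) p = c * dirDerivs L f p := by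
  induction L generalizing p with
  | nil => rfl
  | cons v L ih =>
    rw [dirDerivs, funext ih]
    exact congrArg (fun T : V →L[ℝ] ℝ => T v) (fderiv_const_mul
      ((contDiff_dirDerivs hf L).differentiable (by simp) p) c)

end DirectionalDerivatives

/-! ### Passage between multi-index bounds and iterated derivatives, and scaling. -/

section MultiIndices

variable {n : ℕ}

theorem count_word (α : Fin n → ℕ) (i : Fin n) : (word α).count i = α i := by
  rw [word, List.count_flatMap]
  have h : (List.map (List.count i ∘ fun i => List.replicate (α i) i) (List.finRange n)).sum =
      ∑ j, if j = i then α j else 0 := by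
    rw [Fin.sum_univ_def]
    congr 1
    refine List.map_congr_left fun j _ => ?_
    simp [List.count_replicate]
  rw [h]
  simp

theorem length_word (α : Fin n → ℕ) : (word α).length = order α := by
  rw [word, List.length_flatMap, order, Fin.sum_univ_def]
  simp

/-- By symmetry of mixed partials only the letter counts of a word matter, so every string of
coordinate directions is covered by a multi-index. -/
theorem exists_word_perm (l : List (Fin n)) :
    ∃ α : Fin n → ℕ, order α = l.length ∧ l.Perm (word α) := by
  have h : l.Perm (word fun i => l.count i) :=
    List.perm_iff_count.2 fun i => (count_word (fun i => l.count i) i).symm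
  exact ⟨_, by rw [← length_word]; exact h.length_eq.symm, h⟩

theorem norm_le_sum_basis {m : ℕ} (T : ContinuousMultilinearMap ℝ (fun _ : Fin m => E n) ℝ) :
    ‖T‖ ≤ ∑ i : Fin m → Fin n, |T fun j => EuclideanSpace.single (i j) (1 : ℝ)| := by
  refine ContinuousMultilinearMap.opNorm_le_bound (by positivity) fun v => ?_
  have hv : v = fun j => ∑ i : Fin n, v j i • EuclideanSpace.single i (1 : ℝ) := by
    funext j
    ext l
    simp [Finset.sum_apply, Pi.single_apply]
  conv_lhs => rw [hv]
  rw [ContinuousMultilinearMap.map_sum, Finset.sum_mul]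
  refine (norm_sum_le _ _).trans (Finset.sum_le_sum fun i _ => ?_)
  rw [ContinuousMultilinearMap.map_smul_univ, norm_smul, mul_comm, norm_prod, Real.norm_eq_abs]
  gcongr with j
  exact PiLp.norm_apply_le (v j) (i j)

/-- Bounds on all partial derivatives of a given order bound the iterated derivative. -/
theorem norm_iteratedFDeriv_le_of_partialDeriv {f : E n → ℝ} (hf : ContDiff ℝ ∞ f) (m : ℕ)
    {w : E n → ℝ}
    (h : ∀ α : Fin n → ℕ, order α = m → ∃ C : ℝ, ∀ x, |partialDeriv α f x| ≤ C * w x) :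
    ∃ C : ℝ, ∀ x, ‖iteratedFDeriv ℝ m f x‖ ≤ C * w x := by
  have h1 : ∀ i : Fin m → Fin n, ∃ C : ℝ, ∀ x,
      |iteratedFDeriv ℝ m f x fun j => EuclideanSpace.single (i j) (1 : ℝ)| ≤ C * w x := by
    intro i
    obtain ⟨α, hα, hp⟩ := exists_word_perm (List.ofFn i)
    rw [List.length_ofFn] at hα
    obtain ⟨C, hC⟩ := h α hα
    refine ⟨C, fun x => (le_of_eq ?_).trans (hC x)⟩
    have h2 := dirDerivs_perm hf (hp.map fun i => EuclideanSpace.single i (1 : ℝ))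
    rw [partialDeriv, ← h2, dirDerivs_eq_iteratedFDeriv hf]
    congr 1
    have h3 : ∀ L : List (E n), ∀ hL : L.length = m,
        iteratedFDeriv ℝ L.length f x L.get = iteratedFDeriv ℝ m f x fun j => L.get (j.cast hL.symm) := by
      rintro L rfl; rfl
    rw [h3 _ (by simp)]
    congr 1
    ext1 j
    simp
  choose C hC using h1
  refine ⟨∑ i, C i, fun x => (norm_le_sum_basis _).trans ?_⟩
  rw [Finset.sum_mul]
  exact Finset.sum_le_sum fun i _ => hC i x

/-- The dilation `(x, ξ) ↦ (ρ x, ξ)`. -/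
def dilate (n : ℕ) (ρ : ℝ) : E n × E n →L[ℝ] E n × E n :=
  (ρ • ContinuousLinearMap.fst ℝ (E n) (E n)).prod (ContinuousLinearMap.snd ℝ (E n) (E n))

@[simp]
theorem dilate_apply (ρ : ℝ) (z : E n × E n) : dilate n ρ z = (ρ • z.1, z.2) := rfl

theorem mixedDeriv_dilate {f : E n × E n → ℝ} (hf : ContDiff ℝ ∞ f) (ρ : ℝ) (α β : Fin n → ℕ)
    (z : E n × E n) : mixedDeriv α β (fun p => f (dilate n ρ p)) z =
      ρ ^ order α * mixedDeriv α β f (dilate n ρ z) := by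
  rw [mixedDeriv, dirDerivs_comp_clm hf, mixedDeriv, List.map_append, List.map_map, List.map_map]
  have h := congrFun (dirDerivs_smul_append hf ρ ((word α).map fun i =>
    ((EuclideanSpace.single i (1 : ℝ), 0) : E n × E n)) ((word β).map fun j =>
    ((0, EuclideanSpace.single j (1 : ℝ)) : E n × E n))) (dilate n ρ z)
  rw [List.length_map, length_word, List.map_map] at h
  rw [← h]
  congr 2
  · refine List.map_congr_left fun i _ => ?_
    simp
  · refine List.map_congr_left fun i _ => ?_
    simp

theorem abs_mixedDeriv_le {f : E n × E n → ℝ} (hf : ContDiff ℝ ∞ f) (α β : Fin n → ℕ)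
    (p : E n × E n) :
    |mixedDeriv α β f p| ≤ ‖iteratedFDeriv ℝ (order α + order β) f p‖ := by
  refine (abs_dirDerivs_le hf (fun v hv => ?_) p).trans (le_of_eq ?_)
  · rcases List.mem_append.1 hv with hv | hv <;> obtain ⟨i, -, rfl⟩ := List.mem_map.1 hv <;>
      simp [Prod.norm_def]
  · rw [List.length_append, List.length_map, List.length_map, length_word, length_word]

/-- A bound on the iterated derivative of the dilated function bounds the mixed derivatives of
the function. -/
theorem abs_mixedDeriv_le_of_dilate {f : E n × E n → ℝ} (hf : ContDiff ℝ ∞ f) (α β : Fin n → ℕ)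
    {ρ B : ℝ} (hρ : 0 < ρ) {x ξ : E n}
    (h : ‖iteratedFDeriv ℝ (order α + order β) (fun p => f (dilate n ρ p)) (ρ⁻¹ • x, ξ)‖ ≤ B) :
    |mixedDeriv α β f (x, ξ)| ≤ ρ ^ (-(order α : ℝ)) * B := by
  have h1 := (abs_mixedDeriv_le (hf.comp (dilate n ρ).contDiff) α β (ρ⁻¹ • x, ξ)).trans h
  rw [show (f ∘ ⇑(dilate n ρ)) = fun p => f (dilate n ρ p) from rfl, mixedDeriv_dilate hf,
    dilate_apply, smul_inv_smul₀ hρ.ne', abs_mul, abs_of_nonneg (by positivity)] at h1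
  rw [Real.rpow_neg hρ.le, Real.rpow_natCast, inv_mul_eq_div, le_div_iff₀ (by positivity), mul_comm]
  exact h1

end MultiIndices

/-! ### Cutoff functions. -/

section Cutoffs

variable {n : ℕ} {ι V W : Type*} [NormedAddCommGroup V] [NormedSpace ℝ V]
  [NormedAddCommGroup W] [NormedSpace ℝ W]

theorem unifSmoothOn_of_hasCompactSupport {f : V → W} (hf : ContDiff ℝ ∞ f)
    (hc : HasCompactSupport f) : UnifSmoothOn (fun _ : ι => f) fun _ => univ := by
  refine ⟨fun _ => isOpen_univ, fun _ => hf.contDiffOn, fun j => ?_⟩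
  obtain ⟨C, hC⟩ := (hf.continuous_iteratedFDeriv (m := j)
    (by exact_mod_cast le_top)).bounded_above_of_compact_support (hc.iteratedFDeriv j)
  exact ⟨C, fun _ v _ => hC v⟩

/-- A smooth function which is `0` for `|x| ≤ 1/2` and `1` for `|x| ≥ 1`. -/
def farCutoff (x : E n) : ℝ := Real.smoothTransition ((4 * ‖x‖ ^ 2 - 1) / 3)

theorem contDiff_farCutoff : ContDiff ℝ ∞ (farCutoff : E n → ℝ) :=
  Real.smoothTransition.contDiff.comp (((contDiff_const.mul (contDiff_norm_sq ℝ)).sub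
    contDiff_const).div_const 3)

theorem farCutoff_eq_zero {x : E n} (hx : ‖x‖ ≤ 1 / 2) : farCutoff x = 0 :=
  Real.smoothTransition.zero_of_nonpos (by nlinarith [norm_nonneg x])

theorem farCutoff_eq_one {x : E n} (hx : 1 ≤ ‖x‖) : farCutoff x = 1 :=
  Real.smoothTransition.one_of_one_le (by nlinarith)

theorem hasCompactSupport_one_sub_farCutoff : HasCompactSupport fun x : E n => 1 - farCutoff x := by
  refine HasCompactSupport.intro (isCompact_closedBall (0 : E n) 1) fun x hx => ?_
  rw [mem_closedBall_zero_iff, not_le] at hx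
  rw [farCutoff_eq_one hx.le, sub_self]

theorem unifSmoothOn_farCutoff : UnifSmoothOn (fun _ : ι => (farCutoff : E n → ℝ)) fun _ => univ := by
  have h1 := unifSmoothOn_of_hasCompactSupport (ι := ι) (contDiff_const.sub contDiff_farCutoff)
    (hasCompactSupport_one_sub_farCutoff (n := n))
  have h2 : UnifSmoothOn (V := E n) (fun (_ : ι) _ => (1 : ℝ)) fun _ => univ :=
    UnifSmoothOn.const_of_bounded (C := 1) fun _ => by simp
  have h3 := (UnifSmoothOn.sum (V := E n) (W := ℝ) (ι := ι) (Finset.univ : Finset Bool)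
    (f := fun b => if b then fun _ _ => 1 else fun _ x => -(1 - farCutoff x))
    (s := fun _ => univ) (fun _ => isOpen_univ) (by
      rintro (_ | _) _
      · exact h1.clm_comp (-ContinuousLinearMap.id ℝ ℝ)
      · exact h2))
  refine h3.congr fun i x _ => ?_
  simp

/-- A smooth function which is `1` for `|x| ≤ M` and `0` for `|x| ≥ 2M`. -/
def nearCutoff (M : ℝ) (x : E n) : ℝ := 1 - farCutoff ((2 * M)⁻¹ • x)

theorem contDiff_nearCutoff (M : ℝ) : ContDiff ℝ ∞ (nearCutoff M : E n → ℝ) :=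
  contDiff_const.sub (contDiff_farCutoff.comp (contDiff_const_smul _))

theorem nearCutoff_eq_one {M : ℝ} (hM : 0 < M) {x : E n} (hx : ‖x‖ ≤ M) : nearCutoff M x = 1 := by
  rw [nearCutoff, farCutoff_eq_zero, sub_zero]
  rw [norm_smul, Real.norm_of_nonneg (by positivity), inv_mul_le_iff₀ (by positivity)]
  linarith

theorem nearCutoff_eq_zero {M : ℝ} (hM : 0 < M) {x : E n} (hx : 2 * M ≤ ‖x‖) :
    nearCutoff M x = 0 := by
  rw [nearCutoff, farCutoff_eq_one, sub_self]
  rw [norm_smul, Real.norm_of_nonneg (by positivity), le_inv_mul_iff₀ (by positivity)]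
  linarith

theorem hasCompactSupport_nearCutoff {M : ℝ} (hM : 0 < M) :
    HasCompactSupport (nearCutoff M : E n → ℝ) := by
  refine HasCompactSupport.intro (isCompact_closedBall (0 : E n) (2 * M)) fun x hx => ?_
  rw [mem_closedBall_zero_iff, not_le] at hx
  exact nearCutoff_eq_zero hM hx.le

end Cutoffs

/-! ### The rescaled and cut-off Hamiltonian. -/

section Hamiltonian

variable {n : ℕ}

theorem one_le_jap (x : E n) : 1 ≤ jap x := by
  rw [jap, Real.one_le_sqrt]; nlinarith [sq_nonneg ‖x‖]

theorem norm_le_jap (x : E n) : ‖x‖ ≤ jap x := by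
  rw [jap]; exact Real.le_sqrt_of_sq_le (by linarith)

/-- The rescaled symbol `τ^μ h(τ Y)`, cut off near the origin, is bounded with all its
derivatives, uniformly in `τ ≥ 1`. -/
theorem unifSmoothOn_rescaled {μ c : ℝ} (hc : 0 < c) {h : E n → ℝ} (hh : ContDiff ℝ ∞ h)
    (hd : ∀ m : ℕ, ∃ C : ℝ, ∀ x, ‖iteratedFDeriv ℝ m h x‖ ≤ C * jap x ^ (-μ - (m : ℝ)))
    (hμ : 0 < μ) :
    UnifSmoothOn (fun (τ : {τ : ℝ // 1 ≤ τ}) (Y : E n) =>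
      farCutoff (c⁻¹ • Y) * ((τ : ℝ) ^ μ * h ((τ : ℝ) • Y))) fun _ => univ := by
  have hfar : UnifSmoothOn (fun (_ : {τ : ℝ // 1 ≤ τ}) (Y : E n) => farCutoff (c⁻¹ • Y))
      fun _ => univ := by
    have h1 := unifSmoothOn_farCutoff (ι := {τ : ℝ // 1 ≤ τ}) (n := n)
    exact h1.comp (TameOn.of_clm (A := fun _ => c⁻¹ • ContinuousLinearMap.id ℝ (E n))
      fun _ => le_rfl) fun _ => mapsTo_univ _ _
  -- These two sets cover space. On the first, `⟨τY⟩ ≥ τc/3`, so the powers of `τ` from the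
  -- prefactor, the chain rule and the decay cancel; on the second the cutoff vanishes.
  have hopen1 : IsOpen {Y : E n | c / 3 < ‖Y‖} := isOpen_lt continuous_const continuous_norm
  have hopen2 : IsOpen {Y : E n | ‖Y‖ < c / 2} := isOpen_lt continuous_norm continuous_const
  have hsm : ∀ τ : ℝ, ContDiff ℝ ∞ fun Y : E n => h (τ • Y) := fun τ =>
    hh.comp (contDiff_const_smul τ)
  have hin : UnifSmoothOn (fun (τ : {τ : ℝ // 1 ≤ τ}) (Y : E n) => (τ : ℝ) ^ μ * h ((τ : ℝ) • Y))
      fun _ => {Y : E n | c / 3 < ‖Y‖} := by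
    refine ⟨fun _ => hopen1, fun τ => (contDiff_const.mul (hsm τ)).contDiffOn, fun j => ?_⟩
    obtain ⟨C, hC⟩ := hd j
    refine ⟨max C 0 * (c / 3) ^ (-μ - (j : ℝ)), fun τ Y hY => ?_⟩
    have hτ : 0 < (τ : ℝ) := one_pos.trans_le τ.2
    have hY' : 0 < ‖Y‖ := lt_trans (by positivity) hY
    rw [show (fun Y : E n => (τ : ℝ) ^ μ * h ((τ : ℝ) • Y)) =
      fun Y => (τ : ℝ) ^ μ • h ((τ : ℝ) • Y) from rfl,
      iteratedFDeriv_const_smul_apply' ((hsm τ).contDiffAt.of_le (by exact_mod_cast le_top)),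
      iteratedFDeriv_comp_const_smul _ (hh.of_le (by exact_mod_cast le_top)), norm_smul, norm_smul,
      norm_pow, Real.norm_of_nonneg hτ.le, Real.norm_of_nonneg (by positivity)]
    have h1 : jap ((τ : ℝ) • Y) ^ (-μ - (j : ℝ)) ≤ ((τ : ℝ) * (c / 3)) ^ (-μ - (j : ℝ)) := by
      refine Real.rpow_le_rpow_of_nonpos (by positivity) ?_ (by
        have : (0 : ℝ) ≤ j := by positivity
        linarith)
      refine le_trans ?_ (norm_le_jap _)
      rw [norm_smul, Real.norm_of_nonneg hτ.le]
      exact mul_le_mul_of_nonneg_left (le_of_lt hY) hτ.le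
    have h2 : ‖iteratedFDeriv ℝ j h ((τ : ℝ) • Y)‖ ≤
        max C 0 * ((τ : ℝ) * (c / 3)) ^ (-μ - (j : ℝ)) := by
      refine (hC _).trans ?_
      have : 0 ≤ jap ((τ : ℝ) • Y) ^ (-μ - (j : ℝ)) :=
        Real.rpow_nonneg (zero_le_one.trans (one_le_jap _)) _
      gcongr
      exact le_max_left _ _
    rw [Real.mul_rpow hτ.le (by positivity)] at h2
    calc _ ≤ (τ : ℝ) ^ μ * ((τ : ℝ) ^ j * (max C 0 * ((τ : ℝ) ^ (-μ - (j : ℝ)) *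
          (c / 3) ^ (-μ - (j : ℝ))))) := by gcongr
      _ = ((τ : ℝ) ^ μ * (τ : ℝ) ^ (j : ℝ) * (τ : ℝ) ^ (-μ - (j : ℝ))) *
          (max C 0 * (c / 3) ^ (-μ - (j : ℝ))) := by rw [Real.rpow_natCast]; ring
      _ = _ := by
        rw [← Real.rpow_add hτ, ← Real.rpow_add hτ]
        simp
  have hA := (hfar.mono (fun _ => hopen1) fun _ => subset_univ _).bilinear
    (ContinuousLinearMap.mul ℝ ℝ) hin
  have hB : UnifSmoothOn (fun (τ : {τ : ℝ // 1 ≤ τ}) (Y : E n) =>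
      farCutoff (c⁻¹ • Y) * ((τ : ℝ) ^ μ * h ((τ : ℝ) • Y))) fun _ => {Y : E n | ‖Y‖ < c / 2} := by
    have h0 : UnifSmoothOn (V := E n) (fun (_ : {τ : ℝ // 1 ≤ τ}) _ => (0 : ℝ)) fun _ => univ :=
      UnifSmoothOn.const_of_bounded (C := 0) fun _ => by simp
    refine (h0.mono (fun _ => hopen2) fun _ => subset_univ _).congr fun τ Y hY => ?_
    have h1 : ‖c⁻¹ • Y‖ ≤ 1 / 2 := by
      rw [norm_smul, Real.norm_of_nonneg (by positivity), inv_mul_le_iff₀ hc]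
      have : ‖Y‖ < c / 2 := hY
      linarith
    rw [farCutoff_eq_zero h1, zero_mul]
  have hU := UnifSmoothOn.union hA hB
  refine hU.mono (fun _ => isOpen_univ) fun τ Y _ => ?_
  rcases lt_or_ge (c / 3) ‖Y‖ with h | h
  · exact Or.inl h
  · exact Or.inr (lt_of_le_of_lt h (by linarith))

variable (k : ℕ) (μ : ℝ) (G : E n → Matrix (Fin n) (Fin n) ℝ)

/-- The perturbation `τ^μ (g_{τY}(η, η) - g₀(η, η))` of the free Hamiltonian, cut off for `|Y|`
small and for `|η|` large. -/
def cutHamiltonian (c M τ : ℝ) (v : E n × E n) : ℝ :=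
  ∑ i, ∑ j, farCutoff (c⁻¹ • v.1) * (τ ^ μ * (G (τ • v.1) i j - flatMatrix n k i j)) *
    (nearCutoff M v.2 * (v.2 i * v.2 j))

theorem cutHamiltonian_eq {c M τ : ℝ} (hc : 0 < c) (hM : 0 < M) {v : E n × E n}
    (h1 : c ≤ ‖v.1‖) (h2 : ‖v.2‖ ≤ M) :
    cutHamiltonian k μ G c M τ v = τ ^ μ * (bilin (G (τ • v.1)) v.2 v.2 - g₀ k v.2 v.2) := by
  have h3 : 1 ≤ ‖c⁻¹ • v.1‖ := by
    rw [norm_smul, Real.norm_of_nonneg (by positivity), le_inv_mul_iff₀ hc]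
    linarith
  simp only [cutHamiltonian, g₀, bilin, farCutoff_eq_one h3, nearCutoff_eq_one hM h2]
  rw [← Finset.sum_sub_distrib, Finset.mul_sum]
  refine Finset.sum_congr rfl fun i _ => ?_
  rw [← Finset.sum_sub_distrib, Finset.mul_sum]
  exact Finset.sum_congr rfl fun j _ => by ring

variable {k μ G}

theorem IsLongRange.iteratedFDeriv_le (hG : IsLongRange k μ G) (i j : Fin n) (m : ℕ) :
    ∃ C : ℝ, ∀ x, ‖iteratedFDeriv ℝ m (fun y => G y i j - flatMatrix n k i j) x‖ ≤
      C * jap x ^ (-μ - (m : ℝ)) := by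
  refine norm_iteratedFDeriv_le_of_partialDeriv ((hG.smooth i j).sub contDiff_const) m
    fun α hα => ?_
  obtain ⟨C, hC⟩ := hG.decay α
  refine ⟨C, fun x => ?_⟩
  rw [← hα]
  refine le_trans ?_ (hC x)
  refine le_trans ?_ (Finset.single_le_sum (f := fun i => ∑ j,
    |partialDeriv α (fun y => G y i j - flatMatrix n k i j) x|)
    (fun i _ => Finset.sum_nonneg fun j _ => abs_nonneg _) (Finset.mem_univ i))
  exact Finset.single_le_sum (f := fun j =>
    |partialDeriv α (fun y => G y i j - flatMatrix n k i j) x|)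
    (fun j _ => abs_nonneg _) (Finset.mem_univ j)

/-- Each summand is a cut-off rescaled symbol in the position variable times a compactly supported
function of momentum, and `ρ⟨t⟩ ≥ 1` is the scale of the symbol. -/
theorem unifSmoothPaths_cutHamiltonian (hG : IsLongRange k μ G) (hμ : 0 < μ) {c M : ℝ}
    (hc : 0 < c) (hM : 0 < M) :
    UnifSmoothPaths fun (ρ : {ρ : ℝ // 1 ≤ ρ}) t v =>
      cutHamiltonian k μ G c M (ρ * timeWeight t) v := by
  have hcoord : ∀ i : Fin n, ContDiff ℝ ∞ fun v : E n => v i := fun i =>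
    (EuclideanSpace.proj (𝕜 := ℝ) i).contDiff
  have hmom : ∀ i j : Fin n, ContDiff ℝ ∞ fun η : E n => nearCutoff M η * (η i * η j) := fun i j =>
    (contDiff_nearCutoff M).mul ((hcoord i).mul (hcoord j))
  constructor
  · intro ρ
    have hτ : ContDiff ℝ ∞ fun p : ℝ × (E n × E n) => (ρ : ℝ) * timeWeight p.1 :=
      contDiff_const.mul (contDiff_timeWeight.comp contDiff_fst)
    have hY : ContDiff ℝ ∞ fun p : ℝ × (E n × E n) => p.2.1 := contDiff_fst.comp contDiff_snd
    have hη : ContDiff ℝ ∞ fun p : ℝ × (E n × E n) => p.2.2 := contDiff_snd.comp contDiff_snd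
    refine ContDiff.sum fun i _ => ContDiff.sum fun j _ => ?_
    refine ((contDiff_farCutoff.comp (hY.const_smul c⁻¹)).mul
      ((hτ.rpow_const_of_ne fun p => ?_).mul
        (((hG.smooth i j).comp (hτ.smul hY)).sub contDiff_const))).mul ((hmom i j).comp hη)
    have := timeWeight_pos p.1
    have := one_pos.trans_le ρ.2
    positivity
  · have h1 : UnifSmoothOn (fun (τ : {τ : ℝ // 1 ≤ τ}) (v : E n × E n) =>
        cutHamiltonian k μ G c M τ v) fun _ => univ := by
      refine UnifSmoothOn.sum _ (fun _ => isOpen_univ) fun i _ =>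
        UnifSmoothOn.sum _ (fun _ => isOpen_univ) fun j _ => ?_
      have ha := (unifSmoothOn_rescaled hc ((hG.smooth i j).sub contDiff_const)
        (hG.iteratedFDeriv_le i j) hμ).comp (TameOn.of_clm
          (A := fun _ => ContinuousLinearMap.fst ℝ (E n) (E n)) fun _ => le_rfl)
          fun _ => mapsTo_univ _ _
      have hb := (unifSmoothOn_of_hasCompactSupport (ι := {τ : ℝ // 1 ≤ τ}) (hmom i j)
        ((hasCompactSupport_nearCutoff hM).mul_right)).comp (TameOn.of_clm
          (A := fun _ => ContinuousLinearMap.snd ℝ (E n) (E n)) fun _ => le_rfl)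
          fun _ => mapsTo_univ _ _
      exact ha.bilinear (ContinuousLinearMap.mul ℝ ℝ) hb
    exact h1.reindex fun p : {ρ : ℝ // 1 ≤ ρ} × ℝ =>
      ⟨p.1 * timeWeight p.2, one_le_mul_of_one_le_of_one_le p.1.2 (one_le_timeWeight _)⟩

/-- The cut-off Hamiltonian as a `Perturbation`. -/
def cutPerturbation (hG : IsLongRange k μ G) (hμ : 0 < μ) {c M : ℝ} (hc : 0 < c) (hM : 0 < M) :
    Perturbation n μ :=
  ⟨hμ, cutHamiltonian k μ G c M, unifSmoothPaths_cutHamiltonian hG hμ hc hM⟩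

end Hamiltonian

/-! ### From the integral equations back to the fixed point equation. -/

section EvolutionConverse

variable {n : ℕ} (k : ℕ) {μ : ℝ} (hμ : 0 < μ)

/-- Every ingredient depends on `t` only through `|t|`; the half-line problem is posed on the whole
line by even extension, so values at `t ≥ 0` determine a path. -/
theorem evolution_abs {c : ℝ} {z : E n × E n} {x f : ℝ →ᵇ E n × E n}
    (hx : x = freePath k n z + c • evolOp k hμ one_pos le_rfl n f) (t : ℝ) : x |t| = x t := by
  rw [hx]
  refine Prod.ext ?_ ?_
  · simp [evolOp_fst, freePath_apply, headFun, timeWeight_abs]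
  · simp [evolOp_snd, freePath_apply, tailFun]

theorem eq_of_evolution_equations {c : ℝ} {z : E n × E n} {x f : ℝ →ᵇ E n × E n}
    (hx : ∀ t, x |t| = x t)
    (h1 : ∀ t, 0 ≤ t → timeWeight t • (x t).1 = z.1 +
      ∫ s in (0 : ℝ)..t, ((2 : ℝ) • flatOp n k (x s).2 + (c * timeWeight s ^ (-μ)) • (f s).1))
    (h2 : ∀ t, 0 ≤ t → (x t).2 = z.2 + c • ∫ s in Ioi t, timeWeight s ^ (-1 - μ) • (f s).2) :
    x = freePath k n z + c • evolOp k hμ one_pos le_rfl n f := by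
  set y := freePath k n z + c • evolOp k hμ one_pos le_rfl n f with hy
  obtain ⟨e1, e2⟩ := evolution_equations k hμ hy
  have h3 : ∀ t, 0 ≤ t → (x t).2 = (y t).2 := fun t ht => (h2 t ht).trans (e2 t ht).symm
  have h4 : ∀ t, 0 ≤ t → x t = y t := by
    intro t ht
    refine Prod.ext ?_ (h3 t ht)
    have h5 : timeWeight t • (x t).1 = timeWeight t • (y t).1 := by
      rw [h1 t ht, e1 t ht]
      congr 1
      refine intervalIntegral.integral_congr fun s hs => ?_
      rw [uIcc_of_le ht] at hs
      simp only [h3 s hs.1]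
    exact smul_right_injective _ (timeWeight_pos t).ne' h5
  ext1 t
  rw [← hx t, ← evolution_abs k hμ hy t]
  exact h4 _ (abs_nonneg t)

end EvolutionConverse

/-! ### The unrescaled Hamiltonian and its gradients. -/

section FullHamiltonian

variable {n : ℕ} (G : E n → Matrix (Fin n) (Fin n) ℝ)

/-- The Hamiltonian `g_x(η, η)`. -/
def fullHamiltonian (v : E n × E n) : ℝ := bilin (G v.1) v.2 v.2

/-- The velocity field `∂_η g_x(η, η)`. -/
def velocity (v : E n × E n) : E n := (gradPair n (fderiv ℝ (fullHamiltonian G) v)).1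

/-- The gradient `∂_x g_x(η, η)`. -/
def posGrad (v : E n × E n) : E n := (gradPair n (fderiv ℝ (fullHamiltonian G) v)).2

variable {G}

theorem fderiv_fullHamiltonian_apply (v h : E n × E n) :
    fderiv ℝ (fullHamiltonian G) v h = inner ℝ (posGrad G v) h.1 + inner ℝ (velocity G v) h.2 := by
  rw [posGrad, velocity, inner_gradPair_snd, inner_gradPair_fst, ← map_add]
  simp

theorem IsLongRange.contDiff_fullHamiltonian {k : ℕ} {μ : ℝ} (hG : IsLongRange k μ G) :
    ContDiff ℝ ∞ (fullHamiltonian G) := by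
  have hcoord : ∀ i : Fin n, ContDiff ℝ ∞ fun v : E n × E n => v.2 i := fun i =>
    (EuclideanSpace.proj (𝕜 := ℝ) i).contDiff.comp contDiff_snd
  unfold fullHamiltonian bilin
  exact ContDiff.sum fun i _ => ContDiff.sum fun j _ =>
    (((hG.smooth i j).comp contDiff_fst).mul (hcoord i)).mul (hcoord j)

/-- Strict inequalities keep both cutoffs equal to `1` in a neighbourhood, so only the dilated
Hamiltonian minus the free one is differentiated. -/
theorem IsLongRange.fderiv_cutHamiltonian {k : ℕ} {μ : ℝ} (hG : IsLongRange k μ G) {c M τ : ℝ}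
    (hc : 0 < c) (hM : 0 < M) {v : E n × E n} (h1 : c < ‖v.1‖) (h2 : ‖v.2‖ < M) (h : E n × E n) :
    fderiv ℝ (cutHamiltonian k μ G c M τ) v h = τ ^ μ *
      (fderiv ℝ (fullHamiltonian G) (τ • v.1, v.2) (τ • h.1, h.2) - 2 * g₀ k v.2 h.2) := by
  have he : cutHamiltonian k μ G c M τ =ᶠ[𝓝 v] fun v =>
      τ ^ μ * (fullHamiltonian G (dilate n τ v) - inner ℝ (flatOp n k v.2) v.2) := by
    have o1 : ∀ᶠ w : E n × E n in 𝓝 v, c < ‖w.1‖ :=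
      continuous_fst.norm.continuousAt.eventually_const_lt h1
    have o2 : ∀ᶠ w : E n × E n in 𝓝 v, ‖w.2‖ < M :=
      continuous_snd.norm.continuousAt.eventually_lt_const h2
    filter_upwards [o1, o2] with w hw1 hw2
    rw [cutHamiltonian_eq k μ G hc hM hw1.le hw2.le, inner_flatOp]
    rfl
  have hd : HasFDerivAt (fun v => fullHamiltonian G (dilate n τ v))
      ((fderiv ℝ (fullHamiltonian G) (dilate n τ v)).comp (dilate n τ)) v :=
    ((hG.contDiff_fullHamiltonian.differentiable (by simp) _).hasFDerivAt).comp v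
      (dilate n τ).hasFDerivAt
  have hq := (((flatOp n k).comp (ContinuousLinearMap.snd ℝ (E n) (E n))).hasFDerivAt
    (x := v)).inner ℝ ((ContinuousLinearMap.snd ℝ (E n) (E n)).hasFDerivAt (x := v))
  rw [he.fderiv_eq]
  have ht := ((hd.sub hq).const_mul (τ ^ μ)).fderiv
  refine (congrArg (fun T : E n × E n →L[ℝ] ℝ => T h) ht).trans ?_
  simp only [_root_.smul_apply, _root_.sub_apply, ContinuousLinearMap.comp_apply, dilate_apply,
    smul_eq_mul, fderivInnerCLM_apply, ContinuousLinearMap.prod_apply,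
    ContinuousLinearMap.coe_snd', inner_flatOp, g₀_comm k h.2]
  ring

end FullHamiltonian

/-! ### Outgoing trajectories, energy conservation and change of scale. -/

/-- A choice of cutoffs and of a scale, for momenta with `|ξ|²` in a neighbourhood of `(a, b)`. -/
structure Setting {n : ℕ} (k : ℕ) (μ : ℝ) (G : E n → Matrix (Fin n) (Fin n) ℝ) (a b : ℝ) where
  longRange : IsLongRange k μ G
  mu_pos : 0 < μ
  c : ℝ
  M : ℝ
  r : ℝ
  ε : ℝ
  c_pos : 0 < c
  c_sq : 4 * c ^ 2 ≤ 1 / 8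
  c_sq' : 4 * c ^ 2 ≤ a
  M_pos : 0 < M
  M_sq : ∀ s, 0 ≤ s → s ^ 2 < 2 * b → s + 1 ≤ M
  ε_le : ε ≤ c / 2
  ε_le' : ε ≤ 1 / 2
  isScale : (cutPerturbation longRange mu_pos c_pos M_pos).IsScale k r ε

/-- The enlarged outgoing region. -/
def goodRegion (n k : ℕ) (a b : ℝ) : Set (E n × E n) :=
  {z | 1 / 2 < ‖z.1‖ ∧ a / 2 < ‖z.2‖ ^ 2 ∧ ‖z.2‖ ^ 2 < 2 * b ∧
    -(1 / 2) * (‖z.1‖ * ‖z.2‖) < g₀ k z.1 z.2}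

theorem continuous_g₀ (n k : ℕ) : Continuous fun z : E n × E n => g₀ k z.1 z.2 := by
  simp only [← inner_flatOp]
  exact ((flatOp n k).continuous.comp continuous_fst).inner continuous_snd

theorem isOpen_goodRegion (n k : ℕ) (a b : ℝ) : IsOpen (goodRegion n k a b) := by
  have h1 : Continuous fun z : E n × E n => ‖z.1‖ := continuous_fst.norm
  have h2 : Continuous fun z : E n × E n => ‖z.2‖ := continuous_snd.norm
  exact (isOpen_lt continuous_const h1).inter
    ((isOpen_lt continuous_const (h2.pow 2)).inter
      ((isOpen_lt (h2.pow 2) continuous_const).inter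
        (isOpen_lt (continuous_const.mul (h1.mul h2)) (continuous_g₀ n k))))

theorem exists_setting {n k : ℕ} {μ : ℝ} {G : E n → Matrix (Fin n) (Fin n) ℝ}
    (hG : IsLongRange k μ G) (hμ : 0 < μ) {a : ℝ} (ha : 0 < a) (b : ℝ) :
    Nonempty (Setting k μ G a b) := by
  -- With `c = √m / 2` one has `4c² = m`, so both constraints on `c` hold; `M = √(2b) + 1` leaves a
  -- unit of room above the momenta in the enlarged region.
  set m := min (1 / 8) a with hm
  have hm0 : 0 < m := lt_min (by norm_num) ha
  have hc : 0 < Real.sqrt m / 2 := by positivity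
  have hM : 0 < Real.sqrt (2 * b) + 1 := by positivity
  have hsq : 4 * (Real.sqrt m / 2) ^ 2 = m := by
    rw [div_pow, Real.sq_sqrt hm0.le]; ring
  obtain ⟨r, hr⟩ := (cutPerturbation hG hμ hc hM).exists_isScale k
    (ε := min (Real.sqrt m / 2 / 2) (1 / 2)) (lt_min (by positivity) (by norm_num))
  exact ⟨{ longRange := hG, mu_pos := hμ, c := _, M := _, r := r, ε := _, c_pos := hc
           c_sq := by rw [hsq]; exact min_le_left _ _
           c_sq' := by rw [hsq]; exact min_le_right _ _
           M_pos := hM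
           M_sq := fun s hs h => by
             have := Real.le_sqrt_of_sq_le h.le
             linarith
           ε_le := min_le_left _ _
           ε_le' := min_le_right _ _
           isScale := hr }⟩

namespace Setting

variable {n k : ℕ} {μ : ℝ} {G : E n → Matrix (Fin n) (Fin n) ℝ} {a b : ℝ} (S : Setting k μ G a b)

/-- The perturbation of a setting. -/
def pert : Perturbation n μ := cutPerturbation S.longRange S.mu_pos S.c_pos S.M_pos

theorem scale : S.pert.IsScale k S.r S.ε := S.isScale

/-- The admissible scales of a setting. -/
abbrev Scale : Type := {ρ : ℝ // S.r ≤ ρ}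

theorem one_le_scale (ρ : S.Scale) : 1 ≤ (ρ : ℝ) := S.scale.one_le.trans ρ.2

/-- The cosine bound `-1/2` lets at most half of `|y|² + 4t²|ξ|²` be lost in `|y + 2tIξ|²`. What
remains is at least `1/8 + at²`, hence at least `4c²(1 + t²)`. -/
theorem norm_freePath_ge {z : E n × E n} (hz : z ∈ goodRegion n k a b) {t : ℝ} (ht : 0 ≤ t) :
    2 * S.c ≤ ‖(freePath k n z t).1‖ := by
  obtain ⟨h1, h2, h3, h4⟩ := hz
  have hc := S.c_pos
  have htw := timeWeight_pos t
  rw [freePath_apply, norm_smul, norm_inv, Real.norm_of_nonneg htw.le, le_inv_mul_iff₀ htw,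
    abs_of_nonneg ht]
  refine abs_le_of_sq_le_sq' ?_ (norm_nonneg _) |>.2
  have h5 : ‖z.1 + (2 * t) • flatOp n k z.2‖ ^ 2 =
      ‖z.1‖ ^ 2 + 4 * t * g₀ k z.1 z.2 + 4 * t ^ 2 * ‖z.2‖ ^ 2 := by
    rw [norm_add_sq_real, norm_smul, norm_flatOp, real_inner_smul_right, real_inner_comm,
      inner_flatOp, g₀_comm, Real.norm_of_nonneg (by positivity)]
    ring
  rw [h5, mul_pow, timeWeight_sq]
  have h6 : -(2 * t * (‖z.1‖ * ‖z.2‖)) ≤ 4 * t * g₀ k z.1 z.2 := by nlinarith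
  have h7 : 2 * t * (‖z.1‖ * ‖z.2‖) ≤ (‖z.1‖ ^ 2 + 4 * t ^ 2 * ‖z.2‖ ^ 2) / 2 := by
    nlinarith [sq_nonneg (‖z.1‖ - 2 * t * ‖z.2‖)]
  have h8 : 1 / 4 ≤ ‖z.1‖ ^ 2 := by nlinarith
  have h9 : t ^ 2 * (2 * S.c) ^ 2 ≤ t ^ 2 * (2 * ‖z.2‖ ^ 2) := by
    refine mul_le_mul_of_nonneg_left ?_ (sq_nonneg t)
    nlinarith [S.c_sq']
  nlinarith [S.c_sq]

/-- The true path stays within `ε` of the free one, and `ε` is below the free path's distance to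
both cutoffs. -/
theorem margin (ρ : S.Scale) {z : E n × E n} (hz : z ∈ goodRegion n k a b) {t : ℝ}
    (ht : 0 ≤ t) : S.c < ‖(S.scale.path ρ z t).1‖ ∧ ‖(S.scale.path ρ z t).2‖ < S.M := by
  have h1 := S.scale.norm_path_sub_le ρ z t
  have h2 := (norm_fst_le _).trans h1
  have h3 := (norm_snd_le _).trans h1
  rw [Prod.fst_sub] at h2
  rw [Prod.snd_sub] at h3
  have h4 := S.norm_freePath_ge hz ht
  have h5 := norm_sub_norm_le (freePath k n z t).1 (S.scale.path ρ z t).1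
  rw [norm_sub_rev] at h5
  have h6 := norm_sub_norm_le (S.scale.path ρ z t).2 (freePath k n z t).2
  have h7 : (freePath k n z t).2 = z.2 := rfl
  have h8 := S.M_sq ‖z.2‖ (norm_nonneg _) hz.2.2.1
  rw [h7] at h3 h6
  exact ⟨by linarith [S.ε_le, S.c_pos], by linarith [S.ε_le']⟩

theorem force_fst {ρ : ℝ} (hρ : 0 < ρ) (t : ℝ) {v : E n × E n} (h1 : S.c < ‖v.1‖)
    (h2 : ‖v.2‖ < S.M) :
    (2 : ℝ) • flatOp n k v.2 + (ρ ^ (-μ) * timeWeight t ^ (-μ)) • (S.pert.force ρ t v).1 =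
      velocity G (ρ • timeWeight t • v.1, v.2) := by
  have htw := timeWeight_pos t
  refine ext_inner_right ℝ fun θ => ?_
  rw [inner_add_left, real_inner_smul_left, real_inner_smul_left, inner_flatOp]
  rw [Perturbation.force, inner_gradPair_fst, velocity, inner_gradPair_fst]
  rw [show S.pert.toFun = cutHamiltonian k μ G S.c S.M from rfl,
    S.longRange.fderiv_cutHamiltonian S.c_pos S.M_pos h1 h2, smul_zero, ← Real.mul_rpow hρ.le htw.le,
    ← mul_assoc, ← Real.rpow_add (by positivity), neg_add_cancel, Real.rpow_zero, mul_smul]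
  ring

/-- Differentiating the dilated Hamiltonian in position produces a factor `ρ⟨t⟩`, which turns the
weight `⟨t⟩^{-1-μ}` into that of Hamilton's equation in time rescaled by `ρ`. -/
theorem force_snd {ρ : ℝ} (hρ : 0 < ρ) (t : ℝ) {v : E n × E n} (h1 : S.c < ‖v.1‖)
    (h2 : ‖v.2‖ < S.M) :
    (ρ ^ (-μ) * timeWeight t ^ (-1 - μ)) • (S.pert.force ρ t v).2 =
      ρ • posGrad G (ρ • timeWeight t • v.1, v.2) := by
  have htw := timeWeight_pos t
  refine ext_inner_right ℝ fun θ => ?_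
  rw [real_inner_smul_left, real_inner_smul_left]
  rw [Perturbation.force, inner_gradPair_snd, posGrad, inner_gradPair_snd]
  rw [show S.pert.toFun = cutHamiltonian k μ G S.c S.M from rfl,
    S.longRange.fderiv_cutHamiltonian S.c_pos S.M_pos h1 h2, mul_smul]
  have h3 : ((ρ * timeWeight t) • θ, (0 : E n)) = (ρ * timeWeight t) • (θ, (0 : E n)) := by simp
  have h4 : g₀ k v.2 (0 : E n) = 0 := by rw [← inner_flatOp, inner_zero_right]
  simp only [h3, h4, map_smul, smul_eq_mul, mul_zero, sub_zero]
  have h5 : ρ ^ (-μ) * timeWeight t ^ (-1 - μ) * ((ρ * timeWeight t) ^ μ * (ρ * timeWeight t)) =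
      ρ := by
    rw [sub_eq_add_neg, Real.rpow_add htw, Real.rpow_neg_one, Real.mul_rpow hρ.le htw.le,
      Real.rpow_neg hρ.le, Real.rpow_neg htw.le]
    have := Real.rpow_pos_of_pos hρ μ
    have := Real.rpow_pos_of_pos htw μ
    field_simp
  linear_combination (fderiv ℝ (fullHamiltonian G) (ρ • timeWeight t • v.1, v.2) (θ, 0)) * h5

/-- A path staying in the region where the cutoffs are inactive is a solution of the fixed point
equation if and only if it satisfies Hamilton's equations in integral form. -/
theorem fixedPoint_iff (ρ : S.Scale) {z : E n × E n} {u : ℝ →ᵇ E n × E n}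
    (hu : ∀ t, u |t| = u t) (hm : ∀ t, 0 ≤ t → S.c < ‖(u t).1‖ ∧ ‖(u t).2‖ < S.M) :
    u = freePath k n z + S.pert.nonlin k ρ u ↔
      (∀ t, 0 ≤ t → timeWeight t • (u t).1 = z.1 + ∫ s in (0 : ℝ)..t,
        velocity G ((ρ : ℝ) • timeWeight s • (u s).1, (u s).2)) ∧
      (∀ t, 0 ≤ t → (u t).2 = z.2 + ∫ s in Ioi t,
        (ρ : ℝ) • posGrad G ((ρ : ℝ) • timeWeight s • (u s).1, (u s).2)) := by
  have hρ1 := S.one_le_scale ρ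
  have hρ : 0 < (ρ : ℝ) := one_pos.trans_le hρ1
  have e1 : ∀ t, 0 ≤ t → ∫ s in (0 : ℝ)..t, ((2 : ℝ) • flatOp n k (u s).2 +
      ((ρ : ℝ) ^ (-μ) * timeWeight s ^ (-μ)) • (nemytskii (S.pert.force ρ) u s).1) =
      ∫ s in (0 : ℝ)..t, velocity G ((ρ : ℝ) • timeWeight s • (u s).1, (u s).2) := by
    intro t ht
    refine intervalIntegral.integral_congr fun s hs => ?_
    rw [uIcc_of_le ht] at hs
    simp only [S.pert.nemytskii_force_apply hρ1]
    exact S.force_fst hρ s (hm s hs.1).1 (hm s hs.1).2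
  have e2 : ∀ t, 0 ≤ t → (ρ : ℝ) ^ (-μ) • ∫ s in Ioi t, timeWeight s ^ (-1 - μ) •
      (nemytskii (S.pert.force ρ) u s).2 =
      ∫ s in Ioi t, (ρ : ℝ) • posGrad G ((ρ : ℝ) • timeWeight s • (u s).1, (u s).2) := by
    intro t ht
    rw [← integral_smul]
    refine setIntegral_congr_fun measurableSet_Ioi fun s hs => ?_
    have hs' : 0 ≤ s := ht.trans (le_of_lt hs)
    simp only [S.pert.nemytskii_force_apply hρ1, smul_smul (_ ^ (-μ))]
    exact S.force_snd hρ s (hm s hs').1 (hm s hs').2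
  constructor
  · intro h
    obtain ⟨a1, a2⟩ := evolution_equations k S.pert.pos h
    exact ⟨fun t ht => by rw [← e1 t ht]; exact a1 t ht, fun t ht => by rw [← e2 t ht]; exact a2 t ht⟩
  · rintro ⟨a1, a2⟩
    exact eq_of_evolution_equations k S.pert.pos hu
      (fun t ht => by rw [e1 t ht]; exact a1 t ht) (fun t ht => by rw [e2 t ht]; exact a2 t ht)

/-- Conservation of energy gives the eikonal equation for the initial momentum. -/
theorem energy_eq (ρ : S.Scale) {z : E n × E n} (hz : z ∈ goodRegion n k a b) :
    fullHamiltonian G ((ρ : ℝ) • z.1, z.2 + S.scale.shift ρ z) = g₀ k z.2 z.2 := by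
  have hρ1 := S.one_le_scale ρ
  have hρ : 0 < (ρ : ℝ) := one_pos.trans_le hρ1
  set u := S.scale.path ρ z with hu
  have hueq : u = freePath k n z + S.pert.nonlin k ρ u := S.scale.path_eq ρ z
  set e : ℝ → ℝ := fun t => fullHamiltonian G ((ρ : ℝ) • timeWeight t • (u t).1, (u t).2) with he
  have hderiv : ∀ t, 0 ≤ t → HasDerivWithinAt e 0 (Ici 0) t := by
    intro t ht
    obtain ⟨a1, a2⟩ := evolution_hasDerivWithinAt k S.pert.pos hueq ht
    obtain ⟨m1, m2⟩ := S.margin ρ hz ht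
    rw [S.pert.nemytskii_force_apply hρ1] at a1 a2
    rw [S.force_fst hρ t m1 m2] at a1
    rw [neg_smul, S.force_snd hρ t m1 m2] at a2
    have hH := (S.longRange.contDiff_fullHamiltonian.differentiable (by simp)
      ((ρ : ℝ) • timeWeight t • (u t).1, (u t).2)).hasFDerivAt
    have h := hH.comp_hasDerivWithinAt t ((a1.const_smul (ρ : ℝ)).prodMk a2)
    refine h.congr_deriv ?_
    rw [fderiv_fullHamiltonian_apply]
    simp only [inner_smul_right, inner_neg_right]
    rw [real_inner_comm]
    ring
  have hconst : ∀ T, 0 ≤ T → e T = e 0 := fun T hT =>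
    constant_of_has_deriv_right_zero (a := 0) (b := T)
      (fun t ht => ((hderiv t ht.1).continuousWithinAt.mono Icc_subset_Ici_self))
      (fun t ht => (hderiv t ht.1).mono (Ici_subset_Ici.2 ht.1)) T ⟨hT, le_rfl⟩
  -- The perturbation along the path is `(ρ⟨t⟩)^{-μ}` times a bounded quantity, so in the limit only
  -- the free energy of the asymptotic momentum survives.
  have hlim : Tendsto e atTop (𝓝 (g₀ k z.2 z.2)) := by
    have h1 : Tendsto (fun t => g₀ k (u t).2 (u t).2) atTop (𝓝 (g₀ k z.2 z.2)) :=
      (((continuous_g₀ n k).comp (continuous_id.prodMk continuous_id)).tendsto z.2).comp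
        (tendsto_snd_of_evolution k S.pert.pos hueq)
    obtain ⟨C, hC⟩ := S.pert.unif.unif.bound 0
    have h2 : Tendsto (fun t => ((ρ : ℝ) * timeWeight t) ^ (-μ) *
        S.pert.toFun (ρ * timeWeight t) (u t)) atTop (𝓝 0) := by
      have h3 : Tendsto (fun t => (ρ : ℝ) * timeWeight t) atTop atTop :=
        (tendsto_atTop_mono (fun t => (le_abs_self t).trans (abs_le_timeWeight t))
          tendsto_id).const_mul_atTop hρ
      have h4 := (tendsto_rpow_neg_atTop S.mu_pos).comp h3
      refine h4.zero_mul_isBoundedUnder_le ?_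
      refine isBoundedUnder_of ⟨C, fun t => ?_⟩
      have := hC (⟨ρ, hρ1⟩, t) (u t) (mem_univ _)
      rwa [norm_iteratedFDeriv_zero] at this
    have h5 := h1.add h2
    rw [add_zero] at h5
    refine h5.congr' ((eventually_ge_atTop 0).mono fun t ht => ?_)
    obtain ⟨m1, m2⟩ := S.margin ρ hz ht
    have htw := timeWeight_pos t
    rw [show S.pert.toFun = cutHamiltonian k μ G S.c S.M from rfl,
      cutHamiltonian_eq k μ G S.c_pos S.M_pos m1.le m2.le, ← mul_assoc,
      ← Real.rpow_add (by positivity), neg_add_cancel, Real.rpow_zero, one_mul]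
    simp only [he, fullHamiltonian, mul_smul]
    ring
  have h0 : e 0 = g₀ k z.2 z.2 := by
    refine tendsto_nhds_unique (tendsto_const_nhds.congr' ?_) hlim
    exact (eventually_ge_atTop 0).mono fun t ht => (hconst t ht).symm
  rw [← h0, he]
  have htw0 : timeWeight 0 = 1 := by simp [timeWeight]
  simp only [htw0, one_smul, hu, S.scale.path_zero_fst, Perturbation.IsScale.shift,
    add_sub_cancel]

/-- The momentum shifts at different scales agree. -/
theorem shift_dilate (ρ ρ' : S.Scale) {l : ℝ} (hl : 1 ≤ l) (hρ' : (ρ' : ℝ) = ρ * l)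
    {z : E n × E n} (hz : z ∈ goodRegion n k a b) :
    S.scale.shift ρ (dilate n l z) = S.scale.shift ρ' z := by
  have hl0 : 0 < l := one_pos.trans_le hl
  set u := S.scale.path ρ' z with hu
  have hueq : u = freePath k n z + S.pert.nonlin k ρ' u := S.scale.path_eq ρ' z
  have huabs : ∀ t, u |t| = u t := evolution_abs k S.pert.pos hueq
  obtain ⟨a1, a2⟩ := (S.fixedPoint_iff ρ' huabs fun t ht => S.margin ρ' hz ht).1 hueq
  -- The candidate at scale `ρ` is the path run at speed `1/l` with positions multiplied by `l`; `q`
  -- converts between the weights `⟨t/l⟩` and `⟨t⟩`. Since `q ≥ 1`, the new path still avoids the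
  -- position cutoff.
  set q : ℝ → ℝ := fun t => (timeWeight t)⁻¹ * (l * timeWeight (l⁻¹ * t)) with hq
  have hq1 : ∀ t, 1 ≤ q t := by
    intro t
    have htw := timeWeight_pos t
    rw [hq]
    simp only
    rw [le_inv_mul_iff₀ htw, mul_one]
    refine abs_le_of_sq_le_sq' ?_ (by have := timeWeight_pos (l⁻¹ * t); positivity) |>.2
    rw [mul_pow, timeWeight_sq, timeWeight_sq, mul_pow, mul_add, ← mul_assoc, ← mul_pow,
      mul_inv_cancel₀ hl0.ne']
    nlinarith
  have hql : ∀ t, q t ≤ l := by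
    intro t
    have htw := timeWeight_pos t
    rw [hq]
    simp only
    rw [inv_mul_le_iff₀ htw, mul_comm]
    refine mul_le_mul_of_nonneg_right (timeWeight_mono ?_) hl0.le
    rw [abs_mul, abs_of_pos (inv_pos.2 hl0)]
    exact mul_le_of_le_one_left (abs_nonneg t) (inv_le_one_of_one_le₀ hl)
  have hqc : Continuous q := (continuous_timeWeight.inv₀ fun t => (timeWeight_pos t).ne').mul
    (continuous_const.mul (continuous_timeWeight.comp (continuous_const.mul continuous_id)))
  have huc : Continuous fun t : ℝ => u (l⁻¹ * t) :=
    u.continuous.comp (continuous_const.mul continuous_id)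
  set w : ℝ →ᵇ E n × E n := BoundedContinuousFunction.ofNormedAddCommGroup
    (fun t => (q t • (u (l⁻¹ * t)).1, (u (l⁻¹ * t)).2))
    ((hqc.smul (continuous_fst.comp huc)).prodMk (continuous_snd.comp huc)) (l * ‖u‖) (fun t => by
      have h1 : ‖u (l⁻¹ * t)‖ ≤ ‖u‖ := u.norm_coe_le_norm _
      refine max_le ?_ ?_
      · rw [norm_smul, Real.norm_of_nonneg (zero_le_one.trans (hq1 t))]
        exact mul_le_mul (hql t) ((norm_fst_le _).trans h1) (norm_nonneg _) hl0.le
      · refine ((norm_snd_le _).trans h1).trans (le_mul_of_one_le_left (norm_nonneg _) hl)) with hw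
  have hwt : ∀ t, w t = (q t • (u (l⁻¹ * t)).1, (u (l⁻¹ * t)).2) := fun t => rfl
  have hwX : ∀ t, timeWeight t • (w t).1 = l • timeWeight (l⁻¹ * t) • (u (l⁻¹ * t)).1 := by
    intro t
    rw [hwt, hq, smul_smul, smul_smul, mul_inv_cancel_left₀ (timeWeight_pos t).ne']
  have hwabs : ∀ t, w |t| = w t := by
    intro t
    have h1 : l⁻¹ * |t| = |l⁻¹ * t| := by rw [abs_mul, abs_of_pos (inv_pos.2 hl0)]
    rw [hwt, hwt, hq]
    simp only [h1, huabs, timeWeight_abs]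
  have hwm : ∀ t, 0 ≤ t → S.c < ‖(w t).1‖ ∧ ‖(w t).2‖ < S.M := by
    intro t ht
    obtain ⟨m1, m2⟩ := S.margin ρ' hz (t := l⁻¹ * t) (by positivity)
    refine ⟨?_, m2⟩
    rw [hwt, norm_smul, Real.norm_of_nonneg (zero_le_one.trans (hq1 t))]
    exact m1.trans_le (le_mul_of_one_le_left (norm_nonneg _) (hq1 t))
  have harg : ∀ s, ((ρ : ℝ) • timeWeight s • (w s).1, (w s).2) =
      ((ρ' : ℝ) • timeWeight (l⁻¹ * s) • (u (l⁻¹ * s)).1, (u (l⁻¹ * s)).2) := by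
    intro s
    rw [hwX, hρ', mul_smul]
    rfl
  -- Both paths trace the same unrescaled trajectory, so a change of time variable carries one set
  -- of integral equations to the other; uniqueness then identifies the shifts.
  have hweq : w = freePath k n (dilate n l z) + S.pert.nonlin k ρ w := by
    refine (S.fixedPoint_iff ρ hwabs hwm).2 ⟨fun t ht => ?_, fun t ht => ?_⟩
    · rw [hwX, a1 _ (by positivity), smul_add, dilate_apply]
      congr 1
      simp only [harg]
      rw [intervalIntegral.integral_comp_mul_left (fun s => velocity G
        ((ρ' : ℝ) • timeWeight s • (u s).1, (u s).2)) (inv_pos.2 hl0).ne', inv_inv, mul_zero]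
    · rw [hwt, a2 _ (by positivity), dilate_apply]
      congr 1
      simp only [harg]
      rw [integral_comp_mul_left_Ioi (fun s => (ρ : ℝ) • posGrad G
        ((ρ' : ℝ) • timeWeight s • (u s).1, (u s).2)) t (inv_pos.2 hl0), inv_inv, ← integral_smul]
      simp only [hρ', smul_smul, mul_comm l]
  rw [Perturbation.IsScale.shift, Perturbation.IsScale.shift, S.scale.path_unique hweq, hwt]
  simp [hu]

end Setting

/-! ### The momentum shift at one scale and its dilates. -/

/-- The bounded part `|y| < 2` of the enlarged outgoing region. -/
def goodShell (n k : ℕ) (a b : ℝ) : Set (E n × E n) := goodRegion n k a b ∩ {z | ‖z.1‖ < 2}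

theorem isOpen_goodShell (n k : ℕ) (a b : ℝ) : IsOpen (goodShell n k a b) :=
  (isOpen_goodRegion n k a b).inter (isOpen_lt continuous_fst.norm continuous_const)

theorem norm_dilate_le {n : ℕ} {l C : ℝ} (hl : |l| ≤ C) (hC : 1 ≤ C) : ‖dilate n l‖ ≤ C := by
  refine ContinuousLinearMap.opNorm_le_bound _ (zero_le_one.trans hC) fun z => ?_
  refine max_le ?_ ?_
  · rw [dilate_apply, norm_smul, Real.norm_eq_abs]
    exact mul_le_mul hl (norm_fst_le z) (norm_nonneg _) (zero_le_one.trans hC)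
  · exact (norm_snd_le z).trans (le_mul_of_one_le_left (norm_nonneg _) hC)

namespace Setting

variable {n k : ℕ} {μ : ℝ} {G : E n → Matrix (Fin n) (Fin n) ℝ} {a b : ℝ} (S : Setting k μ G a b)

/-- The smallest admissible scale. -/
def base : S.Scale := ⟨S.r, le_rfl⟩

/-- The momentum shift at the smallest admissible scale. -/
def baseShift : E n × E n → E n := S.scale.shift S.base

theorem contDiff_baseShift : ContDiff ℝ ∞ S.baseShift := S.scale.contDiff_shift _

theorem r_pos : 0 < S.r := one_pos.trans_le S.scale.one_le

theorem unifSmoothOn_shift :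
    UnifSmoothOn (fun (ρ : S.Scale) z => (ρ : ℝ) ^ μ • S.scale.shift ρ z) fun _ => univ := by
  refine ⟨fun _ => isOpen_univ, fun ρ => ((S.scale.contDiff_shift ρ).const_smul _).contDiffOn,
    fun j => ?_⟩
  obtain ⟨C, hC0, hC⟩ := S.scale.exists_shift_bound j
  refine ⟨C, fun ρ z _ => ?_⟩
  have hρ : 0 < (ρ : ℝ) := one_pos.trans_le (S.one_le_scale ρ)
  rw [iteratedFDeriv_const_smul_apply' ((S.scale.contDiff_shift ρ).contDiffAt.of_le
    (by exact_mod_cast le_top)), norm_smul, Real.norm_of_nonneg (by positivity)]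
  calc _ ≤ (ρ : ℝ) ^ μ * (C * (ρ : ℝ) ^ (-μ)) := by gcongr; exact hC ρ z
    _ = C * ((ρ : ℝ) ^ μ * (ρ : ℝ) ^ (-μ)) := by ring
    _ = C := by rw [← Real.rpow_add hρ, add_neg_cancel, Real.rpow_zero, mul_one]

/-- The weighted dilates of the momentum shift are bounded with all their derivatives, uniformly
in the dilation. -/
theorem unifSmoothOn_baseShift_dilate :
    UnifSmoothOn (fun (t : {t : ℝ // 0 ≤ t}) z => max 1 (t : ℝ) ^ μ • S.baseShift (dilate n t z))
      fun _ => goodRegion n k a b := by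
  have hw : UnifSmoothOn (fun _ : {t : ℝ // 0 ≤ t ∧ t ≤ 1} => S.baseShift) fun _ => univ := by
    have h1 := (S.unifSmoothOn_shift.reindex fun _ : {t : ℝ // 0 ≤ t ∧ t ≤ 1} => S.base).clm_comp
      (S.r ^ (-μ) • ContinuousLinearMap.id ℝ (E n))
    refine h1.congr fun t z _ => ?_
    simp only [_root_.smul_apply, ContinuousLinearMap.id_apply, smul_smul]
    rw [show ((S.base : ℝ)) = S.r from rfl, ← Real.rpow_add S.r_pos, neg_add_cancel, Real.rpow_zero,
      one_smul]
    rfl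
  -- Dilations by `t ≤ 1` must be included because the ray integral starts at the origin. There the
  -- global bound on the cut-off shift suffices, while for `t ≥ 1` the decay comes from
  -- `shift_dilate`.
  have hsmall : UnifSmoothOn (fun (t : {t : ℝ // 0 ≤ t ∧ t ≤ 1}) z => S.baseShift (dilate n t z))
      fun _ => goodRegion n k a b :=
    (hw.comp (TameOn.of_clm (A := fun t : {t : ℝ // 0 ≤ t ∧ t ≤ 1} => dilate n t) fun t =>
      norm_dilate_le (by rw [abs_of_nonneg t.2.1]; exact t.2.2) le_rfl)
      fun _ => mapsTo_univ _ _).mono (fun _ => isOpen_goodRegion n k a b) fun _ => subset_univ _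
  have hlarge : UnifSmoothOn (fun (t : {t : ℝ // 1 ≤ t}) z =>
      (t : ℝ) ^ μ • S.baseShift (dilate n t z)) fun _ => goodRegion n k a b := by
    have h1 := ((S.unifSmoothOn_shift.reindex fun t : {t : ℝ // 1 ≤ t} =>
      (⟨S.r * t, le_mul_of_one_le_right S.r_pos.le t.2⟩ : S.Scale)).clm_comp
      (S.r ^ (-μ) • ContinuousLinearMap.id ℝ (E n))).mono
      (fun _ => isOpen_goodRegion n k a b) fun _ => subset_univ _
    refine h1.congr fun t z hz => ?_
    have ht : 0 < (t : ℝ) := one_pos.trans_le t.2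
    have h2 := S.shift_dilate S.base ⟨S.r * t, le_mul_of_one_le_right S.r_pos.le t.2⟩ t.2 rfl hz
    simp only [_root_.smul_apply, ContinuousLinearMap.id_apply, smul_smul, ← h2]
    rw [Real.mul_rpow S.r_pos.le ht.le, ← mul_assoc, ← Real.rpow_add S.r_pos, neg_add_cancel,
      Real.rpow_zero, one_mul]
    rfl
  refine ⟨fun _ => isOpen_goodRegion n k a b, fun t => ((S.contDiff_baseShift.comp
    (dilate n t).contDiff).const_smul _).contDiffOn, fun j => ?_⟩
  obtain ⟨C, hC⟩ := hsmall.bound j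
  obtain ⟨D, hD⟩ := hlarge.bound j
  refine ⟨max C D, fun t z hz => ?_⟩
  rcases le_total (t : ℝ) 1 with h | h
  · simp only [max_eq_left h, Real.one_rpow, one_smul]
    exact (hC ⟨t, t.2, h⟩ z hz).trans (le_max_left _ _)
  · simp only [max_eq_right h]
    exact (hD ⟨t, h⟩ z hz).trans (le_max_right _ _)

theorem fderiv_baseShift_symm (z : E n × E n) (v w : E n) :
    inner ℝ (fderiv ℝ S.baseShift z (v, 0)) w = inner ℝ (fderiv ℝ S.baseShift z (w, 0)) v :=
  S.scale.fderiv_shift_symm S.base z v w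

theorem fullHamiltonian_baseShift {z : E n × E n} (hz : z ∈ goodRegion n k a b) :
    fullHamiltonian G (S.r • z.1, z.2 + S.baseShift z) = g₀ k z.2 z.2 :=
  S.energy_eq S.base hz

attribute [irreducible] baseShift

/-! ### The potential of the momentum shift along rays. -/

/-- The integrand of the potential. -/
def integrand (s : ℝ) (z : E n × E n) : ℝ := inner ℝ (S.baseShift (dilate n s z)) z.1

/-- A primitive of the momentum shift with respect to position. -/
def potential (z : E n × E n) : ℝ := ∫ s in (0 : ℝ)..1, S.integrand s z

theorem contDiff_integrand : ContDiff ℝ ∞ fun p : ℝ × (E n × E n) => S.integrand p.1 p.2 := by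
  have hY : ContDiff ℝ ∞ fun p : ℝ × (E n × E n) => p.2.1 := contDiff_fst.comp contDiff_snd
  have hη : ContDiff ℝ ∞ fun p : ℝ × (E n × E n) => p.2.2 := contDiff_snd.comp contDiff_snd
  exact (S.contDiff_baseShift.comp ((contDiff_fst.smul hY).prodMk hη)).inner ℝ hY

theorem contDiff_potential : ContDiff ℝ ∞ S.potential :=
  contDiff_integral_zero_one S.contDiff_integrand

theorem hasFDerivAt_baseShift (z : E n × E n) :
    HasFDerivAt S.baseShift (fderiv ℝ S.baseShift z) z :=
  (S.contDiff_baseShift.differentiable (by simp) z).hasFDerivAt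

theorem fderiv_integrand (s : ℝ) (z : E n × E n) (v : E n) :
    fderiv ℝ (S.integrand s) z (v, 0) =
      s * inner ℝ (fderiv ℝ S.baseShift (dilate n s z) (z.1, 0)) v +
        inner ℝ (S.baseShift (dilate n s z)) v := by
  have h3 : HasFDerivAt (S.integrand s) _ z :=
    ((S.hasFDerivAt_baseShift (dilate n s z)).comp z (dilate n s).hasFDerivAt).inner ℝ
      (hasFDerivAt_fst (𝕜 := ℝ) (p := z))
  have h4 : dilate n s ((v, 0) : E n × E n) = s • ((v, 0) : E n × E n) := by simp
  have h5 := S.fderiv_baseShift_symm (dilate n s z) v z.1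
  rw [h3.fderiv, ContinuousLinearMap.comp_apply, ContinuousLinearMap.prod_apply,
    fderivInnerCLM_apply, ContinuousLinearMap.comp_apply, h4, map_smul, real_inner_smul_left, h5,
    add_comm]
  rfl

theorem hasDerivAt_mul_inner_baseShift (s : ℝ) (z : E n × E n) (v : E n) :
    HasDerivAt (fun s : ℝ => s * (inner ℝ (S.baseShift (dilate n s z)) v : ℝ))
      (s * inner ℝ (fderiv ℝ S.baseShift (dilate n s z) (z.1, 0)) v +
          inner ℝ (S.baseShift (dilate n s z)) v) s := by
  have h7 : HasDerivAt (fun s : ℝ => dilate n s z) (z.1, 0) s := by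
    have := ((hasDerivAt_id s).smul_const z.1).prodMk (hasDerivAt_const s z.2)
    rwa [one_smul] at this
  have h8 : HasDerivAt (fun s : ℝ => (inner ℝ (S.baseShift (dilate n s z)) v : ℝ)) _ s :=
    ((S.hasFDerivAt_baseShift _).comp_hasDerivAt s h7).inner ℝ (hasDerivAt_const s v)
  refine ((hasDerivAt_id s).mul h8).congr_deriv ?_
  rw [inner_zero_right, zero_add, one_mul, add_comm]
  rfl

/-- This is the Poincaré lemma. By the symmetry of the derivative, the derivative of the integrand
in direction `v` is `d/ds (s ⟨w(sz.1, z.2), v⟩)` with `w` the shift, and the fundamental theorem of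
calculus evaluates the integral. -/
theorem fderiv_potential (z : E n × E n) (v : E n) :
    fderiv ℝ S.potential z (v, 0) = inner ℝ (S.baseShift z) v := by
  have hI := S.contDiff_integrand
  have h1 : fderiv ℝ S.potential z = ∫ s in (0 : ℝ)..1,
      fderiv ℝ (S.integrand s) z :=
    (hasFDerivAt_integral_zero_one (f := S.integrand) hI z).fderiv
  have hpair : Continuous fun s : ℝ => (s, z) := continuous_id.prodMk continuous_const
  have hcont : Continuous fun s : ℝ => fderiv ℝ (S.integrand s) z := by
    have h2 := (contDiff_fderiv_right (f := S.integrand) hI).continuous.comp hpair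
    exact h2
  have hc2 : Continuous fun s : ℝ =>
      s * inner ℝ (fderiv ℝ S.baseShift (dilate n s z) (z.1, 0)) v +
          inner ℝ (S.baseShift (dilate n s z)) v := by
    have := hcont.clm_apply (continuous_const (y := ((v, 0) : E n × E n)))
    simpa only [S.fderiv_integrand] using this
  rw [h1, ContinuousLinearMap.intervalIntegral_apply (hcont.intervalIntegrable _ _)]
  simp only [S.fderiv_integrand]
  rw [intervalIntegral.integral_eq_sub_of_hasDerivAt
    (fun s _ => S.hasDerivAt_mul_inner_baseShift s z v) (hc2.intervalIntegrable _ _)]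
  simp

theorem unifSmoothOn_fst {ι : Type*} :
    UnifSmoothOn (fun (_ : ι) (z : E n × E n) => z.1) fun _ => goodShell n k a b := by
  have h1 := TameOn.of_clm (A := fun _ : ι => ContinuousLinearMap.fst ℝ (E n) (E n))
    fun _ => le_rfl
  refine ⟨fun _ => isOpen_goodShell n k a b, fun _ => contDiff_fst.contDiffOn, fun j => ?_⟩
  rcases Nat.eq_zero_or_pos j with rfl | hj
  · refine ⟨2, fun _ z hz => ?_⟩
    rw [norm_iteratedFDeriv_zero]
    exact hz.2.le
  · obtain ⟨C, hC⟩ := h1.bound j hj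
    exact ⟨C, fun t z _ => hC t z (mem_univ _)⟩

theorem contDiff_integrand_dilate (l : ℝ) :
    ContDiff ℝ ∞ fun p : ℝ × (E n × E n) => S.integrand p.1 (dilate n l p.2) := by
  have h1 : ContDiff ℝ ∞ fun p : ℝ × (E n × E n) => (p.1, dilate n l p.2) :=
    contDiff_fst.prodMk ((dilate n l).contDiff.comp contDiff_snd)
  exact S.contDiff_integrand.comp h1

theorem integrand_dilate_eq {l s : ℝ} (z : E n × E n) :
    S.integrand s (dilate n l z) = (l * max 1 (s * l) ^ (-μ)) •
      innerSL ℝ (max 1 (s * l) ^ μ • S.baseShift (dilate n (s * l) z)) z.1 := by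
  have hm : 0 < max 1 (s * l) := lt_max_of_lt_left one_pos
  have h3 : dilate n s (dilate n l z) = dilate n (s * l) z := by simp [mul_smul]
  have h4 : max 1 (s * l) ^ (-μ) * max 1 (s * l) ^ μ = 1 := by
    rw [← Real.rpow_add hm, neg_add_cancel, Real.rpow_zero]
  rw [integrand, h3, innerSL_apply_apply, real_inner_smul_left,
    show (dilate n l z).1 = l • z.1 from rfl, real_inner_smul_right, smul_eq_mul]
  linear_combination (-l * inner ℝ (S.baseShift (dilate n (s * l) z)) z.1) * h4

/-- The weight `max(1, sl)^{-μ}` is at most `(sl)^{-μ}`, so the bound splits into the expected power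
of `l` and a singularity in `s`. -/
theorem norm_iteratedFDeriv_integrand_dilate_le (j : ℕ) : ∃ C : ℝ, 0 ≤ C ∧
    ∀ l : ℝ, 0 < l → ∀ s : ℝ, 0 < s → ∀ z ∈ goodShell n k a b,
      ‖iteratedFDeriv ℝ j (fun z => S.integrand s (dilate n l z)) z‖ ≤ l ^ (1 - μ) * C * s ^ (-μ) := by
  obtain ⟨C, hC1, hC⟩ := ((S.unifSmoothOn_baseShift_dilate.mono
    (fun _ => isOpen_goodShell n k a b) fun _ => inter_subset_left).bilinear
      (innerSL ℝ) unifSmoothOn_fst).bound_uniform j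
  refine ⟨C, zero_le_one.trans hC1, fun l hl s hs z hz => ?_⟩
  have hC0 : 0 ≤ C := zero_le_one.trans hC1
  have hsl : 0 < s * l := mul_pos hs hl
  have hm : 0 < max 1 (s * l) := lt_max_of_lt_left one_pos
  have h1 := hC j le_rfl ⟨s * l, hsl.le⟩ z hz
  have hsm : ContDiff ℝ ∞ fun z : E n × E n =>
      innerSL ℝ (max 1 (s * l) ^ μ • S.baseShift (dilate n (s * l) z)) z.1 :=
    ((S.contDiff_baseShift.comp (dilate n _).contDiff).const_smul _).inner ℝ contDiff_fst
  rw [funext (S.integrand_dilate_eq (l := l) (s := s)), iteratedFDeriv_const_smul_apply'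
    (hsm.contDiffAt.of_le (by exact_mod_cast le_top)), norm_smul,
    Real.norm_of_nonneg (by positivity)]
  have h2 : max 1 (s * l) ^ (-μ) ≤ (s * l) ^ (-μ) :=
    Real.rpow_le_rpow_of_nonpos hsl (le_max_right _ _) (by linarith [S.mu_pos])
  have h3 : l ^ (1 : ℝ) * l ^ (-μ) = l ^ (1 - μ) := by rw [← Real.rpow_add hl, sub_eq_add_neg]
  calc _ ≤ l * (s * l) ^ (-μ) * C :=
        mul_le_mul (mul_le_mul_of_nonneg_left h2 hl.le) h1 (norm_nonneg _) (by positivity)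
    _ = (l ^ (1 : ℝ) * l ^ (-μ)) * C * s ^ (-μ) := by
      rw [Real.mul_rpow hs.le hl.le, Real.rpow_one]; ring
    _ = _ := by rw [h3]

/-- The singularity `s^{-μ}` is integrable on `(0, 1)` because `μ < 1`; its integral is the factor
`(1 - μ)⁻¹`. -/
theorem unifSmoothOn_potential_dilate (hμ1 : μ < 1) :
    UnifSmoothOn (fun (l : {l : ℝ // 1 ≤ l}) z => (l : ℝ) ^ (μ - 1) * S.potential (dilate n l z))
      fun _ => goodShell n k a b := by
  have hsm : ∀ l : ℝ, ContDiff ℝ ∞ fun z => S.potential (dilate n l z) := fun l =>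
    S.contDiff_potential.comp (dilate n l).contDiff
  refine ⟨fun _ => isOpen_goodShell n k a b, fun l => (contDiff_const.mul (hsm l)).contDiffOn,
    fun j => ?_⟩
  obtain ⟨C, hC0, hC⟩ := S.norm_iteratedFDeriv_integrand_dilate_le j
  refine ⟨C * (1 - μ)⁻¹, fun l z hz => ?_⟩
  have hl : 0 < (l : ℝ) := one_pos.trans_le l.2
  have hpot : ‖iteratedFDeriv ℝ j (fun z => S.potential (dilate n l z)) z‖ ≤
      (l : ℝ) ^ (1 - μ) * C * (1 - μ)⁻¹ := by
    refine ((contDiff_integral_zero_one_aux j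
      (f := fun s z => S.integrand s (dilate n l z)) (S.contDiff_integrand_dilate l)).2 z).trans ?_
    have h1 : ∫ s in (0 : ℝ)..1, (l : ℝ) ^ (1 - μ) * C * s ^ (-μ) =
        (l : ℝ) ^ (1 - μ) * C * (1 - μ)⁻¹ := by
      rw [intervalIntegral.integral_const_mul, integral_rpow (Or.inl (by linarith))]
      rw [Real.one_rpow, Real.zero_rpow (by linarith), sub_zero, one_div]
      congr 2; ring
    rw [← h1, intervalIntegral.integral_of_le zero_le_one,
      intervalIntegral.integral_of_le zero_le_one]
    refine integral_mono_of_nonneg (Eventually.of_forall fun s => norm_nonneg _) ?_ ?_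
    · exact ((intervalIntegral.intervalIntegrable_rpow' (by linarith)).const_mul _).1
    · exact (ae_restrict_iff' measurableSet_Ioc).2 (Eventually.of_forall fun s hs =>
        hC l hl s hs.1 z hz)
  rw [show (fun z => (l : ℝ) ^ (μ - 1) * S.potential (dilate n l z)) =
    fun z => (l : ℝ) ^ (μ - 1) • S.potential (dilate n l z) from rfl,
    iteratedFDeriv_const_smul_apply' ((hsm l).contDiffAt.of_le (by exact_mod_cast le_top)),
    norm_smul, Real.norm_of_nonneg (by positivity)]
  calc _ ≤ (l : ℝ) ^ (μ - 1) * ((l : ℝ) ^ (1 - μ) * C * (1 - μ)⁻¹) := by gcongr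
    _ = ((l : ℝ) ^ (μ - 1) * (l : ℝ) ^ (1 - μ)) * (C * (1 - μ)⁻¹) := by ring
    _ = _ := by rw [← Real.rpow_add hl]; simp

/-! ### The outgoing phase in the original variables. -/

/-- The difference between the outgoing phase function and `x · ξ`. -/
def correction (p : E n × E n) : ℝ := S.r * S.potential (dilate n S.r⁻¹ p)

theorem contDiff_correction : ContDiff ℝ ∞ S.correction :=
  contDiff_const.mul (S.contDiff_potential.comp (dilate n _).contDiff)

theorem unifSmoothOn_correction_dilate (hμ1 : μ < 1) :
    UnifSmoothOn (fun (ρ : S.Scale) z => (ρ : ℝ) ^ (μ - 1) * S.correction (dilate n ρ z))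
      fun _ => goodShell n k a b := by
  have hr := S.r_pos
  have h1 := ((S.unifSmoothOn_potential_dilate hμ1).reindex fun ρ : S.Scale =>
    (⟨S.r⁻¹ * ρ, by rw [le_inv_mul_iff₀ hr, mul_one]; exact ρ.2⟩ : {l : ℝ // 1 ≤ l})).clm_comp
      (S.r ^ μ • ContinuousLinearMap.id ℝ ℝ)
  refine h1.congr fun ρ z _ => ?_
  have hρ : 0 < (ρ : ℝ) := hr.trans_le ρ.2
  have h2 : dilate n S.r⁻¹ (dilate n ρ z) = dilate n (S.r⁻¹ * ρ) z := by simp [mul_smul]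
  have h3 : S.r ^ μ * S.r⁻¹ ^ (μ - 1) = S.r := by
    rw [Real.inv_rpow hr.le, ← Real.rpow_neg hr.le, ← Real.rpow_add hr]
    simp
  simp only [correction, h2, _root_.smul_apply, ContinuousLinearMap.id_apply, smul_eq_mul]
  rw [Real.mul_rpow (by positivity) hρ.le]
  linear_combination (-(ρ : ℝ) ^ (μ - 1) * S.potential (dilate n (S.r⁻¹ * ρ) z)) * h3

/-- The factor `r` in `correction` compensates the `r⁻¹` from the inner dilation, so the
`x`-gradient is exactly the momentum shift. -/
theorem fderiv_correction (p : E n × E n) (v : E n) :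
    fderiv ℝ S.correction p (v, 0) = inner ℝ (S.baseShift (dilate n S.r⁻¹ p)) v := by
  have h1 : HasFDerivAt S.correction (S.r • ((fderiv ℝ S.potential (dilate n S.r⁻¹ p)).comp
      (dilate n S.r⁻¹))) p :=
    (((S.contDiff_potential.differentiable (by simp) _).hasFDerivAt).comp p
      (dilate n S.r⁻¹).hasFDerivAt).const_mul S.r
  have h2 : dilate n S.r⁻¹ ((v, 0) : E n × E n) = S.r⁻¹ • ((v, 0) : E n × E n) := by simp
  rw [h1.fderiv]
  simp only [_root_.smul_apply, ContinuousLinearMap.comp_apply, h2, map_smul, smul_eq_mul,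
    S.fderiv_potential]
  rw [mul_inv_cancel_left₀ S.r_pos.ne']

/-- The outgoing phase function. -/
def phase (p : E n × E n) : ℝ := inner ℝ p.1 p.2 + S.correction p

theorem contDiff_phase : ContDiff ℝ ∞ S.phase :=
  (contDiff_fst.inner ℝ contDiff_snd).add S.contDiff_correction

theorem gradX_phase (p : E n × E n) (i : Fin n) :
    gradX S.phase p i = (p.2 + S.baseShift (dilate n S.r⁻¹ p)) i := by
  have h1 := (((hasFDerivAt_fst (𝕜 := ℝ) (p := p)).inner ℝ (hasFDerivAt_snd (𝕜 := ℝ) (p := p))).add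
    (S.contDiff_correction.differentiable (by simp) p).hasFDerivAt).fderiv
  refine (congrArg (fun T : E n × E n →L[ℝ] ℝ => T (EuclideanSpace.single i 1, 0)) h1).trans ?_
  rw [_root_.add_apply, S.fderiv_correction]
  simp [EuclideanSpace.inner_single_left, EuclideanSpace.inner_single_right]

theorem bilin_gradX_phase {p : E n × E n} (hp : dilate n S.r⁻¹ p ∈ goodRegion n k a b) :
    bilin (G p.1) (gradX S.phase p) (gradX S.phase p) = g₀ k p.2 p.2 := by
  have h1 := S.fullHamiltonian_baseShift hp
  simp only [dilate_apply, smul_inv_smul₀ S.r_pos.ne'] at h1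
  rw [← h1, show gradX S.phase p = (p.2 + S.baseShift (dilate n S.r⁻¹ p) : E n) from
    funext (S.gradX_phase p)]
  rfl

end Setting

theorem abs_g₀_le {n : ℕ} (k : ℕ) (x ξ : E n) : |g₀ k x ξ| ≤ ‖x‖ * ‖ξ‖ := by
  rw [← inner_flatOp, ← norm_flatOp k x]
  exact abs_real_inner_le_norm _ _

/-! ### Localization to the outgoing region. -/

section Localizer

variable (n k : ℕ) (a b : ℝ)

/-- A smooth function which is `1` on `[a, b]` and `0` off `(2a/3, 3b/2)`. -/
def energyCutoff (u : ℝ) : ℝ :=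
  Real.smoothTransition ((u - 2 * a / 3) / (a / 3)) *
    Real.smoothTransition ((3 * b / 2 - u) / (b / 2))

/-- A cutoff, homogeneous of degree zero in position, which localizes to the outgoing region. -/
def localizer (z : E n × E n) : ℝ :=
  energyCutoff a b (‖z.2‖ ^ 2) *
    Real.smoothTransition (8 * (g₀ k z.1 z.2 / (‖z.1‖ * ‖z.2‖)) + 3)

variable {n k a b}

theorem contDiff_energyCutoff : ContDiff ℝ ∞ (energyCutoff a b) := by
  unfold energyCutoff
  exact (Real.smoothTransition.contDiff.comp ((contDiff_id.sub contDiff_const).div_const _)).mul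
    (Real.smoothTransition.contDiff.comp ((contDiff_const.sub contDiff_id).div_const _))

theorem localizer_eq_one (ha : 0 < a) (hb : 0 < b) {z : E n × E n} (h1 : a ≤ ‖z.2‖ ^ 2)
    (h2 : ‖z.2‖ ^ 2 ≤ b) (h3 : -(1 / 4) ≤ g₀ k z.1 z.2 / (‖z.1‖ * ‖z.2‖)) :
    localizer n k a b z = 1 := by
  rw [localizer, energyCutoff, Real.smoothTransition.one_of_one_le,
    Real.smoothTransition.one_of_one_le, Real.smoothTransition.one_of_one_le]
  · norm_num
  · linarith
  · rw [le_div_iff₀ (by positivity)]; linarith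
  · rw [le_div_iff₀ (by positivity)]; linarith

theorem localizer_eventuallyEq_zero_of_energy_le (ha : 0 < a) {z : E n × E n}
    (h : ‖z.2‖ ^ 2 < 2 * a / 3) : localizer n k a b =ᶠ[𝓝 z] 0 := by
  have h1 : Continuous fun z : E n × E n => ‖z.2‖ ^ 2 := continuous_snd.norm.pow 2
  filter_upwards [h1.continuousAt.eventually_lt_const h] with w hw
  rw [localizer, energyCutoff, Real.smoothTransition.zero_of_nonpos, zero_mul, zero_mul]
  · rfl
  · exact div_nonpos_of_nonpos_of_nonneg (by linarith) (by positivity)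

theorem localizer_eventuallyEq_zero_of_energy_ge (hb : 0 < b) {z : E n × E n}
    (h : 3 * b / 2 < ‖z.2‖ ^ 2) : localizer n k a b =ᶠ[𝓝 z] 0 := by
  have h1 : Continuous fun z : E n × E n => ‖z.2‖ ^ 2 := continuous_snd.norm.pow 2
  filter_upwards [h1.continuousAt.eventually_const_lt h] with w hw
  rw [localizer, energyCutoff, Real.smoothTransition.zero_of_nonpos (x := (3 * b / 2 - _) / _),
    mul_zero, zero_mul]
  · rfl
  · exact div_nonpos_of_nonpos_of_nonneg (by linarith) (by positivity)

theorem localizer_eventuallyEq_zero_of_angle {z : E n × E n}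
    (h : g₀ k z.1 z.2 < -(3 / 8) * (‖z.1‖ * ‖z.2‖)) : localizer n k a b =ᶠ[𝓝 z] 0 := by
  have h1 : Continuous fun z : E n × E n => -(3 / 8) * (‖z.1‖ * ‖z.2‖) :=
    continuous_const.mul (continuous_fst.norm.mul continuous_snd.norm)
  filter_upwards [(continuous_g₀ n k).continuousAt.eventually_lt h1.continuousAt h] with w hw
  have h2 := abs_g₀_le k w.1 w.2
  have h3 : 0 ≤ ‖w.1‖ * ‖w.2‖ := by positivity
  have h4 : 0 < ‖w.1‖ * ‖w.2‖ := by
    rcases h3.eq_or_lt with h4 | h4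
    · rw [← h4] at hw h2
      rw [abs_nonpos_iff.1 h2] at hw
      norm_num at hw
    · exact h4
  rw [localizer, Real.smoothTransition.zero_of_nonpos, mul_zero]
  · rfl
  · have : g₀ k w.1 w.2 / (‖w.1‖ * ‖w.2‖) ≤ -(3 / 8) := by
      rw [div_le_iff₀ h4]; exact hw.le
    linarith

/-- Where the direction of `z` is not in the enlarged outgoing region the localizer vanishes. -/
theorem localizer_eventuallyEq_zero (ha : 0 < a) (hb : 0 < b) {z : E n × E n}
    (hz : 1 / 2 < ‖z.1‖) (h : z ∉ goodRegion n k a b) : localizer n k a b =ᶠ[𝓝 z] 0 := by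
  by_cases h1 : ‖z.2‖ ^ 2 < 2 * a / 3
  · exact localizer_eventuallyEq_zero_of_energy_le ha h1
  by_cases h2 : 3 * b / 2 < ‖z.2‖ ^ 2
  · exact localizer_eventuallyEq_zero_of_energy_ge hb h2
  refine localizer_eventuallyEq_zero_of_angle ?_
  by_contra h3
  push Not at h1 h2 h3
  refine h ⟨hz, by linarith, by linarith, ?_⟩
  have h4 : 0 < ‖z.2‖ := by
    rcases (norm_nonneg z.2).eq_or_lt with h4 | h4
    · rw [← h4] at h1; nlinarith
    · exact h4
  have : 0 < ‖z.1‖ * ‖z.2‖ := by positivity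
  linarith

/-- The quotient is singular also at zero momentum, but there the energy cutoff vanishes nearby. -/
theorem contDiffAt_localizer (ha : 0 < a) {z : E n × E n} (hz : z.1 ≠ 0) :
    ContDiffAt ℝ ∞ (localizer n k a b) z := by
  by_cases h : ‖z.2‖ ^ 2 < 2 * a / 3
  · exact contDiffAt_const.congr_of_eventuallyEq (localizer_eventuallyEq_zero_of_energy_le ha h)
  have hz2 : z.2 ≠ 0 := by
    intro h0
    rw [h0, norm_zero] at h
    exact h (by norm_num; linarith)
  have h1 : ContDiff ℝ ∞ fun z : E n × E n => g₀ k z.1 z.2 := by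
    simp only [← inner_flatOp]
    exact ((flatOp n k).contDiff.comp contDiff_fst).inner ℝ contDiff_snd
  have h2 : ContDiffAt ℝ ∞ (fun z : E n × E n => ‖z.1‖ * ‖z.2‖) z :=
    ((contDiffAt_norm ℝ hz).comp z contDiffAt_fst).mul
      ((contDiffAt_norm ℝ hz2).comp z contDiffAt_snd)
  unfold localizer
  refine ContDiffAt.mul ?_ ?_
  · exact (contDiff_energyCutoff.comp ((contDiff_norm_sq ℝ).comp contDiff_snd)).contDiffAt
  · refine Real.smoothTransition.contDiff.contDiffAt.comp z ((contDiffAt_const.mul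
      (h1.contDiffAt.div h2 ?_)).add contDiffAt_const)
    exact mul_ne_zero (norm_ne_zero_iff.2 hz) (norm_ne_zero_iff.2 hz2)

theorem localizer_dilate {ρ : ℝ} (hρ : 0 < ρ) (z : E n × E n) :
    localizer n k a b (dilate n ρ z) = localizer n k a b z := by
  have h1 : g₀ k (ρ • z.1) z.2 = ρ * g₀ k z.1 z.2 := by
    rw [← inner_flatOp, ← inner_flatOp, map_smul, real_inner_smul_left]
  simp only [localizer, dilate_apply, h1, norm_smul, Real.norm_of_nonneg hρ.le]
  rw [mul_assoc ρ, mul_div_mul_left _ _ hρ.ne']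

/-- The shell lies in a compact set on which positions do not vanish, so continuity bounds every
derivative. -/
theorem unifSmoothOn_localizer {ι : Type*} (ha : 0 < a) :
    UnifSmoothOn (fun _ : ι => localizer n k a b) fun _ => goodShell n k a b := by
  have hU : IsOpen {z : E n × E n | z.1 ≠ 0} := isOpen_ne_fun continuous_fst continuous_const
  have hsm : ContDiffOn ℝ ∞ (localizer n k a b) {z : E n × E n | z.1 ≠ 0} := fun z hz =>
    (contDiffAt_localizer ha hz).contDiffWithinAt
  set K : Set (E n × E n) := (Metric.closedBall 0 2 ∩ {x | 1 / 2 ≤ ‖x‖}) ×ˢ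
    Metric.closedBall 0 (Real.sqrt (2 * b)) with hK
  have hKc : IsCompact K := ((isCompact_closedBall _ _).inter_right
    (isClosed_le continuous_const continuous_norm)).prod (isCompact_closedBall _ _)
  have hKU : K ⊆ {z : E n × E n | z.1 ≠ 0} := by
    rintro z ⟨⟨-, h1⟩, -⟩ h0
    have h2 : (1 : ℝ) / 2 ≤ ‖z.1‖ := h1
    rw [h0, norm_zero] at h2
    norm_num at h2
  have hsub : goodShell n k a b ⊆ K := by
    rintro z ⟨⟨h1, -, h2, -⟩, h3⟩
    refine ⟨⟨mem_closedBall_zero_iff.2 (le_of_lt h3), h1.le⟩, mem_closedBall_zero_iff.2 ?_⟩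
    exact Real.le_sqrt_of_sq_le h2.le
  refine ⟨fun _ => isOpen_goodShell n k a b, fun _ => hsm.mono (hsub.trans hKU), fun j => ?_⟩
  have hc : ContinuousOn (iteratedFDeriv ℝ j (localizer n k a b)) K := fun z hz =>
    ((contDiffAt_localizer ha (hKU hz)).continuousAt_iteratedFDeriv
      (by exact_mod_cast le_top)).continuousWithinAt
  obtain ⟨C, hC⟩ := hKc.exists_bound_of_continuousOn hc
  exact ⟨C, fun _ z hz => hC z (hsub hz)⟩

/-- The dilated position cutoffs are bounded with all their derivatives on the shell. -/
theorem unifSmoothOn_farCutoff_dilate :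
    UnifSmoothOn (fun (τ : {τ : ℝ // 0 < τ}) (z : E n × E n) => farCutoff ((τ : ℝ) • z.1))
      fun _ => goodShell n k a b := by
  have hsm : ∀ τ : ℝ, ContDiff ℝ ∞ fun z : E n × E n => farCutoff (τ • z.1) := fun τ =>
    contDiff_farCutoff.comp (contDiff_fst.const_smul τ)
  refine ⟨fun _ => isOpen_goodShell n k a b, fun τ => (hsm τ).contDiffOn, fun j => ?_⟩
  obtain ⟨C, hC⟩ := ((unifSmoothOn_farCutoff (n := n) (ι := {τ : ℝ // 0 < τ ∧ τ ≤ 2})).comp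
    (TameOn.of_clm (V := E n × E n)
      (A := fun τ : {τ : ℝ // 0 < τ ∧ τ ≤ 2} => (τ : ℝ) • ContinuousLinearMap.fst ℝ (E n) (E n)) (C := 2 *
        ‖ContinuousLinearMap.fst ℝ (E n) (E n)‖) fun τ => by
        rw [norm_smul, Real.norm_of_nonneg τ.2.1.le]
        exact mul_le_mul_of_nonneg_right τ.2.2 (norm_nonneg _))
    fun _ => mapsTo_univ _ _).bound j
  obtain ⟨D, hD⟩ := (UnifSmoothOn.const_of_bounded (V := E n × E n) (ι := Unit)
    (c := fun _ => (1 : ℝ)) (C := 1) (by simp)).bound j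
  refine ⟨max C D, fun τ z hz => ?_⟩
  -- On the shell `|y| > 1/2`, so for `τ > 2` the cutoff is constantly `1`; for `τ ≤ 2` the
  -- dilations are bounded.
  rcases le_or_gt (τ : ℝ) 2 with h | h
  · exact (hC ⟨τ, τ.2, h⟩ z (mem_univ _)).trans (le_max_left _ _)
  · have h1 : (fun z : E n × E n => farCutoff ((τ : ℝ) • z.1)) =ᶠ[𝓝 z] fun _ => 1 := by
      filter_upwards [(isOpen_goodShell n k a b).mem_nhds hz] with w hw
      refine farCutoff_eq_one ?_
      rw [norm_smul, Real.norm_of_nonneg τ.2.le]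
      have := hw.1.1
      nlinarith
    rw [(h1.iteratedFDeriv ℝ j).eq_of_nhds]
    exact (hD () z (mem_univ _)).trans (le_max_right _ _)

end Localizer

/-! ### Derivative bounds for the correction and its cut-off versions. -/

namespace Setting

variable {n k : ℕ} {μ : ℝ} {G : E n → Matrix (Fin n) (Fin n) ℝ} {a b : ℝ} (S : Setting k μ G a b)

/-- The correction, cut off near the origin and localized to the outgoing region. -/
def cutCorrection (R : ℝ) (p : E n × E n) : ℝ :=
  farCutoff (R⁻¹ • p.1) * (localizer n k a b p * S.correction p)

theorem cutCorrection_eventuallyEq_zero {R : ℝ} (hR : 0 < R) {p : E n × E n} (hp : ‖p.1‖ < R / 2) :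
    S.cutCorrection R =ᶠ[𝓝 p] 0 := by
  filter_upwards [(continuous_fst (X := E n) (Y := E n)).norm.continuousAt.eventually_lt_const hp]
    with q hq
  rw [cutCorrection, farCutoff_eq_zero, zero_mul]
  · rfl
  · rw [norm_smul, norm_inv, Real.norm_of_nonneg hR.le, inv_mul_le_iff₀ hR]
    linarith

theorem contDiff_cutCorrection (ha : 0 < a) {R : ℝ} (hR : 0 < R) :
    ContDiff ℝ ∞ (S.cutCorrection R) := by
  refine contDiff_iff_contDiffAt.2 fun p => ?_
  by_cases hp : ‖p.1‖ < R / 2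
  · exact contDiffAt_const.congr_of_eventuallyEq (S.cutCorrection_eventuallyEq_zero hR hp)
  · have hp1 : p.1 ≠ 0 := by
      intro h0
      rw [h0, norm_zero] at hp
      exact hp (by positivity)
    exact (contDiff_farCutoff.comp (contDiff_fst.const_smul R⁻¹)).contDiffAt.mul
      ((contDiffAt_localizer ha hp1).mul S.contDiff_correction.contDiffAt)

theorem unifSmoothOn_cutCorrection_dilate (hμ1 : μ < 1) (ha : 0 < a) :
    UnifSmoothOn (fun (i : S.Scale × {R : ℝ // 0 < R}) z =>
      (i.1 : ℝ) ^ (μ - 1) * S.cutCorrection i.2 (dilate n i.1 z)) fun _ => goodShell n k a b := by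
  have hpos : ∀ ρ : S.Scale, 0 < (ρ : ℝ) := fun ρ => S.r_pos.trans_le ρ.2
  have h1 := (unifSmoothOn_farCutoff_dilate (n := n) (k := k) (a := a) (b := b)).reindex
    fun i : S.Scale × {R : ℝ // 0 < R} =>
      (⟨(i.2 : ℝ)⁻¹ * i.1, mul_pos (inv_pos.2 i.2.2) (hpos i.1)⟩ : {τ : ℝ // 0 < τ})
  have h2 := unifSmoothOn_localizer (n := n) (k := k) (b := b)
    (ι := S.Scale × {R : ℝ // 0 < R}) ha
  have h3 := (S.unifSmoothOn_correction_dilate hμ1).reindex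
    fun i : S.Scale × {R : ℝ // 0 < R} => i.1
  refine (h1.bilinear (ContinuousLinearMap.mul ℝ ℝ)
    (h2.bilinear (ContinuousLinearMap.mul ℝ ℝ) h3)).congr fun i z _ => ?_
  simp only [ContinuousLinearMap.mul_apply', cutCorrection, localizer_dilate (hpos i.1)]
  rw [show (dilate n i.1 z).1 = (i.1 : ℝ) • z.1 from rfl, smul_smul]
  ring

/-- Undoing the dilation gives `ρ^{-1}` for each `x`-derivative and nothing for `ξ`-derivatives;
removing the weight gives `ρ^{1-μ}`. -/
theorem abs_mixedDeriv_le_of_weighted {f : E n × E n → ℝ} (hf : ContDiff ℝ ∞ f) (α β : Fin n → ℕ)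
    {ρ C : ℝ} (hρ : 0 < ρ) {p : E n × E n}
    (h : ‖iteratedFDeriv ℝ (order α + order β) (fun z => ρ ^ (μ - 1) * f (dilate n ρ z))
      (ρ⁻¹ • p.1, p.2)‖ ≤ C) :
    |mixedDeriv α β f p| ≤ C * ρ ^ (1 - μ - (order α : ℝ)) := by
  have hs : ContDiff ℝ ∞ fun z => f (dilate n ρ z) := hf.comp (dilate n ρ).contDiff
  rw [show (fun z => ρ ^ (μ - 1) * f (dilate n ρ z)) = fun z => ρ ^ (μ - 1) • f (dilate n ρ z)
    from rfl, iteratedFDeriv_const_smul_apply' (hs.contDiffAt.of_le (by exact_mod_cast le_top)),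
    norm_smul, Real.norm_of_nonneg (by positivity)] at h
  have h1 : ρ ^ (1 - μ) * ρ ^ (μ - 1) = 1 := by rw [← Real.rpow_add hρ]; simp
  have h2 := abs_mixedDeriv_le_of_dilate hf α β hρ (x := p.1) (ξ := p.2) (B := ρ ^ (1 - μ) * C) (by
    refine le_trans (le_of_eq ?_) (mul_le_mul_of_nonneg_left h (by positivity))
    rw [← mul_assoc, h1, one_mul])
  refine h2.trans (le_of_eq ?_)
  rw [sub_eq_add_neg (1 - μ), Real.rpow_add hρ]
  ring

theorem mem_goodRegion_dilate_inv {p : E n × E n} (ha : 0 < a) {σ R ρ : ℝ}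
    (hσ : σ ≤ 1 / 4) (hρ : 0 < ρ) (hρR : ρ < 2 * ‖p.1‖)
    (hp : p ∈ region k 1 R (Ioo a b) σ) : dilate n ρ⁻¹ p ∈ goodRegion n k a b := by
  obtain ⟨-, ⟨h2, h3⟩, h4⟩ := hp
  have hx : 0 < ‖p.1‖ := by linarith
  have hξ : 0 < ‖p.2‖ := by
    rcases (norm_nonneg p.2).eq_or_lt with h | h
    · rw [← h] at h2; norm_num at h2; linarith
    · exact h
  have hprod : 0 < ‖p.1‖ * ‖p.2‖ := by positivity
  simp only [Units.val_one, Int.cast_one, one_mul] at h4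
  rw [lt_div_iff₀ hprod] at h4
  have hnorm : ‖(dilate n ρ⁻¹ p).1‖ = ρ⁻¹ * ‖p.1‖ := by
    rw [dilate_apply, norm_smul, norm_inv, Real.norm_of_nonneg hρ.le]
  have hg : g₀ k (dilate n ρ⁻¹ p).1 (dilate n ρ⁻¹ p).2 = ρ⁻¹ * g₀ k p.1 p.2 := by
    rw [dilate_apply, ← inner_flatOp, ← inner_flatOp, map_smul, real_inner_smul_left]
  refine ⟨?_, ?_, ?_, ?_⟩
  · rw [hnorm, lt_inv_mul_iff₀ hρ]; linarith
  · change a / 2 < ‖p.2‖ ^ 2; linarith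
  · change ‖p.2‖ ^ 2 < 2 * b; linarith
  · rw [hnorm, hg]
    change -(1 / 2) * (ρ⁻¹ * ‖p.1‖ * ‖p.2‖) < _
    have : ρ⁻¹ * (-(1 / 2) * (‖p.1‖ * ‖p.2‖)) < ρ⁻¹ * g₀ k p.1 p.2 :=
      mul_lt_mul_of_pos_left (by nlinarith) (inv_pos.2 hρ)
    linarith

/-- Take the scale `ρ = |x|`, which is admissible since `|x| > r`; the rescaled point has `|y| = 1`
and lies in the shell. -/
theorem exists_mixedDeriv_correction_bound (hμ1 : μ < 1) (ha : 0 < a)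
    (α β : Fin n → ℕ) : ∃ C : ℝ, 0 ≤ C ∧ ∀ σ : ℝ, σ ≤ 1 / 4 →
      ∀ p ∈ region k 1 S.r (Ioo a b) σ,
        |mixedDeriv α β S.correction p| ≤ C * ‖p.1‖ ^ (1 - μ - (order α : ℝ)) := by
  obtain ⟨C, hC1, hC⟩ := (S.unifSmoothOn_correction_dilate hμ1).bound_uniform (order α + order β)
  refine ⟨C, zero_le_one.trans hC1, fun σ hσ p hp => ?_⟩
  have hx : 0 < ‖p.1‖ := S.r_pos.trans hp.1
  refine abs_mixedDeriv_le_of_weighted S.contDiff_correction α β hx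
    (hC _ le_rfl ⟨‖p.1‖, hp.1.le⟩ _ ⟨?_, ?_⟩)
  · exact mem_goodRegion_dilate_inv ha hσ hx (by linarith) hp
  · change ‖‖p.1‖⁻¹ • p.1‖ < 2
    rw [norm_smul, norm_inv, norm_norm, inv_mul_cancel₀ hx.ne']
    norm_num

theorem exists_mixedDeriv_cutCorrection_bound (hμ1 : μ < 1) (ha : 0 < a) (hb : 0 < b)
    (α β : Fin n → ℕ) : ∃ C : ℝ, 0 ≤ C ∧ ∀ R : ℝ, 2 * S.r ≤ R → ∀ p : E n × E n,
      (‖p.1‖ < R / 2 → mixedDeriv α β (S.cutCorrection R) p = 0) ∧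
      (R / 2 ≤ ‖p.1‖ → |mixedDeriv α β (S.cutCorrection R) p| ≤
        C * ‖p.1‖ ^ (1 - μ - (order α : ℝ))) := by
  obtain ⟨C, hC1, hC⟩ := (S.unifSmoothOn_cutCorrection_dilate hμ1 ha).bound_uniform
    (order α + order β)
  have hC0 : 0 ≤ C := zero_le_one.trans hC1
  have hr := S.r_pos
  refine ⟨C, hC0, fun R hR p => ⟨fun hp => ?_, fun hp => ?_⟩⟩
  · have hR0 : 0 < R := by linarith
    have h1 := abs_mixedDeriv_le (S.contDiff_cutCorrection ha hR0) α β p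
    rw [((S.cutCorrection_eventuallyEq_zero hR0 hp).iteratedFDeriv ℝ _).eq_of_nhds,
      Pi.zero_def, iteratedFDeriv_fun_zero] at h1
    simpa using h1
  · have hR0 : 0 < R := by linarith
    have hx : 0 < ‖p.1‖ := by linarith
    have hn : ‖‖p.1‖⁻¹ • p.1‖ = 1 := by
      rw [norm_smul, norm_inv, norm_norm, inv_mul_cancel₀ hx.ne']
    refine abs_mixedDeriv_le_of_weighted (S.contDiff_cutCorrection ha hR0) α β hx ?_
    -- Outside the enlarged region the localizer vanishes in a neighbourhood, so the estimate is
    -- needed only where the correction is controlled.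
    by_cases hg : (‖p.1‖⁻¹ • p.1, p.2) ∈ goodRegion n k a b
    · refine hC _ le_rfl (⟨‖p.1‖, by linarith⟩, ⟨R, hR0⟩) _ ⟨hg, ?_⟩
      change ‖‖p.1‖⁻¹ • p.1‖ < 2
      rw [hn]; norm_num
    · have h1 : (fun z => ‖p.1‖ ^ (μ - 1) * S.cutCorrection R (dilate n ‖p.1‖ z))
          =ᶠ[𝓝 (‖p.1‖⁻¹ • p.1, p.2)] 0 := by
        have h2 : 1 / 2 < ‖((‖p.1‖⁻¹ • p.1, p.2) : E n × E n).1‖ := by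
          change 1 / 2 < ‖‖p.1‖⁻¹ • p.1‖
          rw [hn]; norm_num
        filter_upwards [localizer_eventuallyEq_zero ha hb h2 hg] with z hz
        rw [cutCorrection, localizer_dilate hx, hz]
        simp
      rw [(h1.iteratedFDeriv ℝ _).eq_of_nhds, Pi.zero_def, iteratedFDeriv_fun_zero]
      simpa using hC0

/-- The outgoing phase function, cut off near the origin and localized. -/
def cutPhase (R : ℝ) (p : E n × E n) : ℝ := inner ℝ p.1 p.2 + S.cutCorrection R p

theorem contDiff_cutPhase (ha : 0 < a) {R : ℝ} (hR : 0 < R) : ContDiff ℝ ∞ (S.cutPhase R) :=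
  (contDiff_fst.inner ℝ contDiff_snd).add (S.contDiff_cutCorrection ha hR)

theorem cutPhase_eq (ha : 0 < a) (hb : 0 < b) {R σ : ℝ} (hR : 0 < R) (hσ : σ ≤ 1 / 4)
    {p : E n × E n} (hp : p ∈ region k 1 R (Ioo a b) σ) : S.cutPhase R p = S.phase p := by
  obtain ⟨h1, ⟨h2, h3⟩, h4⟩ := hp
  simp only [Units.val_one, Int.cast_one, one_mul] at h4
  rw [cutPhase, phase, cutCorrection, localizer_eq_one ha hb h2.le h3.le (by linarith),
    farCutoff_eq_one, one_mul, one_mul]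
  rw [norm_smul, norm_inv, Real.norm_of_nonneg hR.le, le_inv_mul_iff₀ hR]
  linarith

end Setting

theorem isOpen_region_one {n k : ℕ} {a b R σ : ℝ} (ha : 0 < a) (hR : 0 < R) :
    IsOpen (region (n := n) k 1 R (Ioo a b) σ) := by
  have h1 : Continuous fun z : E n × E n => ‖z.1‖ := continuous_fst.norm
  have h2 : Continuous fun z : E n × E n => ‖z.2‖ := continuous_snd.norm
  have h3 : region (n := n) k 1 R (Ioo a b) σ = {z | R < ‖z.1‖} ∩ ({z | ‖z.2‖ ^ 2 ∈ Ioo a b} ∩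
      {z | -σ * (‖z.1‖ * ‖z.2‖) < g₀ k z.1 z.2}) := by
    ext z
    refine and_congr_right fun (hz1 : R < ‖z.1‖) => and_congr_right fun (hz2 : ‖z.2‖ ^ 2 ∈ Ioo a b) => ?_
    have hξ : 0 < ‖z.2‖ := by
      rcases (norm_nonneg z.2).eq_or_lt with h | h
      · have := hz2.1
        rw [← h] at this; norm_num at this; linarith
      · exact h
    have hx : 0 < ‖z.1‖ := hR.trans hz1
    simp only [Units.val_one, Int.cast_one, one_mul]
    exact lt_div_iff₀ (by positivity)
  rw [h3]
  exact (isOpen_lt continuous_const h1).inter ((isOpen_Ioo.preimage (h2.pow 2)).inter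
    (isOpen_lt (continuous_const.mul (h1.mul h2)) (continuous_g₀ n k)))

/-! ### Incoming phases by reflection of the momentum. -/

section Reflection

variable {n : ℕ} (ε : ℤˣ)

/-- The reflection `(x, ξ) ↦ (x, ε ξ)`. -/
def flip (n : ℕ) (ε : ℤˣ) : E n × E n →L[ℝ] E n × E n :=
  (ContinuousLinearMap.fst ℝ (E n) (E n)).prod
    (((ε : ℤ) : ℝ) • ContinuousLinearMap.snd ℝ (E n) (E n))

@[simp]
theorem flip_apply (p : E n × E n) : flip n ε p = (p.1, ((ε : ℤ) : ℝ) • p.2) := rfl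

/-- The function `ε f(x, ε ξ)`. -/
def reflect (f : E n × E n → ℝ) (p : E n × E n) : ℝ := ((ε : ℤ) : ℝ) * f (flip n ε p)

theorem sign_mul_self : ((ε : ℤ) : ℝ) * ((ε : ℤ) : ℝ) = 1 := by
  rcases Int.units_eq_one_or ε with rfl | rfl <;> simp

theorem contDiff_reflect {f : E n × E n → ℝ} (hf : ContDiff ℝ ∞ f) :
    ContDiff ℝ ∞ (reflect ε f) :=
  contDiff_const.mul (hf.comp (flip n ε).contDiff)

theorem gradX_reflect {f : E n × E n → ℝ} (hf : ContDiff ℝ ∞ f) (p : E n × E n) (i : Fin n) :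
    gradX (reflect ε f) p i = ((ε : ℤ) : ℝ) * gradX f (flip n ε p) i := by
  have h1 : HasFDerivAt (reflect ε f) (((ε : ℤ) : ℝ) • (fderiv ℝ f (flip n ε p)).comp (flip n ε)) p :=
    ((hf.differentiable (by simp) _).hasFDerivAt.comp p (flip n ε).hasFDerivAt).const_mul _
  rw [gradX, h1.fderiv, gradX]
  simp

theorem bilin_sign_mul (A : Matrix (Fin n) (Fin n) ℝ) (η : Fin n → ℝ) :
    bilin A (fun i => ((ε : ℤ) : ℝ) * η i) (fun i => ((ε : ℤ) : ℝ) * η i) = bilin A η η := by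
  refine Finset.sum_congr rfl fun i _ => Finset.sum_congr rfl fun j _ => ?_
  linear_combination (A i j * η i * η j) * sign_mul_self ε

theorem g₀_flip (k : ℕ) (p : E n × E n) :
    g₀ k (flip n ε p).2 (flip n ε p).2 = g₀ k p.2 p.2 :=
  bilin_sign_mul ε (flatMatrix n k) p.2

theorem flip_mem_region {k : ℕ} {R σ : ℝ} {J : Set ℝ} {p : E n × E n} :
    flip n ε p ∈ region k 1 R J σ ↔ p ∈ region k ε R J σ := by
  have h1 : ‖((ε : ℤ) : ℝ) • p.2‖ = ‖p.2‖ := by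
    rcases Int.units_eq_one_or ε with rfl | rfl <;> simp
  have h2 : g₀ k p.1 (((ε : ℤ) : ℝ) • p.2) = ((ε : ℤ) : ℝ) * g₀ k p.1 p.2 := by
    rw [← inner_flatOp, ← inner_flatOp, real_inner_smul_right]
  simp only [region, mem_ofPred_eq, flip_apply, h1, h2, mul_div_assoc, Units.val_one, Int.cast_one,
    one_mul]

theorem SolvesEikonal.reflect {k : ℕ} {G : E n → Matrix (Fin n) (Fin n) ℝ} {R σ : ℝ} {J : Set ℝ}
    {f : E n × E n → ℝ} (hf : ContDiff ℝ ∞ f) (h : SolvesEikonal k G f (region k 1 R J σ)) :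
    SolvesEikonal k G (reflect ε f) (region k ε R J σ) := by
  intro p hp
  have h1 := h _ ((flip_mem_region ε).2 hp)
  rw [g₀_flip] at h1
  rw [← h1, funext (gradX_reflect ε hf p), bilin_sign_mul]
  rfl

theorem deviation_reflect (f : E n × E n → ℝ) :
    deviation (reflect ε f) = reflect ε (deviation f) := by
  ext1 p
  simp only [deviation, reflect, flip_apply, real_inner_smul_right]
  linear_combination (inner ℝ p.1 p.2) * sign_mul_self ε

/-- The reflection multiplies each momentum direction by `±1`, so the derivatives change only by a
sign. -/
theorem abs_mixedDeriv_reflect {f : E n × E n → ℝ} (hf : ContDiff ℝ ∞ f) (α β : Fin n → ℕ)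
    (p : E n × E n) : |mixedDeriv α β (reflect ε f) p| = |mixedDeriv α β f (flip n ε p)| := by
  have habs : |((ε : ℤ) : ℝ)| = 1 := by
    rcases Int.units_eq_one_or ε with rfl | rfl <;> simp
  have h1 := dirDerivs_const_mul (hf.comp (flip n ε).contDiff) ((ε : ℤ) : ℝ)
    (((word α).map fun i => ((EuclideanSpace.single i (1 : ℝ), 0) : E n × E n)) ++
      ((word β).map fun j => ((0, EuclideanSpace.single j (1 : ℝ)) : E n × E n))) p
  have h2 := dirDerivs_comp_clm hf (flip n ε)
    (((word α).map fun i => ((EuclideanSpace.single i (1 : ℝ), 0) : E n × E n)) ++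
      ((word β).map fun j => ((0, EuclideanSpace.single j (1 : ℝ)) : E n × E n))) p
  have h3 := congrFun (dirDerivs_smul_append hf ((ε : ℤ) : ℝ)
    ((word β).map fun j => ((0, EuclideanSpace.single j (1 : ℝ)) : E n × E n))
    ((word α).map fun i => ((EuclideanSpace.single i (1 : ℝ), 0) : E n × E n))) (flip n ε p)
  rw [dirDerivs_perm hf List.perm_append_comm] at h3
  have h4 : List.map (flip n ε)
      (((word α).map fun i => ((EuclideanSpace.single i (1 : ℝ), 0) : E n × E n)) ++
        ((word β).map fun j => ((0, EuclideanSpace.single j (1 : ℝ)) : E n × E n))) =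
      ((word α).map fun i => ((EuclideanSpace.single i (1 : ℝ), 0) : E n × E n)) ++
      (((word β).map fun j => ((0, EuclideanSpace.single j (1 : ℝ)) : E n × E n)).map
        fun v => ((ε : ℤ) : ℝ) • v) := by
    rw [List.map_append, List.map_map, List.map_map, List.map_map]
    congr 1
    · exact List.map_congr_left fun i _ => by simp
    · exact List.map_congr_left fun i _ => by simp
  have h5 : mixedDeriv α β (reflect ε f) p = ((ε : ℤ) : ℝ) * dirDerivs _ (f ∘ flip n ε) p := h1
  rw [h5, show (f ∘ flip n ε) = fun p => f (flip n ε p) from rfl, h2, h4, h3, abs_mul, abs_mul,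
    abs_pow, habs, one_pow, one_mul, one_mul,
    dirDerivs_perm hf List.perm_append_comm]
  rfl

end Reflection

theorem jap_le {n : ℕ} {x : E n} (hx : 1 ≤ ‖x‖) : jap x ≤ 2 * ‖x‖ := by
  rw [jap, Real.sqrt_le_left (by positivity)]
  nlinarith

/-- For `|x| ≥ 1` the two weights differ by a factor at most `2`; the absolute value in the exponent
covers both signs of `e`. -/
theorem norm_rpow_le_jap_rpow {n : ℕ} {x : E n} (hx : 1 ≤ ‖x‖) (e : ℝ) :
    ‖x‖ ^ e ≤ 2 ^ |e| * jap x ^ e := by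
  have hj : 0 < jap x := one_pos.trans_le (one_le_jap x)
  rcases le_total 0 e with he | he
  · calc ‖x‖ ^ e ≤ jap x ^ e := Real.rpow_le_rpow (norm_nonneg _) (norm_le_jap x) he
      _ ≤ _ := le_mul_of_one_le_left (by positivity)
        (Real.one_le_rpow one_le_two (abs_nonneg e))
  · have h1 : ‖x‖ ^ e ≤ (jap x / 2) ^ e :=
      Real.rpow_le_rpow_of_nonpos (by positivity) (by linarith [jap_le hx]) he
    rw [abs_of_nonpos he, Real.rpow_neg zero_le_two]
    rwa [Real.div_rpow hj.le zero_le_two, div_eq_inv_mul] at h1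

end EikonalPhase

end

/-! ### Assembly of the theorem. -/

theorem mainTheorem6 (n k : ℕ) (hk : k ≤ n) (μ : ℝ) (hμ0 : 0 < μ) (hμ1 : μ < 1)
    (G : EikonalPhase.E n → Matrix (Fin n) (Fin n) ℝ) (hG : EikonalPhase.IsLongRange k μ G)
    (a b : ℝ) (ha : 0 < a) (hab : a < b) :
    ∃ R₀ : ℝ, 0 < R₀ ∧ ∃ σ₀ : ℝ, 0 < σ₀ ∧ σ₀ < 1 ∧ ∀ σ : ℝ, 0 < σ → σ < σ₀ →
      ∃ S : ℤˣ → EikonalPhase.E n × EikonalPhase.E n → ℝ,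
        (∀ ε : ℤˣ,
          ContDiffOn ℝ ∞ (S ε) (EikonalPhase.region k ε R₀ (Set.Ioo a b) σ) ∧
          EikonalPhase.SolvesEikonal k G (S ε)
            (EikonalPhase.region k ε R₀ (Set.Ioo a b) σ)) ∧
        (∀ α β : Fin n → ℕ, ∃ C : ℝ, 0 < C ∧ ∀ ε : ℤˣ,
          ∀ p ∈ EikonalPhase.region k ε R₀ (Set.Ioo a b) σ,
            |EikonalPhase.mixedDeriv α β (EikonalPhase.deviation (S ε)) p|
              ≤ C * EikonalPhase.jap p.1 ^ (1 - μ)) ∧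
        ∃ R' : ℝ, 0 < R' ∧
          ∃ SR : ℤˣ → ℝ → EikonalPhase.E n × EikonalPhase.E n → ℝ,
            (∀ ε : ℤˣ, ∀ R : ℝ, R' ≤ R →
              ContDiff ℝ ∞ (SR ε R) ∧
              (∀ p ∈ EikonalPhase.region k ε R (Set.Ioo a b) σ, SR ε R p = S ε p) ∧
              EikonalPhase.SolvesEikonal k G (SR ε R)
                (EikonalPhase.region k ε R (Set.Ioo a b) σ)) ∧
            (∀ α β : Fin n → ℕ, ∃ C : ℝ, 0 < C ∧ ∀ ε : ℤˣ, ∀ R : ℝ, 2 * R' ≤ R →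
              ∀ p : EikonalPhase.E n × EikonalPhase.E n,
                |EikonalPhase.mixedDeriv α β (EikonalPhase.deviation (SR ε R)) p|
                    ≤ C * EikonalPhase.jap p.1 ^ (1 - μ - (EikonalPhase.order α : ℝ)) ∧
                (α ≠ 0 →
                  |EikonalPhase.mixedDeriv α β (EikonalPhase.deviation (SR ε R)) p|
                    ≤ C * min (EikonalPhase.jap p.1 ^ (1 - μ - (EikonalPhase.order α : ℝ)))
                        (R ^ (1 - μ - (EikonalPhase.order α : ℝ))))) := by
  obtain ⟨T⟩ := EikonalPhase.exists_setting hG hμ0 ha b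
  have hb : 0 < b := ha.trans hab
  have hr1 : 1 ≤ T.r := T.scale.one_le
  have hr := T.r_pos
  have heik : ∀ σ : ℝ, σ ≤ 1 / 4 → EikonalPhase.SolvesEikonal k G T.phase
      (EikonalPhase.region k 1 T.r (Set.Ioo a b) σ) := fun σ hσ p hp =>
    T.bilin_gradX_phase (EikonalPhase.Setting.mem_goodRegion_dilate_inv ha hσ hr
      (by linarith [hp.1]) hp)
  have hdev : EikonalPhase.deviation T.phase = T.correction := by
    ext1 p
    exact add_sub_cancel_left _ _
  have hdevR : ∀ R : ℝ, EikonalPhase.deviation (T.cutPhase R) = T.cutCorrection R := by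
    intro R
    ext1 p
    exact add_sub_cancel_left _ _
  -- The localizer is `1` for cosines at least `-1/4` and supported where the cosine is at least
  -- `-3/8`, inside the enlarged region with `-1/2`. With `R' = 2r`, the cutoff starts at `R/2 ≥ r`,
  -- where the scale `|x|` is admissible.
  refine ⟨T.r, hr, 1 / 4, by norm_num, by norm_num, fun σ hσ hσ' =>
    ⟨fun ε => EikonalPhase.reflect ε T.phase, fun ε => ⟨?_, ?_⟩, fun α β => ?_,
      2 * T.r, by positivity, fun ε R => EikonalPhase.reflect ε (T.cutPhase R),
      fun ε R hR => ⟨?_, fun p hp => ?_, ?_⟩, fun α β => ?_⟩⟩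
  · exact (EikonalPhase.contDiff_reflect ε T.contDiff_phase).contDiffOn
  · exact (heik σ hσ'.le).reflect ε T.contDiff_phase
  · obtain ⟨C, hC0, hC⟩ := T.exists_mixedDeriv_correction_bound hμ1 ha α β
    refine ⟨C + 1, by linarith, fun ε p hp => ?_⟩
    have hp' := (EikonalPhase.flip_mem_region ε).2 hp
    have hx : 1 ≤ ‖p.1‖ := hr1.trans hp.1.le
    rw [EikonalPhase.deviation_reflect, hdev,
      EikonalPhase.abs_mixedDeriv_reflect ε T.contDiff_correction]
    refine (hC σ hσ'.le _ hp').trans ?_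
    refine mul_le_mul (by linarith) ?_ (by positivity) (by linarith)
    have h1 : (0 : ℝ) ≤ EikonalPhase.order α := by positivity
    exact (Real.rpow_le_rpow_of_exponent_le hx (by linarith)).trans
      (Real.rpow_le_rpow (norm_nonneg _) (EikonalPhase.norm_le_jap _) (by linarith))
  · exact EikonalPhase.contDiff_reflect ε (T.contDiff_cutPhase ha (by linarith))
  · exact congrArg (fun t => ((ε : ℤ) : ℝ) * t) (T.cutPhase_eq ha hb (by linarith) hσ'.le
      ((EikonalPhase.flip_mem_region ε).2 hp))
  · have hR0 : 0 < R := by linarith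
    refine EikonalPhase.SolvesEikonal.reflect ε (T.contDiff_cutPhase ha hR0) fun p hp => ?_
    -- The eikonal equation involves derivatives, so the two phases must agree near `p`, which the
    -- openness of the region provides.
    have h1 : T.cutPhase R =ᶠ[nhds p] T.phase := Filter.eventuallyEq_of_mem
      ((EikonalPhase.isOpen_region_one ha hR0).mem_nhds hp)
      fun q hq => T.cutPhase_eq ha hb hR0 hσ'.le hq
    have h2 : EikonalPhase.gradX (T.cutPhase R) p = EikonalPhase.gradX T.phase p := by
      ext1 i
      rw [EikonalPhase.gradX, EikonalPhase.gradX, h1.fderiv_eq]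
    rw [h2]
    exact heik σ hσ'.le p ⟨lt_of_le_of_lt (by linarith) hp.1, hp.2⟩
  · obtain ⟨C, hC0, hC⟩ := T.exists_mixedDeriv_cutCorrection_bound hμ1 ha hb α β
    set e : ℝ := 1 - μ - (EikonalPhase.order α : ℝ) with he
    refine ⟨C * 2 ^ |e| + 1, by positivity, fun ε R hR p => ?_⟩
    have hR0 : 0 < R := by linarith
    have hj : 0 < EikonalPhase.jap p.1 := one_pos.trans_le (EikonalPhase.one_le_jap _)
    have hsm := T.contDiff_cutCorrection ha hR0
    rw [EikonalPhase.deviation_reflect, hdevR, EikonalPhase.abs_mixedDeriv_reflect ε hsm]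
    obtain ⟨h1, h2⟩ := hC R (by linarith) (EikonalPhase.flip n ε p)
    rcases lt_or_ge ‖p.1‖ (R / 2) with hp | hp
    · rw [h1 hp, abs_zero]
      exact ⟨by positivity, fun _ => by positivity⟩
    · have h3 := h2 hp
      rw [EikonalPhase.flip_apply] at h3
      have hx : 1 ≤ ‖p.1‖ := by linarith
      have key : ∀ t : ℝ, 0 ≤ t → ‖p.1‖ ^ e ≤ 2 ^ |e| * t →
          |EikonalPhase.mixedDeriv α β (T.cutCorrection R) (EikonalPhase.flip n ε p)| ≤
            (C * 2 ^ |e| + 1) * t := by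
        intro t ht h
        refine (h3.trans (mul_le_mul_of_nonneg_left h hC0)).trans ?_
        nlinarith
      have h4 := EikonalPhase.norm_rpow_le_jap_rpow hx e
      refine ⟨key _ (by positivity) h4, fun hα => key _ (by positivity) ?_⟩
      rw [mul_min_of_nonneg _ _ (by positivity)]
      refine le_min h4 ?_
      have h5 : 1 ≤ EikonalPhase.order α := by
        by_contra h
        refine hα (funext fun i => ?_)
        exact Finset.sum_eq_zero_iff.1 (Nat.lt_one_iff.1 (not_le.1 h)) i (Finset.mem_univ i)
      have h6 : e ≤ 0 := by
        have : (1 : ℝ) ≤ EikonalPhase.order α := by exact_mod_cast h5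
        linarith
      -- For `α ≠ 0` the exponent is negative, and on the support of the correction `|x| ≥ R/2`;
      -- this is the source of the second entry of the minimum.
      have h7 : ‖p.1‖ ^ e ≤ (R / 2) ^ e :=
        Real.rpow_le_rpow_of_nonpos (by positivity) hp h6
      rw [abs_of_nonpos h6, Real.rpow_neg zero_le_two]
      rwa [Real.div_rpow hR0.le zero_le_two, div_eq_inv_mul] at h7
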